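/- Let $q\ge 4$ be even, $k\ge 2$, $d=5q^k$, $\Delta=d+1$, $t=(q^k-q)^{1/\Delta}$. Let $B=(B_{ij})_{0\le i,j\le q}$ be the symmetric matrix with $B_{00}=t^2$, $B_{0i}=B_{i0}=t$, $B_{ii}=0$ for $1\le i\le q$, and $B_{ij}=1$ for distinct $i,j\in\{1,\dots,q\}$. For an integer $n$, let $G$ be uniformly random among the (simple, labelled) $\Delta$-regular bipartite graphs with $n$ vertices on each side. For vectors $a,b\in\mathbb{Z}_{\ge0}^{q+1}$ with $\sum_i a_i=\sum_i b_i=n$, let $Z^{a,b}(G)$ be the sum, over all assignments $\sigma$ of colours $0,\dots,q$ to the vertices that use colour $i$ exactly $a_i$ times on the left and $b_i$ times on the right, of $\prod_{uv\in E(G)}B_{\sigma(u)\sigma(v)}$. For probability vectors $\alpha,\beta$ on $\{0,\dots,q\}$ put $$\Psi_1(\alpha,\beta)=\lim \frac1n\log \mathbb{E}\big[Z^{a,b}(G)\big],$$ the limit being taken as $n\to\infty$, $a/n\to\alpha$, $b/n\to\beta$, whenever it exists. A positive fixpoint of the tree recursion is a pair of vectors $R=(R_0,\dots,R_q)$, $C=(C_0,\dots,C_q)$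 with positive entries such that, for some constants $A,A'$ and all $1\le i\le q$, $$R_0=A\,t^d\Big(tC_0+\sum_{j=1}^qC_j\Big)^d,\quad R_i=A\Big(tC_0+\sum_{1\le j\le q,\ j\ne i}C_j\Big)^d,$$ $$C_0=A'\,t^d\Big(tR_0+\sum_{j=1}^qR_j\Big)^d,\quad C_i=A'\Big(tR_0+\sum_{1\le j\le q,\ j\ne i}R_j\Big)^d.$$ It is of type $(q_1,q_2,q_3)$ if the non-zero numbers among $q_1,q_2,q_3$ are, up to order, the multiplicities of the distinct values among $R_1,\dots,R_q$. The value of $\Psi_1$ at the fixpoint is $\Psi_1(\alpha,\beta)$, where $\alpha_i=R_i^{p}/\sum_jR_j^{p}$, $\beta_i=C_i^{p}/\sum_jC_j^{p}$ and $p=\Delta/(\Delta-1)$. Then the limit defining $\Psi_1$ exists at every positive fixpoint, and the maximum of $\Psi_1$ over all positive fixpoints is attained, uniquely at the type $(q/2,q/2,0)$: there is a positive fixpoint of type $(q/2,q/2,0)$ at which $\Psi_1$ is at least its value at every positive fixpoint, and every positive fixpoint at which $\Psi_1$ takes this maximal value is of type $(q/2,q/2,0)$. -/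

import Mathlib

open Filter Topology

namespace HypergraphColouring

/-- The weight `t = (q^k - q)^{1/Δ}` of the special colour `0`, where `Δ = d + 1`. -/
noncomputable def tParam (q k d : ℕ) : ℝ :=
  ((q : ℝ) ^ k - (q : ℝ)) ^ ((1 : ℝ) / ((d : ℝ) + 1))

/-- The interaction matrix on the colours `{0, 1, …, q}`: `B₀₀ = t²`, `B₀ᵢ = Bᵢ₀ = t`, `Bᵢᵢ = 0`
and `Bᵢⱼ = 1` for distinct `i, j ≥ 1`. -/
noncomputable def interaction (q k d : ℕ) : Matrix (Fin (q + 1)) (Fin (q + 1)) ℝ :=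
  fun i j =>
    if i = 0 then (if j = 0 then tParam q k d ^ 2 else tParam q k d)
    else if j = 0 then tParam q k d
    else if i = j then 0 else 1

section RandomGraphs

open scoped Classical in
/-- The `Δ`-regular bipartite (simple, labelled) graphs with `n` vertices on each side. -/
noncomputable def regularBipartite (Δ n : ℕ) : Finset (SimpleGraph (Fin n ⊕ Fin n)) :=
  Finset.univ.filter fun G =>
    G ≤ completeBipartiteGraph (Fin n) (Fin n) ∧ G.IsRegularOfDegree Δ

open scoped Classical in
/-- The weight of the assignment `(σ, τ)` on a bipartite graph: the product over all edges of the
interaction of the colours of the two end points. -/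
noncomputable def weight {q n : ℕ} (B : Matrix (Fin (q + 1)) (Fin (q + 1)) ℝ)
    (G : SimpleGraph (Fin n ⊕ Fin n)) (σ τ : Fin n → Fin (q + 1)) : ℝ :=
  ∏ u : Fin n, ∏ v : Fin n, if G.Adj (Sum.inl u) (Sum.inr v) then B (σ u) (τ v) else 1

/-- The assignments of `q + 1` colours to `n` vertices in which colour `i` is used exactly `a i`
times. -/
def assignments {q : ℕ} (n : ℕ) (a : Fin (q + 1) → ℕ) : Finset (Fin n → Fin (q + 1)) :=
  Finset.univ.filter fun σ => ∀ i, (Finset.univ.filter fun u => σ u = i).card = a i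

/-- The total weight of the assignments with colour counts `a` on the left and `b` on the right. -/
noncomputable def partitionFunction {q n : ℕ} (B : Matrix (Fin (q + 1)) (Fin (q + 1)) ℝ)
    (a b : Fin (q + 1) → ℕ) (G : SimpleGraph (Fin n ⊕ Fin n)) : ℝ :=
  ∑ σ ∈ assignments n a, ∑ τ ∈ assignments n b, weight B G σ τ

/-- The expectation of `partitionFunction B a b G` for `G` uniform in `regularBipartite Δ n`. -/
noncomputable def firstMoment {q : ℕ} (B : Matrix (Fin (q + 1)) (Fin (q + 1)) ℝ) (Δ n : ℕ)
    (a b : Fin (q + 1) → ℕ) : ℝ :=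
  (∑ G ∈ regularBipartite Δ n, partitionFunction B a b G) / ((regularBipartite Δ n).card : ℝ)

/-- `(1/n) log E[Z^{a,b}(G)]` as a function of `(n, a, b)`. -/
noncomputable def logFirstMoment {q : ℕ} (B : Matrix (Fin (q + 1)) (Fin (q + 1)) ℝ) (Δ : ℕ)
    (x : ℕ × (Fin (q + 1) → ℕ) × (Fin (q + 1) → ℕ)) : ℝ :=
  (1 / (x.1 : ℝ)) * Real.log (firstMoment B Δ x.1 x.2.1 x.2.2)

/-- The limit process behind `Ψ₁(α, β)`: `n → ∞`, with integer colour counts `a`, `b` of total `n`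
on the two sides whose fractions `a / n`, `b / n` tend to `α`, `β`. (For irrational `α` no
assignment has colour fractions exactly `α`.) -/
noncomputable def phaseFilter {q : ℕ} (α β : Fin (q + 1) → ℝ) :
    Filter (ℕ × (Fin (q + 1) → ℕ) × (Fin (q + 1) → ℕ)) :=
  comap (fun x => x.1) atTop
    ⊓ comap (fun x => fun i => (x.2.1 i : ℝ) / (x.1 : ℝ)) (𝓝 α)
    ⊓ comap (fun x => fun i => (x.2.2 i : ℝ) / (x.1 : ℝ)) (𝓝 β)
    ⊓ 𝓟 {x | ∑ i, x.2.1 i = x.1 ∧ ∑ i, x.2.2 i = x.1}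

/-- `Ψ₁(α, β) = lim (1/n) log E[Z^{α,β}(G)]`, the exponential growth rate of the first moment on
random `Δ`-regular bipartite graphs. -/
noncomputable def Psi1 {q : ℕ} (B : Matrix (Fin (q + 1)) (Fin (q + 1)) ℝ) (Δ : ℕ)
    (α β : Fin (q + 1) → ℝ) : ℝ :=
  limUnder (phaseFilter α β) (logFirstMoment B Δ)

end RandomGraphs

/-- Positive fixpoints `(R, C)` of the tree recursion; each of `R`, `C` is prescribed up to a
factor. -/
structure IsPosFixpoint (q k d : ℕ) (R C : Fin (q + 1) → ℝ) : Prop where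
  R_pos : ∀ i, 0 < R i
  C_pos : ∀ i, 0 < C i
  R_eq : ∃ A : ℝ,
    R 0 = A * (tParam q k d ^ d * (tParam q k d * C 0 + ∑ j : Fin q, C j.succ) ^ d) ∧
    ∀ i : Fin q,
      R i.succ = A * (tParam q k d * C 0 + ∑ j ∈ Finset.univ.erase i, C j.succ) ^ d
  C_eq : ∃ A : ℝ,
    C 0 = A * (tParam q k d ^ d * (tParam q k d * R 0 + ∑ i : Fin q, R i.succ) ^ d) ∧
    ∀ j : Fin q,
      C j.succ = A * (tParam q k d * R 0 + ∑ i ∈ Finset.univ.erase j, R i.succ) ^ d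

/-- `R` is of type `(q₁, q₂, q₃)`: the nonzero ones among `q₁, q₂, q₃` are, up to order, the
multiplicities of the distinct values among `R₁, …, R_q`. -/
def HasType {q : ℕ} (R : Fin (q + 1) → ℝ) (q₁ q₂ q₃ : ℕ) : Prop :=
  (Finset.univ.image fun i : Fin q => R i.succ).val.map
      (fun v => (Finset.univ.filter fun i : Fin q => R i.succ = v).card)
    = ({q₁, q₂, q₃} : Multiset ℕ).filter (fun m => m ≠ 0)

/-- The colour fractions `αᵢ = Rᵢ^p / ∑ⱼ Rⱼ^p`, with `p = (d + 1) / d`, attached to `R`. -/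
noncomputable def phase {q : ℕ} (d : ℕ) (R : Fin (q + 1) → ℝ) : Fin (q + 1) → ℝ :=
  fun i => R i ^ (((d : ℝ) + 1) / (d : ℝ)) / ∑ j, R j ^ (((d : ℝ) + 1) / (d : ℝ))

/-- The value of `Ψ₁` at the phase corresponding to `(R, C)`, for the degree `Δ = d + 1`. -/
noncomputable def psi1At (q k d : ℕ) (R C : Fin (q + 1) → ℝ) : ℝ :=
  Psi1 (interaction q k d) (d + 1) (phase d R) (phase d C)

end HypergraphColouring

open HypergraphColouring

/-!
*The rate at a fixpoint.* A bipartite graph with ordered neighbourhoods is a map from the left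
half-edges to the right vertices, so the first moment is, up to the effect of multiple edges, a sum
over pairs of colourings of the half-edges. Forbidding multiple edges costs only a polynomial
factor, since rearranging the half-edges within each colour class does not change the weight. For
positive `z`, the saddle point bound for the rate is
`H(α) - d H(β) + Δ (∑ αᵢ log ∑ⱼ Bᵢⱼ zⱼ - ∑ βⱼ log zⱼ)`, where `H` is the entropy; it is sharp when
the edge distribution `αᵢ Bᵢⱼ zⱼ / ∑ₗ Bᵢₗ zₗ` has second marginal `β`. At a fixpoint `z = C` has
this property, hence `Ψ₁ = Δ log (Rᵀ B C) - d log ∑ Rᵢ ^ p - d log ∑ Cⱼ ^ p`.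

*The maximum.* After scaling `R` and `C` to total weight `1`, this quantity depends on the messages
of the colours `1, …, q` only through the averages of `(ξ, ξ ^ p, η, η ^ p, ξ η)` over the pairs
`(ξ, η) = (Rᵢ, Cᵢ)`. Relax to all distributions of pairs on a box; the averages then form a compact
convex set, on which a maximum exists. At a maximum the linearised rate is largest at every atom,
which yields `x = A (1 - y) ^ d` and `y = A' (1 - x) ^ d`; comparing the atom `(x, y)` with
`(y, x)` gives `A = A'`. As `d A ≥ 5 > e`, an atom on the diagonal can be improved by moving its
two messages apart, so no atom has `x = y`. Finally `x ↦ A (1 - x) ^ d` has at most one cycle of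
length two, because four fixpoints of its second iterate would contradict the strict concavity of
`log ((1 - x) ^ (d - 1) (1 + (d² - 1) x))`. Thus the optimal distribution lives on `(a, b)` and
`(b, a)`, and equality of the two normalisations forces weight `1/2` on each. For even `q` this is
realised by a fixpoint of type `(q/2, q/2, 0)`, and every other fixpoint with the same rate
realises such a distribution as well.
-/

namespace HypergraphColouring

open scoped BigOperators

section Counting

variable {E κ : Type*} [Fintype E] [DecidableEq E] [Fintype κ] [DecidableEq κ]

/-- The functions whose fibre over `j` has `m j` elements. -/
def functionsWithCounts (E : Type*) [Fintype E] [DecidableEq E] {κ : Type*} [Fintype κ]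
    [DecidableEq κ] (m : κ → ℕ) : Finset (E → κ) :=
  Finset.univ.filter fun c => ∀ j, (Finset.univ.filter fun e => c e = j).card = m j

theorem mem_functionsWithCounts {m : κ → ℕ} {c : E → κ} :
    c ∈ functionsWithCounts E m ↔ ∀ j, (Finset.univ.filter fun e => c e = j).card = m j := by
  simp [functionsWithCounts]

theorem exists_perm_comp_eq {m : κ → ℕ} {c c' : E → κ} (hc : c ∈ functionsWithCounts E m)
    (hc' : c' ∈ functionsWithCounts E m) : ∃ π : Equiv.Perm E, c ∘ π = c' := by
  rw [mem_functionsWithCounts] at hc hc'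
  have hfiber : ∀ j, Nonempty ({x // c' x = j} ≃ {x // c x = j}) := fun j => by
    refine ⟨Fintype.equivOfCardEq ?_⟩
    rw [Fintype.card_subtype, Fintype.card_subtype, hc, hc']
  exact ⟨Equiv.ofFiberEquiv fun j => (hfiber j).some,
    funext fun x => Equiv.ofFiberEquiv_map _ x⟩

theorem comp_perm_mem_functionsWithCounts {m : κ → ℕ} {c : E → κ} (π : Equiv.Perm E) :
    c ∘ π ∈ functionsWithCounts E m ↔ c ∈ functionsWithCounts E m := by
  simp only [mem_functionsWithCounts]
  refine forall_congr' fun j => ?_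
  rw [Finset.card_equiv π (s := Finset.univ.filter fun e => (c ∘ π) e = j)
    (t := Finset.univ.filter fun e => c e = j) (by simp)]

theorem card_perm_comp_eq {m : κ → ℕ} {c c' : E → κ} (hc : c ∈ functionsWithCounts E m)
    (hc' : c' ∈ functionsWithCounts E m) :
    (Finset.univ.filter fun π : Equiv.Perm E => c ∘ π = c').card = ∏ j, (m j).factorial := by
  obtain ⟨π₀, rfl⟩ := exists_perm_comp_eq hc hc'
  have hstab := DomMulAct.stabilizer_card c
  simp only [Fintype.card_subtype, mem_functionsWithCounts.1 hc] at hstab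
  rw [← hstab]
  refine Finset.card_equiv (Equiv.mulRight π₀⁻¹) fun π => ?_
  simp only [Finset.mem_filter, Finset.mem_univ, true_and, Equiv.coe_mulRight, Equiv.Perm.coe_mul]
  exact ⟨fun h => funext fun e => by simpa using congrFun h (π₀⁻¹ e),
    fun h => funext fun e => by simpa using congrFun h (π₀ e)⟩

theorem functionsWithCounts_nonempty {m : κ → ℕ} (hm : ∑ j, m j = Fintype.card E) :
    (functionsWithCounts E m).Nonempty := by
  let e : E ≃ Σ j, Fin (m j) := Fintype.equivOfCardEq (by simp [hm])
  refine ⟨fun x => (e x).1, mem_functionsWithCounts.2 fun j => ?_⟩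
  calc (Finset.univ.filter fun x => (e x).1 = j).card
      = (Finset.univ.filter fun y : Σ j, Fin (m j) => y.1 = j).card :=
        Finset.card_equiv e (by simp)
    _ = Fintype.card {y : Σ j, Fin (m j) // y.1 = j} := (Fintype.card_subtype _).symm
    _ = m j := by rw [Fintype.card_congr (Equiv.sigmaSubtype j), Fintype.card_fin]

theorem card_functionsWithCounts {m : κ → ℕ} (hm : ∑ j, m j = Fintype.card E) :
    (functionsWithCounts E m).card = Nat.multinomial Finset.univ m := by
  obtain ⟨c, hc⟩ := functionsWithCounts_nonempty hm
  refine Nat.eq_of_mul_eq_mul_left (n := ∏ j, (m j).factorial)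
    (Finset.prod_pos fun j _ => Nat.factorial_pos (m j)) ?_
  rw [Nat.multinomial_spec, hm, ← Fintype.card_perm, ← Finset.card_univ,
    Finset.card_eq_sum_card_fiberwise (f := fun π : Equiv.Perm E => c ∘ π)
      fun π _ => (comp_perm_mem_functionsWithCounts π).2 hc,
    Finset.sum_congr rfl fun c' hc' => card_perm_comp_eq hc hc', Finset.sum_const, smul_eq_mul,
    mul_comm]

theorem sum_counts_eq_card {m : κ → ℕ} {c : E → κ} (hc : c ∈ functionsWithCounts E m) :
    ∑ j, m j = Fintype.card E := by
  rw [← Finset.card_univ, Finset.card_eq_sum_card_fiberwise (f := c) (t := Finset.univ)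
    (fun _ _ => Finset.mem_coe.2 (Finset.mem_univ _))]
  exact Finset.sum_congr rfl fun j _ => (mem_functionsWithCounts.1 hc j).symm

theorem expect_perm_comp {m : κ → ℕ} {c : E → κ} (hc : c ∈ functionsWithCounts E m)
    (Φ : (E → κ) → ℝ) :
    𝔼 π : Equiv.Perm E, Φ (c ∘ π) = 𝔼 c' ∈ functionsWithCounts E m, Φ c' := by
  have hsum : ∑ π : Equiv.Perm E, Φ (c ∘ π) =
      ((∏ j, (m j).factorial : ℕ) : ℝ) * ∑ c' ∈ functionsWithCounts E m, Φ c' := by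
    rw [← Finset.sum_fiberwise_of_maps_to (s := Finset.univ) (t := functionsWithCounts E m)
      (g := fun π : Equiv.Perm E => c ∘ π)
      (fun π _ => (comp_perm_mem_functionsWithCounts π).2 hc), Finset.mul_sum]
    refine Finset.sum_congr rfl fun c' hc' => ?_
    rw [Finset.sum_congr rfl (g := fun _ => Φ c') fun π hπ => by
      rw [(Finset.mem_filter.1 hπ).2], Finset.sum_const, card_perm_comp_eq hc hc', nsmul_eq_mul]
  have hfactorial : ((∏ j, (m j).factorial : ℕ) : ℝ) ≠ 0 :=
    Nat.cast_ne_zero.2 (Finset.prod_ne_zero_iff.2 fun j _ => Nat.factorial_ne_zero (m j))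
  rw [Finset.expect_eq_sum_div_card, Finset.expect_eq_sum_div_card, hsum,
    card_functionsWithCounts (sum_counts_eq_card hc), Finset.card_univ, Fintype.card_perm,
    ← sum_counts_eq_card hc, ← Nat.multinomial_spec, Nat.cast_mul, mul_div_mul_left _ _ hfactorial]

theorem prod_comp_of_counts {m : κ → ℕ} {c : E → κ} (hc : c ∈ functionsWithCounts E m)
    (f : κ → ℝ) : ∏ e, f (c e) = ∏ j, f j ^ m j := by
  rw [← Finset.prod_fiberwise (Finset.univ : Finset E) c fun e => f (c e)]
  refine Finset.prod_congr rfl fun j _ => ?_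
  rw [← mem_functionsWithCounts.1 hc j]
  exact Finset.prod_eq_pow_card fun e he => by rw [(Finset.mem_filter.1 he).2]

theorem comp_mem_functionsWithCounts {ι : Type*} [Fintype ι] [DecidableEq ι] {m : κ → ℕ}
    {c : E → κ} (hc : c ∈ functionsWithCounts E m) (f : κ → ι) :
    f ∘ c ∈ functionsWithCounts E fun i => ∑ j with f j = i, m j := by
  refine mem_functionsWithCounts.2 fun i => ?_
  rw [Finset.card_eq_sum_card_fiberwise (f := c) (t := Finset.univ.filter fun j => f j = i)
    fun e he => by simpa using he]
  refine Finset.sum_congr rfl fun j hj => ?_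
  rw [← mem_functionsWithCounts.1 hc j, Finset.filter_filter]
  refine congrArg Finset.card (Finset.filter_congr fun e _ => ?_)
  exact ⟨And.right, fun h => ⟨by rw [Function.comp_apply, h]; exact (Finset.mem_filter.1 hj).2, h⟩⟩

end Counting

section PairMeans

variable {E I J : Type*} [Fintype E] [DecidableEq E] [Fintype J] [DecidableEq J]

/-- The mean weight of a uniform right colouring with fibre sizes `b`, for a given left colouring
`s`. -/
noncomputable def pairMean (B : I → J → ℝ) (b : J → ℕ) (s : E → I) : ℝ :=
  𝔼 c ∈ functionsWithCounts E b, ∏ e, B (s e) (c e)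

theorem pairMean_comp_perm (B : I → J → ℝ) (b : J → ℕ) (s : E → I) (π : Equiv.Perm E) :
    pairMean B b (s ∘ π) = pairMean B b s :=
  Finset.expect_equiv (π.arrowCongr (Equiv.refl J))
    (fun _ => (comp_perm_mem_functionsWithCounts π.symm).symm)
    fun _ _ => Fintype.prod_equiv π _ _ fun e => by simp

theorem multinomial_mul_pairMean (B : I → J → ℝ) {b : J → ℕ} (hb : ∑ j, b j = Fintype.card E)
    (s : E → I) :
    Nat.multinomial Finset.univ b * pairMean B b s =
      ∑ c ∈ functionsWithCounts E b, ∏ e, B (s e) (c e) := by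
  rw [← card_functionsWithCounts hb, pairMean, Finset.card_mul_expect]

variable [Fintype I] [DecidableEq I]

/-- The saddle point upper bound: the right-hand side generates the sums over the right colourings
with the weights `∏ z j ^ b j`. -/
theorem multinomial_mul_pairMean_le {B : I → J → ℝ} (hB : ∀ i j, 0 ≤ B i j) {a : I → ℕ}
    {b : J → ℕ} (hb : ∑ j, b j = Fintype.card E) {s : E → I} (hs : s ∈ functionsWithCounts E a)
    {z : J → ℝ} (hz : ∀ j, 0 ≤ z j) :
    Nat.multinomial Finset.univ b * pairMean B b s * ∏ j, z j ^ b j ≤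
      ∏ i, (∑ j, B i j * z j) ^ a i := by
  calc Nat.multinomial Finset.univ b * pairMean B b s * ∏ j, z j ^ b j
      = ∑ c ∈ functionsWithCounts E b, ∏ e, (B (s e) (c e) * z (c e)) := by
        rw [multinomial_mul_pairMean B hb, Finset.sum_mul]
        refine Finset.sum_congr rfl fun c hc => ?_
        rw [Finset.prod_mul_distrib, prod_comp_of_counts hc z]
    _ ≤ ∑ c : E → J, ∏ e, (B (s e) (c e) * z (c e)) :=
        Finset.sum_le_univ_sum_of_nonneg fun c =>
          Finset.prod_nonneg fun e _ => mul_nonneg (hB _ _) (hz _)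
    _ = ∏ i, (∑ j, B i j * z j) ^ a i := by
        rw [← prod_comp_of_counts hs fun i => ∑ j, B i j * z j, Finset.prod_univ_sum,
          Fintype.piFinset_univ]

theorem multinomial_mul_multinomial_mul_pairMean (B : I → J → ℝ) {a : I → ℕ} {b : J → ℕ}
    (hb : ∑ j, b j = Fintype.card E) {s : E → I} (hs : s ∈ functionsWithCounts E a) :
    Nat.multinomial Finset.univ a * Nat.multinomial Finset.univ b * pairMean B b s =
      ∑ s' ∈ functionsWithCounts E a, ∑ c ∈ functionsWithCounts E b, ∏ e, B (s' e) (c e) := by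
  have hconst : ∀ s' ∈ functionsWithCounts E a,
      ∑ c ∈ functionsWithCounts E b, ∏ e, B (s' e) (c e) =
        Nat.multinomial Finset.univ b * pairMean B b s := fun s' hs' => by
    obtain ⟨π, rfl⟩ := exists_perm_comp_eq hs hs'
    rw [← multinomial_mul_pairMean B hb, pairMean_comp_perm]
  rw [Finset.sum_congr rfl hconst, Finset.sum_const,
    card_functionsWithCounts (sum_counts_eq_card hs), nsmul_eq_mul, mul_assoc]

theorem card_mul_prod_le {B : I → J → ℝ} (hB : ∀ i j, 0 ≤ B i j) {a : I → ℕ}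
    {b : J → ℕ} {N : I × J → ℕ} (hrow : ∀ i, ∑ j, N (i, j) = a i)
    (hcol : ∀ j, ∑ i, N (i, j) = b j) :
    ((functionsWithCounts E N).card : ℝ) * ∏ x, B x.1 x.2 ^ N x
      ≤ ∑ s ∈ functionsWithCounts E a, ∑ c ∈ functionsWithCounts E b, ∏ e, B (s e) (c e) := by
  have hfst : ∀ g ∈ functionsWithCounts E N, Prod.fst ∘ g ∈ functionsWithCounts E a :=
    fun g hg => by
      have hcounts : (fun i => ∑ x with x.1 = i, N x) = a := funext fun i => by
        rw [← hrow i, Finset.sum_filter, Fintype.sum_prod_type_right]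
        simp only [Finset.sum_ite_eq', Finset.mem_univ, if_true]
      exact hcounts ▸ comp_mem_functionsWithCounts hg Prod.fst
  have hsnd : ∀ g ∈ functionsWithCounts E N, Prod.snd ∘ g ∈ functionsWithCounts E b :=
    fun g hg => by
      have hcounts : (fun j => ∑ x with x.2 = j, N x) = b := funext fun j => by
        rw [← hcol j, Finset.sum_filter, Fintype.sum_prod_type]
        simp only [Finset.sum_ite_eq', Finset.mem_univ, if_true]
      exact hcounts ▸ comp_mem_functionsWithCounts hg Prod.snd
  have hinj : Function.Injective fun g : E → I × J => (Prod.fst ∘ g, Prod.snd ∘ g) :=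
    fun g g' h => funext fun e =>
      Prod.ext (congrFun (congrArg Prod.fst h) e) (congrFun (congrArg Prod.snd h) e)
  calc ((functionsWithCounts E N).card : ℝ) * ∏ x, B x.1 x.2 ^ N x
      = ∑ g ∈ functionsWithCounts E N, ∏ e, B (g e).1 (g e).2 := by
        rw [← nsmul_eq_mul, ← Finset.sum_const]
        exact Finset.sum_congr rfl fun g hg => (prod_comp_of_counts hg fun x => B x.1 x.2).symm
    _ = ∑ y ∈ (functionsWithCounts E N).map ⟨_, hinj⟩, ∏ e, B (y.1 e) (y.2 e) := by
        rw [Finset.sum_map]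
        rfl
    _ ≤ ∑ y ∈ functionsWithCounts E a ×ˢ functionsWithCounts E b, ∏ e, B (y.1 e) (y.2 e) := by
        refine Finset.sum_le_sum_of_subset_of_nonneg (fun y hy => ?_)
          fun y _ _ => Finset.prod_nonneg fun e _ => hB _ _
        obtain ⟨g, hg, rfl⟩ := Finset.mem_map.1 hy
        exact Finset.mem_product.2 ⟨hfst g hg, hsnd g hg⟩
    _ = ∑ s ∈ functionsWithCounts E a, ∑ c ∈ functionsWithCounts E b, ∏ e, B (s e) (c e) :=
        Finset.sum_product _ _ _

theorem multinomial_mul_prod_le {B : I → J → ℝ} (hB : ∀ i j, 0 ≤ B i j) {a : I → ℕ} {b : J → ℕ}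
    {s : E → I} (hs : s ∈ functionsWithCounts E a) {N : I × J → ℕ}
    (hrow : ∀ i, ∑ j, N (i, j) = a i) (hcol : ∀ j, ∑ i, N (i, j) = b j) :
    Nat.multinomial Finset.univ N * ∏ x, B x.1 x.2 ^ N x ≤
      Nat.multinomial Finset.univ a * Nat.multinomial Finset.univ b * pairMean B b s := by
  have hN : ∑ x, N x = Fintype.card E := by
    rw [Fintype.sum_prod_type, ← sum_counts_eq_card hs]
    exact Finset.sum_congr rfl fun i _ => hrow i
  have hb : ∑ j, b j = Fintype.card E := by
    rw [← hN, Fintype.sum_prod_type_right]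
    exact (Finset.sum_congr rfl fun j _ => hcol j).symm
  rw [multinomial_mul_multinomial_mul_pairMean B hb hs, ← card_functionsWithCounts hN]
  exact card_mul_prod_le hB hrow hcol

end PairMeans

section Grids

variable {α V : Type*} [Fintype α] [DecidableEq V] {φ : α → V} {Δ : ℕ}

theorem le_card_filter_forall_ne (hφ : ∀ v, (Finset.univ.filter fun x => φ x = v).card ≤ Δ) {j : ℕ}
    (S : Finset α) (r : Fin j → α) :
    S.card - j * Δ ≤ (S.filter fun x => ∀ k, φ x ≠ φ (r k)).card := by
  classical
  have hbad : (S.filter fun x => ¬ ∀ k, φ x ≠ φ (r k)).card ≤ j * Δ := by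
    calc (S.filter fun x => ¬ ∀ k, φ x ≠ φ (r k)).card
        ≤ (Finset.univ.biUnion fun k : Fin j =>
            Finset.univ.filter fun x => φ x = φ (r k)).card := by
          refine Finset.card_le_card fun x hx => ?_
          have hlabel := (Finset.mem_filter.1 hx).2
          push Not at hlabel
          simpa using hlabel
      _ ≤ (Finset.univ : Finset (Fin j)).card * Δ :=
          Finset.card_biUnion_le_card_mul _ _ _ fun k _ => hφ _
      _ = j * Δ := by rw [Finset.card_univ, Fintype.card_fin]
  have hsplit := Finset.card_filter_add_card_filter_not (s := S) (fun x => ∀ k, φ x ≠ φ (r k))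
  omega

variable [DecidableEq α]

/-- The sequences of `j` elements of `S` with distinct labels. -/
def rows (φ : α → V) (j : ℕ) (S : Finset α) : Finset (Fin j → α) :=
  Finset.univ.filter fun r => (∀ k, r k ∈ S) ∧ Function.Injective (φ ∘ r)

/-- The arrangements of elements of `S` without repetition in rows of length `Δ`, indexed by `ρ`,
such that the labels in each row are distinct. -/
def grids (φ : α → V) (Δ : ℕ) (ρ : Type*) [Fintype ρ] [DecidableEq ρ] (S : Finset α) :
    Finset (ρ → Fin Δ → α) :=
  Finset.univ.filter fun h => (∀ u, h u ∈ rows φ Δ S) ∧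
    Function.Injective fun x : ρ × Fin Δ => h x.1 x.2

theorem mem_rows {j : ℕ} {S : Finset α} {r : Fin j → α} :
    r ∈ rows φ j S ↔ (∀ k, r k ∈ S) ∧ Function.Injective (φ ∘ r) := by
  simp [rows]

theorem mem_grids {ρ : Type*} [Fintype ρ] [DecidableEq ρ] {S : Finset α}
    {h : ρ → Fin Δ → α} : h ∈ grids φ Δ ρ S ↔ (∀ u, h u ∈ rows φ Δ S) ∧
      Function.Injective fun x : ρ × Fin Δ => h x.1 x.2 := by
  simp [grids]

theorem injective_of_mem_rows {j : ℕ} {S : Finset α} {r : Fin j → α} (hr : r ∈ rows φ j S) :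
    Function.Injective r :=
  Function.Injective.of_comp (mem_rows.1 hr).2

theorem rows_subset_rows {j : ℕ} {S T : Finset α} (h : S ⊆ T) : rows φ j S ⊆ rows φ j T :=
  fun _ hr => mem_rows.2 ⟨fun k => h ((mem_rows.1 hr).1 k), (mem_rows.1 hr).2⟩

theorem cons_mem_rows {j : ℕ} {S : Finset α} {r : Fin j → α} {x : α} (hr : r ∈ rows φ j S)
    (hx : x ∈ S) (hxr : ∀ k, φ x ≠ φ (r k)) :
    (Fin.cons x r : Fin (j + 1) → α) ∈ rows φ (j + 1) S := by
  obtain ⟨hrS, hinj⟩ := mem_rows.1 hr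
  refine mem_rows.2 ⟨Fin.cases hx hrS, ?_⟩
  rw [Fin.comp_cons, Fin.cons_injective_iff]
  exact ⟨fun ⟨k, hk⟩ => hxr k hk.symm, hinj⟩

theorem card_rows_succ (hφ : ∀ v, (Finset.univ.filter fun x => φ x = v).card ≤ Δ) (j : ℕ)
    (S : Finset α) : (S.card - j * Δ) * (rows φ j S).card ≤ (rows φ (j + 1) S).card := by
  calc (S.card - j * Δ) * (rows φ j S).card
      ≤ ((rows φ j S).sigma fun r => S.filter fun x => ∀ k, φ x ≠ φ (r k)).card := by
        rw [Finset.card_sigma, mul_comm, ← smul_eq_mul]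
        exact Finset.card_nsmul_le_sum _ _ _ fun r _ => le_card_filter_forall_ne hφ S r
    _ ≤ (rows φ (j + 1) S).card := by
        refine Finset.card_le_card_of_injOn
          (fun y : (_ : Fin j → α) × α => (Fin.cons y.2 y.1 : Fin (j + 1) → α)) ?_ ?_
        · rintro ⟨r, x⟩ hy
          obtain ⟨hr, hx⟩ := Finset.mem_sigma.1 (Finset.mem_coe.1 hy)
          obtain ⟨hxS, hxr⟩ := Finset.mem_filter.1 hx
          exact cons_mem_rows hr hxS hxr
        · rintro ⟨r, x⟩ - ⟨r', x'⟩ - h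
          obtain ⟨rfl, rfl⟩ := Fin.cons_inj.1 h
          rfl

theorem le_card_rows (hφ : ∀ v, (Finset.univ.filter fun x => φ x = v).card ≤ Δ) (j : ℕ)
    (S : Finset α) : (S.card - (j - 1) * Δ) ^ j ≤ (rows φ j S).card := by
  induction j with
  | zero =>
    have hempty : (rows φ 0 S).Nonempty :=
      ⟨Fin.elim0, mem_rows.2 ⟨fun k => k.elim0, fun k => k.elim0⟩⟩
    simpa using hempty.card_pos
  | succ j ih =>
    calc (S.card - (j + 1 - 1) * Δ) ^ (j + 1)
        = (S.card - j * Δ) * (S.card - j * Δ) ^ j := by rw [Nat.add_sub_cancel, pow_succ, mul_comm]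
      _ ≤ (S.card - j * Δ) * (S.card - (j - 1) * Δ) ^ j := by
          gcongr
          omega
      _ ≤ (S.card - j * Δ) * (rows φ j S).card := by gcongr
      _ ≤ _ := card_rows_succ hφ j S

theorem cons_mem_grids {a : ℕ} {S : Finset α} {r : Fin Δ → α} {h : Fin a → Fin Δ → α}
    (hr : r ∈ rows φ Δ S) (hh : h ∈ grids φ Δ (Fin a) (S \ Finset.univ.image r)) :
    (Fin.cons r h : Fin (a + 1) → Fin Δ → α) ∈ grids φ Δ (Fin (a + 1)) S := by
  obtain ⟨hrow, hinj⟩ := mem_grids.1 hh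
  have hne : ∀ u k l, h u k ≠ r l := fun u k l he =>
    (Finset.mem_sdiff.1 ((mem_rows.1 (hrow u)).1 k)).2 (by simp [he])
  refine mem_grids.2 ⟨Fin.cases hr fun u => rows_subset_rows Finset.sdiff_subset (hrow u), ?_⟩
  rintro ⟨u, k⟩ ⟨v, l⟩ he
  induction u using Fin.cases with
  | zero =>
    induction v using Fin.cases with
    | zero => exact congrArg (Prod.mk 0) (injective_of_mem_rows hr he)
    | succ v => exact absurd he.symm (hne v l k)
  | succ u =>
    induction v using Fin.cases with
    | zero => exact absurd he (hne u k l)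
    | succ v =>
      obtain ⟨rfl, rfl⟩ := Prod.mk.inj (@hinj (u, k) (v, l) he)
      rfl

theorem card_grids_succ {L a : ℕ} {S : Finset α}
    (hL : ∀ S' ⊆ S, S'.card = S.card - Δ → L ≤ (grids φ Δ (Fin a) S').card) :
    (rows φ Δ S).card * L ≤ (grids φ Δ (Fin (a + 1)) S).card := by
  have hcard : ∀ r ∈ rows φ Δ S, (S \ Finset.univ.image r).card = S.card - Δ := fun r hr => by
    rw [Finset.card_sdiff_of_subset (Finset.image_subset_iff.2 fun k _ => (mem_rows.1 hr).1 k),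
      Finset.card_image_of_injective _ (injective_of_mem_rows hr), Finset.card_univ,
      Fintype.card_fin]
  calc (rows φ Δ S).card * L
      ≤ ((rows φ Δ S).sigma fun r => grids φ Δ (Fin a) (S \ Finset.univ.image r)).card := by
        rw [Finset.card_sigma, ← smul_eq_mul]
        exact Finset.card_nsmul_le_sum _ _ _ fun r hr => hL _ Finset.sdiff_subset (hcard r hr)
    _ ≤ (grids φ Δ (Fin (a + 1)) S).card := by
        refine Finset.card_le_card_of_injOn
          (fun y : (_ : Fin Δ → α) × (Fin a → Fin Δ → α) =>
            (Fin.cons y.1 y.2 : Fin (a + 1) → Fin Δ → α)) ?_ ?_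
        · rintro ⟨r, h⟩ hy
          obtain ⟨hr, hh⟩ := Finset.mem_sigma.1 (Finset.mem_coe.1 hy)
          exact cons_mem_grids hr hh
        · rintro ⟨r, h⟩ - ⟨r', h'⟩ - he
          obtain ⟨rfl, rfl⟩ := Fin.cons_inj.1 he
          rfl

theorem card_grids_le_of_equiv {ρ ρ' : Type*} [Fintype ρ] [DecidableEq ρ]
    [Fintype ρ'] [DecidableEq ρ'] (φ : α → V) (Δ : ℕ) (e : ρ ≃ ρ') (S : Finset α) :
    (grids φ Δ ρ' S).card ≤ (grids φ Δ ρ S).card := by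
  refine Finset.card_le_card_of_injOn (fun h => h ∘ e) (fun h hh => ?_)
    fun h _ h' _ he => e.surjective.injective_comp_right he
  obtain ⟨hrow, hinj⟩ := mem_grids.1 (Finset.mem_coe.1 hh)
  exact Finset.mem_coe.2 (mem_grids.2 ⟨fun u => hrow _,
    hinj.comp (e.injective.prodMap Function.injective_id)⟩)

end Grids

section RoundRobin

variable {α V : Type*} [Fintype α] [LinearOrder V] {φ : α → V} {Δ : ℕ}

theorem apply_ne_of_add_le (hφ : ∀ v, (Finset.univ.filter fun x => φ x = v).card ≤ Δ) {n : ℕ}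
    {g : Fin n → α} (hg : Function.Injective g) (hmono : Monotone (φ ∘ g)) {i j : Fin n}
    (hij : i.val + Δ ≤ j.val) : φ (g i) ≠ φ (g j) := by
  classical
  intro heq
  have hsub : (Finset.Icc i j).image g ⊆ Finset.univ.filter fun x => φ x = φ (g i) := by
    refine Finset.image_subset_iff.2 fun l hl => ?_
    obtain ⟨hil, hlj⟩ := Finset.mem_Icc.1 hl
    exact Finset.mem_filter.2 ⟨Finset.mem_univ _,
      le_antisymm (heq ▸ hmono hlj) (hmono hil)⟩
  have hcard := (Finset.card_le_card hsub).trans (hφ _)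
  rw [Finset.card_image_of_injective _ hg, Fin.card_Icc] at hcard
  omega

variable [DecidableEq α]

/-- List the elements by label and deal them out cyclically to `a ≥ Δ` rows. -/
theorem grids_nonempty (hφ : ∀ v, (Finset.univ.filter fun x => φ x = v).card ≤ Δ) {a : ℕ}
    (ha : Δ ≤ a) {S : Finset α} (hS : S.card = Δ * a) : (grids φ Δ (Fin a) S).Nonempty := by
  have e : Fin (Δ * a) ≃ S := Fintype.equivOfCardEq (by simp [hS])
  set f : Fin (Δ * a) → V := fun i => φ (e i)
  set g : Fin (Δ * a) → α := fun i => e (Tuple.sort f i)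
  have hmono : Monotone (φ ∘ g) := Tuple.monotone_sort f
  have hinj : Function.Injective g := fun i j hij =>
    (Tuple.sort f).injective (e.injective (Subtype.ext hij))
  have hne : ∀ u, ∀ k l : Fin Δ, k < l →
      φ (g (finProdFinEquiv (k, u))) ≠ φ (g (finProdFinEquiv (l, u))) := fun u k l hkl => by
    have hshift : a * (k : ℕ) + a ≤ a * (l : ℕ) := by
      rw [← mul_add_one]
      exact Nat.mul_le_mul_left a hkl
    refine apply_ne_of_add_le hφ hinj hmono ?_
    simp only [finProdFinEquiv_apply_val]
    omega
  refine ⟨fun u k => g (finProdFinEquiv (k, u)), mem_grids.2 ⟨fun u => mem_rows.2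
    ⟨fun k => (e _).2, Function.Injective.of_lt_imp_ne fun k l => hne u k l⟩, ?_⟩⟩
  exact hinj.comp (finProdFinEquiv.injective.comp Prod.swap_injective)

/-- Dealing out one row of distinct labels loses only the factor `(1 - O(1 / a)) ^ Δ` against a row
of arbitrary elements, and the product of these factors over the rows is polynomial in `a`. -/
theorem factorial_le_card_grids (hφ : ∀ v, (Finset.univ.filter fun x => φ x = v).card ≤ Δ) {a : ℕ}
    (ha : Δ ≤ a) {S : Finset α} (hS : S.card = Δ * a) :
    (Δ * a).factorial ≤
      (Δ * Δ).factorial * a.descFactorial (Δ - 1) ^ Δ * (grids φ Δ (Fin a) S).card := by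
  induction a, ha using Nat.le_induction generalizing S with
  | base =>
    have hgrid := (grids_nonempty hφ le_rfl hS).card_pos
    have hdesc : 0 < Δ.descFactorial (Δ - 1) := Nat.descFactorial_pos.2 (Nat.sub_le _ _)
    rw [mul_assoc]
    exact Nat.le_mul_of_pos_right _ (by positivity)
  | succ a _ ih =>
    obtain ⟨L, hL, hLa⟩ : ∃ L : ℕ, (∀ S' ⊆ S, S'.card = S.card - Δ →
        L ≤ (grids φ Δ (Fin a) S').card) ∧
        (Δ * a).factorial ≤ (Δ * Δ).factorial * a.descFactorial (Δ - 1) ^ Δ * L := by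
      obtain ⟨S₁, hS₁, hmin⟩ := Finset.exists_min_image (S.powersetCard (S.card - Δ))
        (fun S' => (grids φ Δ (Fin a) S').card)
        (Finset.powersetCard_nonempty.2 (Nat.sub_le _ _))
      refine ⟨_, fun S' hS' hcard => hmin S' (Finset.mem_powersetCard.2 ⟨hS', hcard⟩), ih ?_⟩
      rw [(Finset.mem_powersetCard.1 hS₁).2, hS, mul_add, mul_one, Nat.add_sub_cancel]
    have hrows : (Δ * (a + 1 - (Δ - 1))) ^ Δ ≤ (rows φ Δ S).card := by
      refine le_trans (le_of_eq ?_) (le_card_rows hφ Δ S)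
      rw [hS, Nat.mul_sub, mul_comm (Δ - 1) Δ]
    have hdesc : (a + 1) ^ Δ * a.descFactorial (Δ - 1) ^ Δ
        = (a + 1 - (Δ - 1)) ^ Δ * (a + 1).descFactorial (Δ - 1) ^ Δ := by
      rw [← mul_pow, ← mul_pow, Nat.succ_descFactorial]
    calc (Δ * (a + 1)).factorial ≤ (Δ * a).factorial * (Δ * (a + 1)) ^ Δ := by
          rw [mul_add, mul_one, ← Nat.factorial_mul_ascFactorial]
          gcongr
          exact Nat.ascFactorial_le_pow_add _ _
      _ ≤ ((Δ * Δ).factorial * a.descFactorial (Δ - 1) ^ Δ * L) * (Δ * (a + 1)) ^ Δ := by gcongr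
      _ = (Δ * Δ).factorial * (a + 1).descFactorial (Δ - 1) ^ Δ *
            ((Δ * (a + 1 - (Δ - 1))) ^ Δ * L) := by
          rw [mul_pow, mul_pow]
          linear_combination ((Δ * Δ).factorial * Δ ^ Δ * L) * hdesc
      _ ≤ (Δ * Δ).factorial * (a + 1).descFactorial (Δ - 1) ^ Δ *
            ((rows φ Δ S).card * L) := by gcongr
      _ ≤ _ := by
          gcongr
          exact card_grids_succ hL

end RoundRobin

section Simplicity

/-- The maps from left half-edges to right vertices in which every right vertex has degree `Δ`. -/
def balanced (Δ n : ℕ) : Finset (Fin n × Fin Δ → Fin n) :=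
  functionsWithCounts (Fin n × Fin Δ) fun _ => Δ

/-- The balanced maps without multiple edges. -/
def simpleMaps (Δ n : ℕ) : Finset (Fin n × Fin Δ → Fin n) :=
  (balanced Δ n).filter fun f => ∀ u, Function.Injective fun k => f (u, k)

/-- The factor by which forbidding multiple edges at `a` vertices reduces the number of
configurations, at most. -/
def simplicityFactor (Δ a : ℕ) : ℕ := (Δ * Δ).factorial * a.descFactorial (Δ - 1) ^ Δ

/-- The permutations of the half-edges which preserve the colour of the vertex. -/
def colourPerms {U κ : Type*} [Fintype U] [DecidableEq U] [DecidableEq κ] (σ : U → κ) (Δ : ℕ) :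
    Finset (Equiv.Perm (U × Fin Δ)) :=
  Finset.univ.filter fun h => ∀ e, σ (h e).1 = σ e.1

/-- The map of half-edges which on the half-edges of colour `i` is the arrangement `g i`. -/
def glue {U κ β : Type*} {Δ : ℕ} (σ : U → κ) (g : ∀ i, {u // σ u = i} → Fin Δ → β) :
    U × Fin Δ → β :=
  fun x => g (σ x.1) ⟨x.1, rfl⟩ x.2

section Glue

variable {U κ β : Type*} {Δ : ℕ} {σ : U → κ}

theorem glue_apply (g : ∀ i, {u // σ u = i} → Fin Δ → β) {i : κ} {u : U} (hu : σ u = i)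
    (k : Fin Δ) : glue σ g (u, k) = g i ⟨u, hu⟩ k := by
  subst hu
  rfl

theorem glue_injective :
    Function.Injective (glue σ : (∀ i, {u // σ u = i} → Fin Δ → β) → U × Fin Δ → β) :=
  fun g g' h => by
    funext i u k
    rw [← glue_apply g u.2, ← glue_apply g' u.2, h]

variable {V : Type*} [Fintype U] [DecidableEq U] [DecidableEq κ] [DecidableEq V]
  {f : U × Fin Δ → V} {g : ∀ i, {u // σ u = i} → Fin Δ → U × Fin Δ}

theorem colour_glue
    (hg : ∀ i, g i ∈ grids f Δ {u // σ u = i} (Finset.univ.filter fun e => σ e.1 = i))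
    (x : U × Fin Δ) : σ (glue σ g x).1 = σ x.1 :=
  (Finset.mem_filter.1 ((mem_rows.1 ((mem_grids.1 (hg _)).1 ⟨x.1, rfl⟩)).1 x.2)).2

theorem injective_glue
    (hg : ∀ i, g i ∈ grids f Δ {u // σ u = i} (Finset.univ.filter fun e => σ e.1 = i)) :
    Function.Injective (glue σ g) := by
  rintro ⟨u, k⟩ ⟨v, l⟩ h
  have hcolour : σ v = σ u := by
    rw [← colour_glue hg (u, k), h, colour_glue hg (v, l)]
  rw [glue_apply g rfl, glue_apply g hcolour] at h
  have hpair := (mem_grids.1 (hg (σ u))).2 (a₁ := (⟨u, rfl⟩, k)) (a₂ := (⟨v, hcolour⟩, l)) h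
  simpa only [Prod.mk.injEq, Subtype.mk.injEq] using hpair

theorem prod_card_grids_le [Fintype κ] (σ : U → κ) (f : U × Fin Δ → V) :
    ∏ i, (grids f Δ {u // σ u = i} (Finset.univ.filter fun e => σ e.1 = i)).card ≤
      ((colourPerms σ Δ).filter fun h => ∀ u, Function.Injective fun k => f (h (u, k))).card := by
  rw [← Fintype.card_piFinset, ← Finset.card_image_of_injective _ (glue_injective (σ := σ))]
  refine (Finset.card_le_card fun F hF => ?_).trans (Finset.card_image_le
    (f := fun h : Equiv.Perm (U × Fin Δ) => (h : U × Fin Δ → U × Fin Δ)))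
  obtain ⟨g, hg, rfl⟩ := Finset.mem_image.1 hF
  rw [Fintype.mem_piFinset] at hg
  refine Finset.mem_image.2 ⟨Equiv.ofBijective (glue σ g)
    (Finite.injective_iff_bijective.1 (injective_glue hg)), Finset.mem_filter.2
    ⟨Finset.mem_filter.2 ⟨Finset.mem_univ _, colour_glue hg⟩, fun u => ?_⟩, rfl⟩
  exact (mem_rows.1 ((mem_grids.1 (hg (σ u))).1 ⟨u, rfl⟩)).2

end Glue

variable {Δ n : ℕ} {κ : Type*} [DecidableEq κ]

theorem sum_balanced_sum_colourPerms {σ : Fin n → κ} {w : (Fin n × Fin Δ → Fin n) → ℝ}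
    (hinv : ∀ h ∈ colourPerms σ Δ, ∀ f, w (f ∘ h) = w f) :
    ∑ f ∈ balanced Δ n, ∑ h ∈ colourPerms σ Δ,
        (if ∀ u, Function.Injective fun k => f (h (u, k)) then w f else 0)
      = (colourPerms σ Δ).card * ∑ f ∈ simpleMaps Δ n, w f := by
  rw [Finset.sum_comm, ← nsmul_eq_mul, ← Finset.sum_const]
  refine Finset.sum_congr rfl fun h hh => ?_
  rw [simpleMaps, Finset.sum_filter]
  refine Finset.sum_equiv (Equiv.arrowCongr h.symm (Equiv.refl (Fin n)))
    (fun f => (comp_perm_mem_functionsWithCounts h).symm) fun f _ => ?_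
  change _ = if ∀ u, Function.Injective fun k => f (h (u, k)) then w (f ∘ h) else 0
  rw [hinv h hh]

variable [Fintype κ]

theorem halfEdge_counts {σ : Fin n → κ} {a : κ → ℕ} (hσ : σ ∈ functionsWithCounts (Fin n) a) :
    (fun e : Fin n × Fin Δ => σ e.1) ∈ functionsWithCounts (Fin n × Fin Δ) fun i => Δ * a i := by
  rw [mem_functionsWithCounts] at hσ ⊢
  intro i
  have hfiber : (Finset.univ.filter fun e : Fin n × Fin Δ => σ e.1 = i)
      = (Finset.univ.filter fun u => σ u = i) ×ˢ (Finset.univ : Finset (Fin Δ)) := by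
    ext e
    simp
  rw [hfiber, Finset.card_product, hσ, Finset.card_univ, Fintype.card_fin, mul_comm]

theorem card_colourPerms {σ : Fin n → κ} {a : κ → ℕ} (hσ : σ ∈ functionsWithCounts (Fin n) a) :
    (colourPerms σ Δ).card = ∏ i, (Δ * a i).factorial := by
  rw [← card_perm_comp_eq (halfEdge_counts (Δ := Δ) hσ) (halfEdge_counts (Δ := Δ) hσ), colourPerms]
  simp only [funext_iff, Function.comp_apply]

theorem prod_factorial_le_card_colourPerms {σ : Fin n → κ} {a : κ → ℕ}
    (hσ : σ ∈ functionsWithCounts (Fin n) a) (ha : ∀ i, Δ ≤ a i) {f : Fin n × Fin Δ → Fin n}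
    (hf : f ∈ balanced Δ n) :
    ∏ i, (Δ * a i).factorial ≤ (∏ i, simplicityFactor Δ (a i)) *
      ((colourPerms σ Δ).filter fun h => ∀ u, Function.Injective fun k => f (h (u, k))).card := by
  have hf' : ∀ v, (Finset.univ.filter fun x => f x = v).card ≤ Δ := fun v =>
    (mem_functionsWithCounts.1 hf v).le
  have hgrids : ∀ i, (Δ * a i).factorial ≤ simplicityFactor Δ (a i) *
      (grids f Δ {u // σ u = i} (Finset.univ.filter fun e => σ e.1 = i)).card := fun i => by
    have hclass : {u // σ u = i} ≃ Fin (a i) := Fintype.equivOfCardEq (by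
      rw [Fintype.card_subtype, mem_functionsWithCounts.1 hσ i, Fintype.card_fin])
    exact (factorial_le_card_grids hf' (ha i)
      (mem_functionsWithCounts.1 (halfEdge_counts hσ) i)).trans
      (Nat.mul_le_mul_left _ (card_grids_le_of_equiv f Δ hclass _))
  calc ∏ i, (Δ * a i).factorial
      ≤ ∏ i, (simplicityFactor Δ (a i) *
          (grids f Δ {u // σ u = i} (Finset.univ.filter fun e => σ e.1 = i)).card) :=
        Finset.prod_le_prod' fun i _ => hgrids i
    _ ≤ _ := by
        rw [Finset.prod_mul_distrib]
        refine Nat.mul_le_mul_left _ ?_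
        convert prod_card_grids_le σ f

/-- The rearrangements of a balanced map by colour-preserving permutations have the same weight,
and sufficiently many of them are simple. -/
theorem sum_balanced_le {σ : Fin n → κ} {a : κ → ℕ} (hσ : σ ∈ functionsWithCounts (Fin n) a)
    (ha : ∀ i, Δ ≤ a i) {w : (Fin n × Fin Δ → Fin n) → ℝ} (hw : ∀ f, 0 ≤ w f)
    (hinv : ∀ h ∈ colourPerms σ Δ, ∀ f, w (f ∘ h) = w f) :
    ∑ f ∈ balanced Δ n, w f
      ≤ (∏ i, (simplicityFactor Δ (a i) : ℝ)) * ∑ f ∈ simpleMaps Δ n, w f := by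
  have hpos : (0 : ℝ) < (colourPerms σ Δ).card := by
    rw [card_colourPerms hσ]
    exact_mod_cast Finset.prod_pos fun i _ => Nat.factorial_pos _
  refine le_of_mul_le_mul_left ?_ hpos
  rw [mul_left_comm, ← sum_balanced_sum_colourPerms hinv, Finset.mul_sum, Finset.mul_sum]
  refine Finset.sum_le_sum fun f hf => ?_
  rw [← Finset.sum_filter, Finset.sum_const, nsmul_eq_mul, ← mul_assoc, card_colourPerms hσ]
  refine mul_le_mul_of_nonneg_right ?_ (hw f)
  exact_mod_cast prod_factorial_le_card_colourPerms hσ ha hf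

end Simplicity

section Graphs

variable {Δ n : ℕ}

open scoped Classical in
/-- The neighbours of a left vertex, as right vertices. -/
noncomputable def leftNbrs (G : SimpleGraph (Fin n ⊕ Fin n)) (u : Fin n) : Finset (Fin n) :=
  Finset.univ.filter fun v => G.Adj (Sum.inl u) (Sum.inr v)

/-- The neighbourhood systems of the left vertices in `Δ`-regular bipartite graphs. -/
def regularNbrs (Δ n : ℕ) : Finset (Fin n → Finset (Fin n)) :=
  Finset.univ.filter fun A => (∀ u, (A u).card = Δ) ∧
    ∀ v, (Finset.univ.filter fun u => v ∈ A u).card = Δ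

/-- The bipartite graph with given neighbourhoods of the left vertices. -/
def graphOfNbrs (A : Fin n → Finset (Fin n)) : SimpleGraph (Fin n ⊕ Fin n) where
  Adj x y := (∃ u v, x = Sum.inl u ∧ y = Sum.inr v ∧ v ∈ A u) ∨
    ∃ u v, y = Sum.inl u ∧ x = Sum.inr v ∧ v ∈ A u
  symm := ⟨fun _ _ h => h.symm⟩
  loopless := ⟨fun x h => by
    rcases h with ⟨u, v, h₁, h₂, -⟩ | ⟨u, v, h₁, h₂, -⟩ <;> rw [h₁] at h₂ <;> cases h₂⟩

theorem mem_leftNbrs {G : SimpleGraph (Fin n ⊕ Fin n)} {u v : Fin n} :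
    v ∈ leftNbrs G u ↔ G.Adj (Sum.inl u) (Sum.inr v) := by
  simp [leftNbrs]

theorem mem_regularNbrs {A : Fin n → Finset (Fin n)} : A ∈ regularNbrs Δ n ↔
    (∀ u, (A u).card = Δ) ∧ ∀ v, (Finset.univ.filter fun u => v ∈ A u).card = Δ := by
  simp [regularNbrs]

open scoped Classical in
theorem mem_regularBipartite {G : SimpleGraph (Fin n ⊕ Fin n)} : G ∈ regularBipartite Δ n ↔
    G ≤ completeBipartiteGraph (Fin n) (Fin n) ∧ ∀ x, G.degree x = Δ := by
  rw [regularBipartite, Finset.mem_filter, SimpleGraph.IsRegularOfDegree]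
  simp only [Finset.mem_univ, true_and]

theorem leftNbrs_graphOfNbrs (A : Fin n → Finset (Fin n)) : leftNbrs (graphOfNbrs A) = A := by
  funext u
  ext v
  simp [leftNbrs, graphOfNbrs]

theorem graphOfNbrs_leftNbrs {G : SimpleGraph (Fin n ⊕ Fin n)}
    (hG : G ≤ completeBipartiteGraph (Fin n) (Fin n)) : graphOfNbrs (leftNbrs G) = G := by
  ext x y
  constructor
  · rintro (⟨u, v, rfl, rfl, h⟩ | ⟨u, v, rfl, rfl, h⟩)
    · exact mem_leftNbrs.1 h
    · exact (mem_leftNbrs.1 h).symm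
  · intro h
    have hadj := hG h
    rcases x with u | v <;> rcases y with u' | v'
    · simp at hadj
    · exact Or.inl ⟨u, v', rfl, rfl, mem_leftNbrs.2 h⟩
    · exact Or.inr ⟨u', v, rfl, rfl, mem_leftNbrs.2 h.symm⟩
    · simp at hadj

theorem graphOfNbrs_le (A : Fin n → Finset (Fin n)) :
    graphOfNbrs A ≤ completeBipartiteGraph (Fin n) (Fin n) := by
  rintro x y (⟨u, v, rfl, rfl, -⟩ | ⟨u, v, rfl, rfl, -⟩) <;> simp

open scoped Classical in
theorem degree_graphOfNbrs_inl (A : Fin n → Finset (Fin n)) (u : Fin n) :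
    (graphOfNbrs A).degree (Sum.inl u) = (A u).card := by
  rw [← SimpleGraph.card_neighborFinset_eq_degree,
    ← Finset.card_map (Function.Embedding.inr : Fin n ↪ Fin n ⊕ Fin n)]
  congr 1
  ext x
  rw [SimpleGraph.mem_neighborFinset]
  rcases x with x | x <;> simp [graphOfNbrs]

open scoped Classical in
theorem degree_graphOfNbrs_inr (A : Fin n → Finset (Fin n)) (v : Fin n) :
    (graphOfNbrs A).degree (Sum.inr v) = (Finset.univ.filter fun u => v ∈ A u).card := by
  rw [← SimpleGraph.card_neighborFinset_eq_degree,
    ← Finset.card_map (Function.Embedding.inl : Fin n ↪ Fin n ⊕ Fin n)]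
  congr 1
  ext x
  rw [SimpleGraph.mem_neighborFinset]
  rcases x with x | x <;> simp [graphOfNbrs]

theorem graphOfNbrs_mem_regularBipartite {A : Fin n → Finset (Fin n)} :
    graphOfNbrs A ∈ regularBipartite Δ n ↔ A ∈ regularNbrs Δ n := by
  classical
  rw [mem_regularNbrs, mem_regularBipartite]
  simp only [graphOfNbrs_le, true_and, Sum.forall, degree_graphOfNbrs_inl, degree_graphOfNbrs_inr]

theorem sum_regularBipartite (F : (Fin n → Finset (Fin n)) → ℝ) :
    ∑ G ∈ regularBipartite Δ n, F (leftNbrs G) = ∑ A ∈ regularNbrs Δ n, F A := by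
  have hinv : ∀ G ∈ regularBipartite Δ n, graphOfNbrs (leftNbrs G) = G := fun G hG =>
    graphOfNbrs_leftNbrs (mem_regularBipartite.1 hG).1
  refine Finset.sum_bij' (fun G _ => leftNbrs G) (fun A _ => graphOfNbrs A)
    (fun G hG => ?_) (fun A hA => graphOfNbrs_mem_regularBipartite.2 hA) hinv
    (fun A _ => leftNbrs_graphOfNbrs A) fun _ _ => rfl
  rwa [← graphOfNbrs_mem_regularBipartite, hinv G hG]

theorem card_filter_image_eq {α : Type*} [Fintype α] [DecidableEq α] {A : Finset α}
    (hA : A.card = Δ) :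
    (Finset.univ.filter fun r : Fin Δ → α => Finset.univ.image r = A).card = Δ.factorial := by
  have hcard : (Finset.univ : Finset (Fin Δ ≃ A)).card = Δ.factorial := by
    rw [Finset.card_univ, Fintype.card_equiv (Fintype.equivOfCardEq (by simp [hA])),
      Fintype.card_fin]
  rw [← hcard]
  refine (Finset.card_bij (fun e _ k => (e k : α)) (fun e _ => ?_) (fun e _ e' _ h => ?_)
    fun r hr => ?_).symm
  · refine Finset.mem_filter.2 ⟨Finset.mem_univ _, ?_⟩
    ext x
    simp only [Finset.mem_image, Finset.mem_univ, true_and]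
    exact ⟨fun ⟨k, hk⟩ => hk ▸ (e k).2, fun hx => ⟨e.symm ⟨x, hx⟩, by simp⟩⟩
  · ext k
    exact congrFun h k
  · obtain rfl : Finset.univ.image r = A := (Finset.mem_filter.1 hr).2
    have hmem : ∀ k, r k ∈ Finset.univ.image r := fun k =>
      Finset.mem_image_of_mem _ (Finset.mem_univ _)
    have hsurj : Function.Surjective fun k => (⟨r k, hmem k⟩ : Finset.univ.image r) := by
      rintro ⟨x, hx⟩
      obtain ⟨k, -, rfl⟩ := Finset.mem_image.1 hx
      exact ⟨k, rfl⟩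
    exact ⟨Equiv.ofBijective _ ((Fintype.bijective_iff_surjective_and_card _).2
      ⟨hsurj, by rw [Fintype.card_fin, Fintype.card_coe, hA]⟩), Finset.mem_univ _, rfl⟩

/-- The neighbourhoods of the left vertices described by a map from half-edges. -/
def nbrsOfMap (f : Fin n × Fin Δ → Fin n) (u : Fin n) : Finset (Fin n) :=
  Finset.univ.image fun k => f (u, k)

theorem card_nbrsOfMap_eq_iff {f : Fin n × Fin Δ → Fin n} {u : Fin n} :
    (nbrsOfMap f u).card = Δ ↔ Function.Injective fun k => f (u, k) := by
  simpa [nbrsOfMap] using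
    Finset.card_image_iff (s := (Finset.univ : Finset (Fin Δ))) (f := fun k => f (u, k))

theorem card_filter_mem_nbrsOfMap {f : Fin n × Fin Δ → Fin n}
    (hf : ∀ u, Function.Injective fun k => f (u, k)) (v : Fin n) :
    (Finset.univ.filter fun u => v ∈ nbrsOfMap f u).card =
      (Finset.univ.filter fun e => f e = v).card := by
  refine (Finset.card_bij (fun e _ => e.1) ?_ ?_ ?_).symm
  · intro e he
    simp only [Finset.mem_filter, Finset.mem_univ, true_and] at he ⊢
    exact Finset.mem_image.2 ⟨e.2, Finset.mem_univ _, he⟩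
  · rintro ⟨u, k⟩ he ⟨u', k'⟩ he' h
    simp only [Finset.mem_filter, Finset.mem_univ, true_and] at he he' h
    subst h
    rw [hf u (he.trans he'.symm)]
  · intro u hu
    obtain ⟨k, -, hk⟩ := Finset.mem_image.1 (Finset.mem_filter.1 hu).2
    exact ⟨(u, k), by simpa using hk, rfl⟩

theorem mem_simpleMaps_iff {f : Fin n × Fin Δ → Fin n} :
    f ∈ simpleMaps Δ n ↔ nbrsOfMap f ∈ regularNbrs Δ n := by
  rw [simpleMaps, Finset.mem_filter, mem_regularNbrs, balanced, mem_functionsWithCounts, and_comm]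
  simp only [card_nbrsOfMap_eq_iff]
  exact and_congr_right fun hf =>
    forall_congr' fun v => by rw [card_filter_mem_nbrsOfMap hf]

theorem card_filter_nbrsOfMap_eq {A : Fin n → Finset (Fin n)} (hA : ∀ u, (A u).card = Δ) :
    (Finset.univ.filter fun f : Fin n × Fin Δ → Fin n => nbrsOfMap f = A).card =
      Δ.factorial ^ n := by
  calc (Finset.univ.filter fun f : Fin n × Fin Δ → Fin n => nbrsOfMap f = A).card
      = (Fintype.piFinset fun u => Finset.univ.filter fun r : Fin Δ → Fin n =>
          Finset.univ.image r = A u).card := by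
        refine Finset.card_equiv (Equiv.curry (Fin n) (Fin Δ) (Fin n)) fun f => ?_
        simp only [Finset.mem_filter, Finset.mem_univ, true_and, Fintype.mem_piFinset]
        exact funext_iff
    _ = Δ.factorial ^ n := by
        rw [Fintype.card_piFinset, Finset.prod_congr rfl fun u _ => card_filter_image_eq (hA u),
          Finset.prod_const, Finset.card_univ, Fintype.card_fin]

theorem sum_simpleMaps (F : (Fin n → Finset (Fin n)) → ℝ) :
    ∑ f ∈ simpleMaps Δ n, F (nbrsOfMap f)
      = (Δ.factorial : ℝ) ^ n * ∑ A ∈ regularNbrs Δ n, F A := by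
  rw [← Finset.sum_fiberwise_of_maps_to (t := regularNbrs Δ n) (g := nbrsOfMap)
    (fun f hf => mem_simpleMaps_iff.1 hf), Finset.mul_sum]
  refine Finset.sum_congr rfl fun A hA => ?_
  have hfiber : (simpleMaps Δ n).filter (fun f => nbrsOfMap f = A) =
      Finset.univ.filter fun f : Fin n × Fin Δ → Fin n => nbrsOfMap f = A := by
    ext f
    simp only [Finset.mem_filter, Finset.mem_univ, true_and, and_iff_right_iff_imp]
    rintro rfl
    exact mem_simpleMaps_iff.2 hA
  rw [Finset.sum_congr rfl (g := fun _ => F A) fun f hf => by rw [(Finset.mem_filter.1 hf).2],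
    Finset.sum_const, nsmul_eq_mul, hfiber, card_filter_nbrsOfMap_eq (mem_regularNbrs.1 hA).1,
    Nat.cast_pow]

/-- The product over all half-edges of the interactions of the colours of their end points. -/
noncomputable def mapWeight {κ : Type*} (B : κ → κ → ℝ) (σ τ : Fin n → κ)
    (f : Fin n × Fin Δ → Fin n) : ℝ :=
  ∏ e, B (σ e.1) (τ (f e))

theorem sum_mapWeight {q : ℕ} (B : Matrix (Fin (q + 1)) (Fin (q + 1)) ℝ)
    (σ τ : Fin n → Fin (q + 1)) :
    ∑ f ∈ simpleMaps Δ n, mapWeight B σ τ f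
      = (Δ.factorial : ℝ) ^ n * ∑ G ∈ regularBipartite Δ n, weight B G σ τ := by
  have hweight : ∀ G : SimpleGraph (Fin n ⊕ Fin n),
      weight B G σ τ = ∏ u, ∏ v ∈ leftNbrs G u, B (σ u) (τ v) := fun G => by
    simp only [weight, leftNbrs, Finset.prod_filter]
  simp only [hweight]
  rw [sum_regularBipartite fun A => ∏ u, ∏ v ∈ A u, B (σ u) (τ v), ← sum_simpleMaps]
  refine Finset.sum_congr rfl fun f hf => ?_
  unfold mapWeight
  rw [Fintype.prod_prod_type]
  refine Finset.prod_congr rfl fun u _ => ?_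
  rw [nbrsOfMap, Finset.prod_image fun k _ l _ h => (Finset.mem_filter.1 hf).2 u h]

theorem card_simpleMaps :
    ((simpleMaps Δ n).card : ℝ) = (Δ.factorial : ℝ) ^ n * (regularBipartite Δ n).card := by
  have hmaps := sum_simpleMaps (Δ := Δ) (n := n) fun _ => 1
  have hgraphs := sum_regularBipartite (Δ := Δ) (n := n) fun _ => 1
  simp only [Finset.sum_const, nsmul_eq_mul, mul_one] at hmaps hgraphs
  rw [hmaps, hgraphs]

end Graphs

section FirstMoment

variable {Δ n : ℕ}

theorem fst_mem_balanced : (Prod.fst : Fin n × Fin Δ → Fin n) ∈ balanced Δ n := by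
  have hid : (id : Fin n → Fin n) ∈ functionsWithCounts (Fin n) fun _ => 1 :=
    mem_functionsWithCounts.2 fun v => by simp [Finset.filter_eq']
  simpa [balanced] using halfEdge_counts (Δ := Δ) hid

theorem card_balanced_le (hn : Δ ≤ n) :
    ((balanced Δ n).card : ℝ) ≤ simplicityFactor Δ n * (simpleMaps Δ n).card := by
  have hsum := sum_balanced_le (Δ := Δ) (n := n) (κ := Unit) (σ := fun _ => ()) (a := fun _ => n)
    (mem_functionsWithCounts.2 fun j => by simp) (fun _ => hn) (w := fun _ => 1)
    (fun _ => zero_le_one) (fun _ _ _ => rfl)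
  simpa using hsum

theorem card_simpleMaps_pos (hn : Δ ≤ n) : (0 : ℝ) < (simpleMaps Δ n).card := by
  have hbalanced : (0 : ℝ) < (balanced Δ n).card := by
    exact_mod_cast Finset.card_pos.2 ⟨_, fst_mem_balanced⟩
  exact pos_of_mul_pos_right (hbalanced.trans_le (card_balanced_le hn)) (Nat.cast_nonneg _)

theorem expect_simpleMaps_le (hn : Δ ≤ n) {w : (Fin n × Fin Δ → Fin n) → ℝ} (hw : ∀ f, 0 ≤ w f) :
    𝔼 f ∈ simpleMaps Δ n, w f ≤ simplicityFactor Δ n * 𝔼 f ∈ balanced Δ n, w f := by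
  rw [Finset.expect_eq_sum_div_card, div_le_iff₀ (card_simpleMaps_pos hn)]
  calc ∑ f ∈ simpleMaps Δ n, w f ≤ ∑ f ∈ balanced Δ n, w f :=
        Finset.sum_le_sum_of_subset_of_nonneg (Finset.filter_subset _ _) fun f _ _ => hw f
    _ = (balanced Δ n).card * 𝔼 f ∈ balanced Δ n, w f := (Finset.card_mul_expect _ _).symm
    _ ≤ simplicityFactor Δ n * (simpleMaps Δ n).card * 𝔼 f ∈ balanced Δ n, w f :=
        mul_le_mul_of_nonneg_right (card_balanced_le hn) (Finset.expect_nonneg fun f _ => hw f)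
    _ = _ := mul_right_comm _ _ _

variable {κ : Type*}

theorem mapWeight_nonneg {B : κ → κ → ℝ} (hB : ∀ i j, 0 ≤ B i j) (σ τ : Fin n → κ)
    (f : Fin n × Fin Δ → Fin n) : 0 ≤ mapWeight B σ τ f :=
  Finset.prod_nonneg fun _ _ => hB _ _

variable [DecidableEq κ]

theorem mapWeight_comp_colourPerm (B : κ → κ → ℝ) {σ : Fin n → κ} (τ : Fin n → κ)
    {h : Equiv.Perm (Fin n × Fin Δ)} (hh : h ∈ colourPerms σ Δ) (f : Fin n × Fin Δ → Fin n) :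
    mapWeight B σ τ (f ∘ h) = mapWeight B σ τ f := by
  refine Fintype.prod_equiv h _ _ fun e => ?_
  rw [(Finset.mem_filter.1 hh).2 e, Function.comp_apply]

variable [Fintype κ]

theorem expect_balanced_le (hn : Δ ≤ n) {σ : Fin n → κ} {a : κ → ℕ}
    (hσ : σ ∈ functionsWithCounts (Fin n) a) (ha : ∀ i, Δ ≤ a i)
    {w : (Fin n × Fin Δ → Fin n) → ℝ} (hw : ∀ f, 0 ≤ w f)
    (hinv : ∀ h ∈ colourPerms σ Δ, ∀ f, w (f ∘ h) = w f) :
    𝔼 f ∈ balanced Δ n, w f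
      ≤ (∏ i, (simplicityFactor Δ (a i) : ℝ)) * 𝔼 f ∈ simpleMaps Δ n, w f := by
  have hcard : ((simpleMaps Δ n).card : ℝ) ≤ (balanced Δ n).card := by
    exact_mod_cast Finset.card_le_card (Finset.filter_subset _ _)
  rw [Finset.expect_eq_sum_div_card, Finset.expect_eq_sum_div_card, ← mul_div_assoc]
  exact div_le_div₀ (mul_nonneg (Finset.prod_nonneg fun _ _ => Nat.cast_nonneg _)
    (Finset.sum_nonneg fun f _ => hw f)) (sum_balanced_le hσ ha hw hinv)
    (card_simpleMaps_pos hn) hcard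

theorem expect_balanced_mapWeight (B : κ → κ → ℝ) {b : κ → ℕ} (σ : Fin n → κ) {τ : Fin n → κ}
    (hτ : τ ∈ functionsWithCounts (Fin n) b) :
    𝔼 f ∈ balanced Δ n, mapWeight B σ τ f =
      pairMean B (fun j => Δ * b j) fun e : Fin n × Fin Δ => σ e.1 := by
  rw [balanced, ← expect_perm_comp fst_mem_balanced, pairMean,
    ← expect_perm_comp (halfEdge_counts (Δ := Δ) hτ)]
  rfl

variable {q : ℕ} {B : Matrix (Fin (q + 1)) (Fin (q + 1)) ℝ} {a b : Fin (q + 1) → ℕ}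

theorem assignments_eq_functionsWithCounts (a : Fin (q + 1) → ℕ) :
    assignments n a = functionsWithCounts (Fin n) a :=
  Finset.ext fun σ => by simp [assignments, mem_functionsWithCounts]

theorem firstMoment_eq (B : Matrix (Fin (q + 1)) (Fin (q + 1)) ℝ) (Δ n : ℕ)
    (a b : Fin (q + 1) → ℕ) :
    firstMoment B Δ n a b = ∑ σ ∈ functionsWithCounts (Fin n) a,
      ∑ τ ∈ functionsWithCounts (Fin n) b, 𝔼 f ∈ simpleMaps Δ n, mapWeight B σ τ f := by
  have hfactorial : (Δ.factorial : ℝ) ^ n ≠ 0 :=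
    pow_ne_zero _ (Nat.cast_ne_zero.2 Δ.factorial_ne_zero)
  have haverage : ∀ σ τ, 𝔼 f ∈ simpleMaps Δ n, mapWeight B σ τ f =
      (∑ G ∈ regularBipartite Δ n, weight B G σ τ) / (regularBipartite Δ n).card := fun σ τ => by
    rw [Finset.expect_eq_sum_div_card, sum_mapWeight, card_simpleMaps,
      mul_div_mul_left _ _ hfactorial]
  simp only [haverage, ← Finset.sum_div]
  simp only [firstMoment, partitionFunction, assignments_eq_functionsWithCounts]
  rw [Finset.sum_comm, Finset.sum_congr rfl fun σ _ => Finset.sum_comm]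

theorem card_colourings (ha : ∑ i, a i = n) :
    (functionsWithCounts (Fin n) a).card = Nat.multinomial Finset.univ a :=
  card_functionsWithCounts (by rw [ha, Fintype.card_fin])

theorem sum_halfEdge_counts (hb : ∑ i, b i = n) :
    ∑ i, Δ * b i = Fintype.card (Fin n × Fin Δ) := by
  rw [← Finset.mul_sum, hb, Fintype.card_prod, Fintype.card_fin, Fintype.card_fin, mul_comm]

theorem firstMoment_le (hB : ∀ i j, 0 ≤ B i j) (hn : Δ ≤ n)
    (ha : ∑ i, a i = n) (hb : ∑ i, b i = n) {z : Fin (q + 1) → ℝ} (hz : ∀ j, 0 < z j) :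
    firstMoment B Δ n a b ≤ simplicityFactor Δ n *
      (Nat.multinomial Finset.univ a * Nat.multinomial Finset.univ b /
        Nat.multinomial Finset.univ fun j => Δ * b j) *
      ((∏ i, (∑ j, B i j * z j) ^ (Δ * a i)) / ∏ j, z j ^ (Δ * b j)) := by
  set saddle := (∏ i, (∑ j, B i j * z j) ^ (Δ * a i)) / ∏ j, z j ^ (Δ * b j) with hsaddle
  have hmultinomial : (0 : ℝ) < Nat.multinomial Finset.univ fun j => Δ * b j :=
    Nat.cast_pos.2 (Nat.multinomial_pos _ _)
  have hmean : ∀ σ ∈ functionsWithCounts (Fin n) a, ∀ τ ∈ functionsWithCounts (Fin n) b,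
      𝔼 f ∈ simpleMaps Δ n, mapWeight B σ τ f ≤
        simplicityFactor Δ n * (saddle / Nat.multinomial Finset.univ fun j => Δ * b j) :=
    fun σ hσ τ hτ => by
      refine (expect_simpleMaps_le hn (mapWeight_nonneg hB σ τ)).trans
        (mul_le_mul_of_nonneg_left ?_ (Nat.cast_nonneg _))
      rw [expect_balanced_mapWeight B σ hτ, le_div_iff₀' hmultinomial, hsaddle,
        le_div_iff₀ (Finset.prod_pos fun j _ => pow_pos (hz j) _)]
      exact multinomial_mul_pairMean_le hB (sum_halfEdge_counts hb) (halfEdge_counts hσ)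
        fun j => (hz j).le
  rw [firstMoment_eq]
  calc _ ≤ ∑ _ ∈ functionsWithCounts (Fin n) a, ∑ _ ∈ functionsWithCounts (Fin n) b,
        simplicityFactor Δ n * (saddle / Nat.multinomial Finset.univ fun j => Δ * b j) :=
        Finset.sum_le_sum fun σ hσ => Finset.sum_le_sum fun τ hτ => hmean σ hσ τ hτ
    _ = _ := by
        rw [Finset.sum_const, Finset.sum_const, nsmul_eq_mul, nsmul_eq_mul, card_colourings ha,
          card_colourings hb]
        ring

theorem le_firstMoment (hB : ∀ i j, 0 ≤ B i j) (hn : Δ ≤ n) (haΔ : ∀ i, Δ ≤ a i)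
    (ha : ∑ i, a i = n) (hb : ∑ i, b i = n) {N : Fin (q + 1) × Fin (q + 1) → ℕ}
    (hrow : ∀ i, ∑ j, N (i, j) = Δ * a i) (hcol : ∀ j, ∑ i, N (i, j) = Δ * b j) :
    Nat.multinomial Finset.univ a * Nat.multinomial Finset.univ b *
      (Nat.multinomial Finset.univ N * ∏ x, B x.1 x.2 ^ N x) /
        ((Nat.multinomial Finset.univ fun i => Δ * a i) *
          Nat.multinomial Finset.univ fun j => Δ * b j) ≤
      (∏ i, (simplicityFactor Δ (a i) : ℝ)) * firstMoment B Δ n a b := by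
  set joint := (Nat.multinomial Finset.univ N * ∏ x, B x.1 x.2 ^ N x) /
    ((Nat.multinomial Finset.univ fun i => Δ * a i) *
      Nat.multinomial Finset.univ fun j => Δ * b j : ℝ) with hjoint
  have hmean : ∀ σ ∈ functionsWithCounts (Fin n) a, ∀ τ ∈ functionsWithCounts (Fin n) b,
      joint ≤ (∏ i, (simplicityFactor Δ (a i) : ℝ)) *
        𝔼 f ∈ simpleMaps Δ n, mapWeight B σ τ f := fun σ hσ τ hτ => by
    refine le_trans ?_ (expect_balanced_le hn hσ haΔ (mapWeight_nonneg hB σ τ)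
      fun h hh f => mapWeight_comp_colourPerm B τ hh f)
    rw [expect_balanced_mapWeight B σ hτ, hjoint, div_le_iff₀' (mul_pos
      (Nat.cast_pos.2 (Nat.multinomial_pos _ _)) (Nat.cast_pos.2 (Nat.multinomial_pos _ _)))]
    exact multinomial_mul_prod_le hB (halfEdge_counts hσ) hrow hcol
  rw [firstMoment_eq, Finset.mul_sum]
  calc _ = ∑ _ ∈ functionsWithCounts (Fin n) a, ∑ _ ∈ functionsWithCounts (Fin n) b, joint := by
        rw [Finset.sum_const, Finset.sum_const, nsmul_eq_mul, nsmul_eq_mul, card_colourings ha,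
          card_colourings hb, mul_div_assoc, mul_assoc]
    _ ≤ _ := Finset.sum_le_sum fun σ hσ => by
        rw [Finset.mul_sum]
        exact Finset.sum_le_sum fun τ hτ => hmean σ hσ τ hτ

end FirstMoment

section GrowthRate

variable {X ι : Type*} {l : Filter X} {n : X → ℕ}

/-- The integer quantity `u` has density `U` relative to the size `n` along `l`: `u / n → U`. -/
def HasDensity (l : Filter X) (n u : X → ℕ) (U : ℝ) : Prop :=
  Tendsto (fun x => (u x : ℝ) / n x) l (𝓝 U)

/-- The quantity `f` has exponential growth rate `r` relative to the size `n` along `l`: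
it is eventually positive and `(1 / n) log f → r`. -/
structure HasGrowthRate (l : Filter X) (n : X → ℕ) (f : X → ℝ) (r : ℝ) : Prop where
  eventually_pos : ∀ᶠ x in l, 0 < f x
  tendsto : Tendsto (fun x => 1 / (n x : ℝ) * Real.log (f x)) l (𝓝 r)

theorem hasDensity_self (hn : Tendsto n l atTop) : HasDensity l n n 1 := by
  refine tendsto_const_nhds.congr' ?_
  filter_upwards [hn.eventually_gt_atTop 0] with x hx
  rw [div_self (Nat.cast_ne_zero.2 hx.ne')]

theorem hasDensity_const (hn : Tendsto n l atTop) (c : ℕ) : HasDensity l n (fun _ => c) 0 :=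
  (tendsto_natCast_atTop_atTop.comp hn).const_div_atTop (c : ℝ)

theorem hasDensity_floor_mul (hn : Tendsto n l atTop) {U : ℝ} (hU : 0 ≤ U) :
    HasDensity l n (fun x => ⌊U * (n x : ℝ)⌋₊) U :=
  (tendsto_nat_floor_mul_div_atTop hU).comp (tendsto_natCast_atTop_atTop.comp hn)

namespace HasDensity

variable {u v : X → ℕ} {U V : ℝ}

theorem eventually_le (hn : Tendsto n l atTop) (hu : HasDensity l n u U) (hv : HasDensity l n v V)
    (hVU : V < U) : ∀ᶠ x in l, v x ≤ u x := by
  filter_upwards [hv.eventually_lt hu hVU, hn.eventually_gt_atTop 0] with x hx hx0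
  exact_mod_cast ((div_lt_div_iff_of_pos_right (Nat.cast_pos.2 hx0)).1 hx).le

theorem natSub (hn : Tendsto n l atTop) (hu : HasDensity l n u U) (hv : HasDensity l n v V)
    (hVU : V < U) : HasDensity l n (fun x => u x - v x) (U - V) := by
  refine (Tendsto.sub hu hv).congr' ?_
  filter_upwards [hu.eventually_le hn hv hVU] with x hx
  rw [Nat.cast_sub hx, sub_div]

theorem const_mul (c : ℕ) (hu : HasDensity l n u U) :
    HasDensity l n (fun x => c * u x) (c * U) :=
  (Tendsto.const_mul (c : ℝ) hu).congr fun x => by rw [Nat.cast_mul, mul_div_assoc]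

theorem sum [Fintype ι] {u : X → ι → ℕ} {U : ι → ℝ}
    (hu : ∀ i, HasDensity l n (fun x => u x i) (U i)) :
    HasDensity l n (fun x => ∑ i, u x i) (∑ i, U i) :=
  (tendsto_finsetSum Finset.univ fun i _ => hu i).congr fun x => by
    rw [Nat.cast_sum, Finset.sum_div]

end HasDensity

namespace HasGrowthRate

variable {f g h : X → ℝ} {r s : ℝ}

theorem mul (hf : HasGrowthRate l n f r) (hg : HasGrowthRate l n g s) :
    HasGrowthRate l n (fun x => f x * g x) (r + s) := by
  refine ⟨?_, (hf.tendsto.add hg.tendsto).congr' ?_⟩ <;>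
    filter_upwards [hf.eventually_pos, hg.eventually_pos] with x hfx hgx
  · exact mul_pos hfx hgx
  · rw [Real.log_mul hfx.ne' hgx.ne', mul_add]

theorem div (hf : HasGrowthRate l n f r) (hg : HasGrowthRate l n g s) :
    HasGrowthRate l n (fun x => f x / g x) (r - s) := by
  refine ⟨?_, (hf.tendsto.sub hg.tendsto).congr' ?_⟩ <;>
    filter_upwards [hf.eventually_pos, hg.eventually_pos] with x hfx hgx
  · exact div_pos hfx hgx
  · rw [Real.log_div hfx.ne' hgx.ne', mul_sub]

theorem pow (hf : HasGrowthRate l n f r) (k : ℕ) :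
    HasGrowthRate l n (fun x => f x ^ k) (k * r) := by
  refine ⟨hf.eventually_pos.mono fun x hx => pow_pos hx k,
    (hf.tendsto.const_mul (k : ℝ)).congr fun x => ?_⟩
  rw [Real.log_pow, mul_left_comm]

theorem prod [Fintype ι] {f : ι → X → ℝ} {r : ι → ℝ} (hf : ∀ i, HasGrowthRate l n (f i) (r i)) :
    HasGrowthRate l n (fun x => ∏ i, f i x) (∑ i, r i) := by
  have hpos : ∀ᶠ x in l, ∀ i, 0 < f i x := eventually_all.2 fun i => (hf i).eventually_pos
  refine ⟨hpos.mono fun x hx => Finset.prod_pos fun i _ => hx i,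
    (tendsto_finsetSum Finset.univ fun i _ => (hf i).tendsto).congr' ?_⟩
  filter_upwards [hpos] with x hx
  rw [Real.log_prod fun i _ => (hx i).ne', Finset.mul_sum]

theorem squeeze (hg : HasGrowthRate l n g r) (hh : HasGrowthRate l n h r)
    (hgf : ∀ᶠ x in l, g x ≤ f x) (hfh : ∀ᶠ x in l, f x ≤ h x) : HasGrowthRate l n f r := by
  refine ⟨?_, tendsto_of_tendsto_of_tendsto_of_le_of_le' hg.tendsto hh.tendsto ?_ ?_⟩
  · filter_upwards [hg.eventually_pos, hgf] with x hpos hle using hpos.trans_le hle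
  · filter_upwards [hg.eventually_pos, hgf] with x hpos hle
    exact mul_le_mul_of_nonneg_left (Real.log_le_log hpos hle) (by positivity)
  · filter_upwards [hg.eventually_pos, hgf, hfh] with x hpos hle hle'
    exact mul_le_mul_of_nonneg_left (Real.log_le_log (hpos.trans_le hle) hle') (by positivity)

end HasGrowthRate

theorem hasGrowthRate_const (hn : Tendsto n l atTop) {c : ℝ} (hc : 0 < c) :
    HasGrowthRate l n (fun _ => c) 0 := by
  refine ⟨Eventually.of_forall fun _ => hc, ?_⟩
  simpa using (tendsto_one_div_atTop_nhds_zero_nat.comp hn).mul_const (Real.log c)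

theorem hasGrowthRate_size (hn : Tendsto n l atTop) :
    HasGrowthRate l n (fun x => (n x : ℝ)) 0 := by
  refine ⟨(hn.eventually_gt_atTop 0).mono fun x hx => Nat.cast_pos.2 hx, ?_⟩
  refine (Real.isLittleO_log_id_atTop.tendsto_div_nhds_zero.comp
    (tendsto_natCast_atTop_atTop.comp hn)).congr fun x => ?_
  rw [one_div, ← div_eq_inv_mul]
  rfl

theorem HasDensity.hasGrowthRate_pow {m : X → ℕ} {c y : ℝ} (hm : HasDensity l n m c)
    (hy : ∀ᶠ x in l, 0 < y ^ m x) : HasGrowthRate l n (fun x => y ^ m x) (c * Real.log y) :=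
  ⟨hy, (Tendsto.mul_const (Real.log y) hm).congr fun x => by rw [Real.log_pow]; ring⟩

theorem simplicityFactor_pos {Δ a : ℕ} (h : Δ ≤ a) : 0 < simplicityFactor Δ a :=
  Nat.mul_pos (Nat.factorial_pos _) (Nat.pow_pos (Nat.descFactorial_pos.2 (by omega)))

theorem simplicityFactor_le {Δ a n : ℕ} (h : a ≤ n) :
    simplicityFactor Δ a ≤ (Δ * Δ).factorial * n ^ ((Δ - 1) * Δ) := by
  rw [simplicityFactor, pow_mul]
  gcongr
  exact (Nat.descFactorial_le_pow _ _).trans (Nat.pow_le_pow_left h _)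

theorem hasGrowthRate_simplicityFactor (hn : Tendsto n l atTop) {Δ : ℕ} {m : X → ℕ}
    (hmn : ∀ᶠ x in l, m x ≤ n x) (hΔm : ∀ᶠ x in l, Δ ≤ m x) :
    HasGrowthRate l n (fun x => (simplicityFactor Δ (m x) : ℝ)) 0 := by
  have hupper : HasGrowthRate l n
      (fun x => ((Δ * Δ).factorial : ℝ) * (n x : ℝ) ^ ((Δ - 1) * Δ)) 0 := by
    simpa using (hasGrowthRate_const hn (Nat.cast_pos.2 (Nat.factorial_pos _))).mul
      ((hasGrowthRate_size hn).pow ((Δ - 1) * Δ))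
  refine (hasGrowthRate_const hn one_pos).squeeze hupper ?_ ?_
  · filter_upwards [hΔm] with x hx
    exact_mod_cast simplicityFactor_pos hx
  · filter_upwards [hmn] with x hx
    exact_mod_cast simplicityFactor_le hx

end GrowthRate

section MultinomialGrowth

variable {X ι : Type*} {l : Filter X} {n : X → ℕ} [Fintype ι]

/-- The entropy `(∑ c) log (∑ c) - ∑ c log c` of a weight vector `c` of arbitrary total mass: the
growth rate of the multinomial coefficients with densities `c`. -/
noncomputable def entropy (c : ι → ℝ) : ℝ :=
  ∑ i, Real.negMulLog (c i) - Real.negMulLog (∑ i, c i)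

theorem entropy_const_mul (D : ℝ) (c : ι → ℝ) : entropy (fun i => D * c i) = D * entropy c := by
  simp only [entropy, ← Finset.mul_sum, Real.negMulLog_mul, Finset.sum_add_distrib,
    ← Finset.sum_mul]
  ring

theorem entropy_eq_of_sum_eq_one {c : ι → ℝ} (hc : ∑ i, c i = 1) :
    entropy c = -∑ i, c i * Real.log (c i) := by
  simp [entropy, hc, Real.negMulLog]

theorem le_log_factorial (m : ℕ) : (m : ℝ) * Real.log m - m ≤ Real.log m.factorial := by
  rcases m.eq_zero_or_pos with rfl | hm
  · simp
  have hm' : (0 : ℝ) < m := Nat.cast_pos.2 hm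
  have hfactorial : (0 : ℝ) < m.factorial := Nat.cast_pos.2 m.factorial_pos
  have hlog := Real.log_le_log (by positivity) (Real.pow_div_factorial_le_exp _ hm'.le m)
  rw [Real.log_div (by positivity) hfactorial.ne', Real.log_pow, Real.log_exp] at hlog
  linarith

theorem log_factorial_le (m : ℕ) :
    Real.log m.factorial ≤ (m : ℝ) * Real.log m - m + 1 + Real.log m := by
  rcases m with _ | m
  · simp
  have hstirling : Stirling.stirlingSeq (m + 1) ≤ Real.exp 1 / √2 := by
    rw [← Stirling.stirlingSeq_one]
    exact Stirling.stirlingSeq'_antitone m.zero_le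
  have hm : ((m + 1 : ℕ) : ℝ) ≠ 0 := Nat.cast_ne_zero.2 m.succ_ne_zero
  have hlog := Real.log_le_log (Stirling.stirlingSeq'_pos m) hstirling
  rw [Stirling.log_stirlingSeq_formula, Real.log_div (Real.exp_ne_zero 1) (by positivity),
    Real.log_exp, Real.log_sqrt zero_le_two, Real.log_div hm (Real.exp_ne_zero 1),
    Real.log_exp, Real.log_mul two_ne_zero hm] at hlog
  linarith [Real.log_natCast_nonneg (m + 1)]

theorem HasDensity.tendsto_log_factorial (hn : Tendsto n l atTop) {m : X → ℕ} {c : ℝ}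
    (hm : HasDensity l n m c) :
    Tendsto (fun x => 1 / (n x : ℝ) * Real.log (m x).factorial
      - (m x : ℝ) / n x * (Real.log (n x) - 1)) l (𝓝 (-Real.negMulLog c)) := by
  have hlower : Tendsto (fun x => -Real.negMulLog ((m x : ℝ) / n x)) l
      (𝓝 (-Real.negMulLog c)) := ((Real.continuous_negMulLog.tendsto c).comp hm).neg
  have hinv : Tendsto (fun x => 1 / (n x : ℝ)) l (𝓝 0) :=
    tendsto_one_div_atTop_nhds_zero_nat.comp hn
  have hupper : Tendsto (fun x => -Real.negMulLog ((m x : ℝ) / n x)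
      + 1 / (n x : ℝ) * (1 + (m x : ℝ) / n x) + 1 / (n x : ℝ) * Real.log (n x)) l
      (𝓝 (-Real.negMulLog c)) := by
    simpa using (hlower.add (hinv.mul (Tendsto.const_add 1 hm))).add
      (hasGrowthRate_size hn).tendsto
  have hmain : ∀ x, 0 < n x → 1 / (n x : ℝ) * ((m x : ℝ) * Real.log (m x) - m x)
      = -Real.negMulLog ((m x : ℝ) / n x) + (m x : ℝ) / n x * (Real.log (n x) - 1) :=
    fun x hx => by
      rcases (m x).eq_zero_or_pos with hmx | hmx
      · simp [hmx]
      · rw [Real.negMulLog, Real.log_div (Nat.cast_ne_zero.2 hmx.ne') (Nat.cast_ne_zero.2 hx.ne')]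
        ring
  refine tendsto_of_tendsto_of_tendsto_of_le_of_le' hlower hupper ?_ ?_ <;>
    filter_upwards [hn.eventually_gt_atTop 0] with x hx
  · rw [le_sub_iff_add_le, ← hmain x hx]
    exact mul_le_mul_of_nonneg_left (le_log_factorial _) (by positivity)
  · have hn0 : (0 : ℝ) < n x := Nat.cast_pos.2 hx
    have hlog : Real.log (m x) ≤ Real.log (n x) + (m x : ℝ) / n x := by
      rcases (m x).eq_zero_or_pos with hmx | hmx
      · simpa [hmx] using Real.log_natCast_nonneg (n x)
      · have hm0 : (0 : ℝ) < m x := Nat.cast_pos.2 hmx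
        have hratio := Real.log_le_sub_one_of_pos (div_pos hm0 hn0)
        rw [Real.log_div hm0.ne' hn0.ne'] at hratio
        linarith
    rw [sub_le_iff_le_add]
    calc 1 / (n x : ℝ) * Real.log (m x).factorial
        ≤ 1 / (n x : ℝ) * ((m x : ℝ) * Real.log (m x) - m x
            + (1 + (m x : ℝ) / n x) + Real.log (n x)) := by
          gcongr
          linarith [log_factorial_le (m x)]
      _ = _ := by
          rw [mul_add, mul_add, hmain x hx]
          ring

theorem hasGrowthRate_multinomial (hn : Tendsto n l atTop) {m : X → ι → ℕ} {c : ι → ℝ}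
    (hm : ∀ i, HasDensity l n (fun x => m x i) (c i)) :
    HasGrowthRate l n (fun x => (Nat.multinomial Finset.univ (m x) : ℝ)) (entropy c) := by
  refine ⟨Eventually.of_forall fun x => Nat.cast_pos.2 (Nat.multinomial_pos _ _), ?_⟩
  have hlimit := ((HasDensity.sum hm).tendsto_log_factorial hn).sub
    (tendsto_finsetSum Finset.univ fun i _ => (hm i).tendsto_log_factorial hn)
  rw [Finset.sum_neg_distrib, neg_sub_neg] at hlimit
  refine hlimit.congr fun x => ?_
  have hfactorial : ∀ k : ℕ, (k.factorial : ℝ) ≠ 0 := fun k =>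
    Nat.cast_ne_zero.2 k.factorial_ne_zero
  have hlog : Real.log (∑ i, m x i).factorial = ∑ i, Real.log (m x i).factorial
      + Real.log (Nat.multinomial Finset.univ (m x)) := by
    rw [← Nat.multinomial_spec, Nat.cast_mul, Nat.cast_prod, Real.log_mul
      (Finset.prod_ne_zero_iff.2 fun i _ => hfactorial _)
      (Nat.cast_ne_zero.2 (Nat.multinomial_pos _ _).ne'), Real.log_prod fun i _ => hfactorial _]
  rw [hlog, Finset.sum_sub_distrib, ← Finset.sum_mul, ← Finset.sum_div, ← Nat.cast_sum,
    ← Finset.mul_sum]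
  ring

end MultinomialGrowth

section Rounding

variable {q : ℕ}

/-- The matrix with row sums `u` and column sums `v` that extends `M` by a zeroth row and a zeroth
column. The subtractions are truncated: `M` must leave room for the entries of these two. -/
def completeMargins (u v : Fin (q + 1) → ℕ) (M : Fin q → Fin q → ℕ) :
    Fin (q + 1) → Fin (q + 1) → ℕ :=
  Fin.cons (Fin.cons (u 0 - ∑ j, (v j.succ - ∑ i, M i j)) fun j => v j.succ - ∑ i, M i j)
    fun i => Fin.cons (u i.succ - ∑ j, M i j) (M i)

variable {u v : Fin (q + 1) → ℕ} {M : Fin q → Fin q → ℕ}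

theorem sum_row_completeMargins (hrow : ∀ i, ∑ j, M i j ≤ u i.succ)
    (hcorner : ∑ j, (v j.succ - ∑ i, M i j) ≤ u 0) (i : Fin (q + 1)) :
    ∑ j, completeMargins u v M i j = u i := by
  rw [Fin.sum_univ_succ]
  induction i using Fin.cases with
  | zero => exact Nat.sub_add_cancel hcorner
  | succ i => exact Nat.sub_add_cancel (hrow i)

theorem sum_col_completeMargins (huv : ∑ i, u i = ∑ j, v j)
    (hrow : ∀ i, ∑ j, M i j ≤ u i.succ) (hcol : ∀ j, ∑ i, M i j ≤ v j.succ)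
    (hcorner : ∑ j, (v j.succ - ∑ i, M i j) ≤ u 0) (j : Fin (q + 1)) :
    ∑ i, completeMargins u v M i j = v j := by
  have hsucc : ∀ j : Fin q, ∑ i, completeMargins u v M i j.succ = v j.succ := fun j => by
    rw [Fin.sum_univ_succ]
    exact Nat.sub_add_cancel (hcol j)
  induction j using Fin.cases with
  | zero =>
    have htotal : ∑ j, ∑ i, completeMargins u v M i j = ∑ j, v j := by
      rw [Finset.sum_comm, ← huv]
      exact Finset.sum_congr rfl fun i _ => sum_row_completeMargins hrow hcorner i
    rw [Fin.sum_univ_succ, Fin.sum_univ_succ v, Finset.sum_congr rfl fun j _ => hsucc j] at htotal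
    exact Nat.add_right_cancel htotal
  | succ j => exact hsucc j

variable {X : Type*} {l : Filter X} {n : X → ℕ}

namespace HasDensity

variable {u : X → ℕ} {m : X → Fin q → ℕ} {U : Fin (q + 1) → ℝ}

theorem eventually_sum_tail_le (hn : Tendsto n l atTop) (hU : 0 < U 0)
    (hu : HasDensity l n u (∑ i, U i)) (hm : ∀ i, HasDensity l n (fun x => m x i) (U i.succ)) :
    ∀ᶠ x in l, ∑ i, m x i ≤ u x :=
  hu.eventually_le hn (HasDensity.sum hm) (by
    rw [Fin.sum_univ_succ U]
    exact lt_add_of_pos_left _ hU)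

theorem sub_sum_tail (hn : Tendsto n l atTop) (hU : 0 < U 0)
    (hu : HasDensity l n u (∑ i, U i)) (hm : ∀ i, HasDensity l n (fun x => m x i) (U i.succ)) :
    HasDensity l n (fun x => u x - ∑ i, m x i) (U 0) := by
  rw [Fin.sum_univ_succ] at hu
  simpa only [add_sub_cancel_right] using
    hu.natSub hn (HasDensity.sum hm) (lt_add_of_pos_left _ hU)

end HasDensity

variable {u v : X → Fin (q + 1) → ℕ} {M : X → Fin q → Fin q → ℕ}
  {P : Fin (q + 1) → Fin (q + 1) → ℝ}

theorem hasDensity_completeMargins (hn : Tendsto n l atTop) (hP₀ : ∀ i, 0 < P i 0)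
    (hP₀' : ∀ j, 0 < P 0 j) (hu : ∀ i, HasDensity l n (fun x => u x i) (∑ j, P i j))
    (hv : ∀ j, HasDensity l n (fun x => v x j) (∑ i, P i j))
    (hM : ∀ i j, HasDensity l n (fun x => M x i j) (P i.succ j.succ)) (i j : Fin (q + 1)) :
    HasDensity l n (fun x => completeMargins (u x) (v x) (M x) i j) (P i j) := by
  have hrow₀ : ∀ j : Fin q, HasDensity l n (fun x => v x j.succ - ∑ i, M x i j) (P 0 j.succ) :=
    fun j => HasDensity.sub_sum_tail (U := fun i => P i j.succ) hn (hP₀' _) (hv j.succ) (hM · j)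
  induction i using Fin.cases with
  | zero =>
    induction j using Fin.cases with
    | zero => exact (hu 0).sub_sum_tail hn (hP₀ 0) hrow₀
    | succ j => exact hrow₀ j
  | succ i =>
    induction j using Fin.cases with
    | zero => exact (hu i.succ).sub_sum_tail hn (hP₀ _) (hM i)
    | succ j => exact hM i j

theorem eventually_sum_completeMargins (hn : Tendsto n l atTop) (hP₀ : ∀ i, 0 < P i 0)
    (hP₀' : ∀ j, 0 < P 0 j) (hu : ∀ i, HasDensity l n (fun x => u x i) (∑ j, P i j))
    (hv : ∀ j, HasDensity l n (fun x => v x j) (∑ i, P i j))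
    (huv : ∀ᶠ x in l, ∑ i, u x i = ∑ j, v x j)
    (hM : ∀ i j, HasDensity l n (fun x => M x i j) (P i.succ j.succ)) :
    ∀ᶠ x in l, (∀ i, ∑ j, completeMargins (u x) (v x) (M x) i j = u x i) ∧
      ∀ j, ∑ i, completeMargins (u x) (v x) (M x) i j = v x j := by
  filter_upwards [huv,
    eventually_all.2 fun i : Fin q => (hu i.succ).eventually_sum_tail_le hn (hP₀ _) (hM i),
    eventually_all.2 fun j : Fin q => HasDensity.eventually_sum_tail_le (U := fun i => P i j.succ)
      hn (hP₀' _) (hv j.succ) (hM · j),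
    (hu 0).eventually_sum_tail_le hn (hP₀ 0)
      (hasDensity_completeMargins hn hP₀ hP₀' hu hv hM 0 ·.succ)] with x huv hrow hcol hcorner
  exact ⟨sum_row_completeMargins hrow hcorner, sum_col_completeMargins huv hrow hcol hcorner⟩

/-- Round down outside the zeroth row and column, which absorb the rounding errors. -/
theorem exists_hasDensity_of_margins (hn : Tendsto n l atTop) (hP : ∀ i j, 0 ≤ P i j)
    (hP₀ : ∀ i, 0 < P i 0) (hP₀' : ∀ j, 0 < P 0 j)
    (hu : ∀ i, HasDensity l n (fun x => u x i) (∑ j, P i j))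
    (hv : ∀ j, HasDensity l n (fun x => v x j) (∑ i, P i j))
    (huv : ∀ᶠ x in l, ∑ i, u x i = ∑ j, v x j) :
    ∃ N : X → Fin (q + 1) → Fin (q + 1) → ℕ,
      (∀ i j, HasDensity l n (fun x => N x i j) (P i j)) ∧
      (∀ᶠ x in l, (∀ i, ∑ j, N x i j = u x i) ∧ ∀ j, ∑ i, N x i j = v x j) ∧
      ∀ x i j, P i j = 0 → N x i j = 0 := by
  set M : X → Fin q → Fin q → ℕ := fun x i j => ⌊P i.succ j.succ * (n x : ℝ)⌋₊ with hM_def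
  have hM : ∀ i j, HasDensity l n (fun x => M x i j) (P i.succ j.succ) := fun i j =>
    hasDensity_floor_mul hn (hP _ _)
  refine ⟨fun x => completeMargins (u x) (v x) (M x),
    hasDensity_completeMargins hn hP₀ hP₀' hu hv hM,
    eventually_sum_completeMargins hn hP₀ hP₀' hu hv huv hM, fun x i j hij => ?_⟩
  obtain ⟨i, rfl⟩ := Fin.exists_succ_eq.2 fun hi : i = 0 => (hP₀' j).ne' (hi ▸ hij)
  obtain ⟨j, rfl⟩ := Fin.exists_succ_eq.2 fun hj : j = 0 => (hP₀ i.succ).ne' (hj ▸ hij)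
  have hfloor : M x i j = 0 := by simp only [hM_def, hij, zero_mul, Nat.floor_zero]
  exact hfloor

theorem exists_counts_hasDensity {α : Fin (q + 1) → ℝ} (hα : ∀ i, 0 < α i) (hα1 : ∑ i, α i = 1) :
    ∃ a : ℕ → Fin (q + 1) → ℕ, (∀ i, HasDensity atTop id (fun n => a n i) (α i)) ∧
      ∀ᶠ n in atTop, ∑ i, a n i = n := by
  have htail : ∀ i : Fin q, HasDensity atTop id (fun n => ⌊α i.succ * (n : ℝ)⌋₊) (α i.succ) :=
    fun i => hasDensity_floor_mul tendsto_id (hα _).le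
  have hsize := hα1 ▸ hasDensity_self (l := atTop) tendsto_id
  refine ⟨fun n => Fin.cons (n - ∑ i : Fin q, ⌊α i.succ * (n : ℝ)⌋₊)
    fun i => ⌊α i.succ * (n : ℝ)⌋₊, fun i => ?_, ?_⟩
  · induction i using Fin.cases with
    | zero => exact hsize.sub_sum_tail tendsto_id (hα 0) htail
    | succ i => exact htail i
  · filter_upwards [hsize.eventually_sum_tail_le tendsto_id (hα 0) htail] with n hn
    rw [Fin.sum_univ_succ]
    exact Nat.sub_add_cancel hn

end Rounding

section PhaseFilter

variable {q : ℕ} {α β : Fin (q + 1) → ℝ}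

theorem tendsto_size_phaseFilter : Tendsto (fun x => x.1) (phaseFilter α β) atTop :=
  tendsto_comap.mono_left (inf_le_left.trans (inf_le_left.trans inf_le_left))

theorem hasDensity_left_phaseFilter (i : Fin (q + 1)) :
    HasDensity (phaseFilter α β) (fun x => x.1) (fun x => x.2.1 i) (α i) := by
  have hleft : phaseFilter α β ≤ comap (fun x i => (x.2.1 i : ℝ) / (x.1 : ℝ)) (𝓝 α) :=
    inf_le_left.trans (inf_le_left.trans inf_le_right)
  exact tendsto_pi_nhds.1 (tendsto_comap.mono_left hleft) i

theorem hasDensity_right_phaseFilter (i : Fin (q + 1)) :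
    HasDensity (phaseFilter α β) (fun x => x.1) (fun x => x.2.2 i) (β i) := by
  have hright : phaseFilter α β ≤ comap (fun x i => (x.2.2 i : ℝ) / (x.1 : ℝ)) (𝓝 β) :=
    inf_le_left.trans inf_le_right
  exact tendsto_pi_nhds.1 (tendsto_comap.mono_left hright) i

theorem eventually_sum_phaseFilter :
    ∀ᶠ x in phaseFilter α β, ∑ i, x.2.1 i = x.1 ∧ ∑ i, x.2.2 i = x.1 :=
  (inf_le_right : phaseFilter α β ≤ _) (mem_principal_self _)

theorem phaseFilter_neBot (hα : ∀ i, 0 < α i) (hα1 : ∑ i, α i = 1) (hβ : ∀ i, 0 < β i)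
    (hβ1 : ∑ i, β i = 1) : (phaseFilter α β).NeBot := by
  obtain ⟨a, ha, hasum⟩ := exists_counts_hasDensity hα hα1
  obtain ⟨b, hb, hbsum⟩ := exists_counts_hasDensity hβ hβ1
  have htendsto : Tendsto (fun n => (n, a n, b n)) atTop (phaseFilter α β) := by
    simp only [phaseFilter, tendsto_inf, tendsto_comap_iff, tendsto_principal]
    exact ⟨⟨⟨tendsto_id, tendsto_pi_nhds.2 ha⟩, tendsto_pi_nhds.2 hb⟩, hasum.and hbsum⟩
  exact htendsto.neBot

end PhaseFilter

section FirstMomentRate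

section EdgeDistribution

variable {ι κ : Type*} [Fintype κ] {B : Matrix ι κ ℝ} {α : ι → ℝ} {z : κ → ℝ}

/-- The joint law of the colours at the two ends of an edge in which the left colour has law `α`
and, given the left colour `i`, the right colour `j` has weight proportional to `B i j * z j`. -/
noncomputable def edgeDistribution (B : Matrix ι κ ℝ) (α : ι → ℝ) (z : κ → ℝ) (i : ι) (j : κ) : ℝ :=
  α i * (B i j * z j / ∑ j', B i j' * z j')

theorem sum_edgeDistribution {i : ι} (hBz : 0 < ∑ j, B i j * z j) :
    ∑ j, edgeDistribution B α z i j = α i := by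
  simp only [edgeDistribution, ← Finset.mul_sum, ← Finset.sum_div, div_self hBz.ne', mul_one]

theorem edgeDistribution_eq_zero {i : ι} {j : κ} (hB : B i j = 0) :
    edgeDistribution B α z i j = 0 := by
  simp only [edgeDistribution, hB, zero_mul, zero_div, mul_zero]

theorem edgeDistribution_nonneg {i : ι} {j : κ} (hα : 0 ≤ α i) (hB : 0 ≤ B i j) (hz : 0 ≤ z j)
    (hBz : 0 < ∑ j, B i j * z j) : 0 ≤ edgeDistribution B α z i j :=
  mul_nonneg hα (div_nonneg (mul_nonneg hB hz) hBz.le)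

theorem edgeDistribution_pos {i : ι} {j : κ} (hα : 0 < α i) (hB : 0 < B i j) (hz : 0 < z j)
    (hBz : 0 < ∑ j, B i j * z j) : 0 < edgeDistribution B α z i j :=
  mul_pos hα (div_pos (mul_pos hB hz) hBz)

theorem negMulLog_edgeDistribution {i : ι} {j : κ} (hB : 0 ≤ B i j) (hz : 0 < z j)
    (hBz : 0 < ∑ j, B i j * z j) :
    Real.negMulLog (edgeDistribution B α z i j)
        + edgeDistribution B α z i j * Real.log (B i j)
      = B i j * z j / (∑ j, B i j * z j) * Real.negMulLog (α i)
        + edgeDistribution B α z i j * (Real.log (∑ j, B i j * z j) - Real.log (z j)) := by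
  rw [edgeDistribution, Real.negMulLog_mul]
  rcases hB.eq_or_lt with hB | hB
  · simp [← hB]
  · rw [Real.negMulLog.eq_def (_ / _), Real.log_div (mul_pos hB hz).ne' hBz.ne',
      Real.log_mul hB.ne' hz.ne']
    ring

theorem entropy_edgeDistribution [Fintype ι] (hB : ∀ i j, 0 ≤ B i j) (hz : ∀ j, 0 < z j)
    (hBz : ∀ i, 0 < ∑ j, B i j * z j) :
    entropy (fun x : ι × κ => edgeDistribution B α z x.1 x.2)
        + ∑ x : ι × κ, edgeDistribution B α z x.1 x.2 * Real.log (B x.1 x.2)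
      = entropy α + ∑ i, α i * Real.log (∑ j, B i j * z j)
        - ∑ j, (∑ i, edgeDistribution B α z i j) * Real.log (z j) := by
  have hterms : ∑ i, ∑ j, (Real.negMulLog (edgeDistribution B α z i j)
        + edgeDistribution B α z i j * Real.log (B i j))
      = ∑ i, (Real.negMulLog (α i) + α i * Real.log (∑ j, B i j * z j)
        - ∑ j, edgeDistribution B α z i j * Real.log (z j)) := by
    refine Finset.sum_congr rfl fun i _ => ?_
    simp only [negMulLog_edgeDistribution (hB i _) (hz _) (hBz i), mul_sub,
      Finset.sum_add_distrib, Finset.sum_sub_distrib, ← Finset.sum_mul, ← Finset.sum_div,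
      div_self (hBz i).ne', one_mul, sum_edgeDistribution (hBz i)]
    ring
  have hright : ∑ j, (∑ i, edgeDistribution B α z i j) * Real.log (z j)
      = ∑ i, ∑ j, edgeDistribution B α z i j * Real.log (z j) := by
    rw [Finset.sum_comm]
    exact Finset.sum_congr rfl fun j _ => Finset.sum_mul _ _ _
  simp only [Finset.sum_add_distrib, Finset.sum_sub_distrib] at hterms
  simp only [entropy, Fintype.sum_prod_type, sum_edgeDistribution (hBz _), hright]
  linarith

end EdgeDistribution

variable {X : Type*} {l : Filter X} {n : X → ℕ} {q Δ : ℕ}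
  {B : Matrix (Fin (q + 1)) (Fin (q + 1)) ℝ} {a b : X → Fin (q + 1) → ℕ}
  {α β z : Fin (q + 1) → ℝ}

/-- The growth rate of the upper bound on the first moment at colour densities `α`, `β` that the
positive vector `z` provides. -/
noncomputable def tiltedRate (B : Matrix (Fin (q + 1)) (Fin (q + 1)) ℝ) (Δ : ℕ)
    (α β z : Fin (q + 1) → ℝ) : ℝ :=
  entropy α + entropy β - Δ * entropy β
    + Δ * (∑ i, α i * Real.log (∑ j, B i j * z j) - ∑ j, β j * Real.log (z j))

theorem exists_hasGrowthRate_firstMoment_le (hn : Tendsto n l atTop)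
    (ha : ∀ i, HasDensity l n (fun x => a x i) (α i))
    (hb : ∀ j, HasDensity l n (fun x => b x j) (β j))
    (hab : ∀ᶠ x in l, ∑ i, a x i = n x ∧ ∑ j, b x j = n x) (hB : ∀ i j, 0 ≤ B i j)
    (hz : ∀ j, 0 < z j) (hBz : ∀ i, 0 < ∑ j, B i j * z j) :
    ∃ g : X → ℝ, HasGrowthRate l n g (tiltedRate B Δ α β z) ∧
      ∀ᶠ x in l, firstMoment B Δ (n x) (a x) (b x) ≤ g x := by
  have hpow : ∀ {m : X → Fin (q + 1) → ℕ} {γ y : Fin (q + 1) → ℝ},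
      (∀ i, HasDensity l n (fun x => m x i) (γ i)) → (∀ i, 0 < y i) →
      HasGrowthRate l n (fun x => ∏ i, y i ^ (Δ * m x i)) (∑ i, Δ * γ i * Real.log (y i)) :=
    fun hm hy => HasGrowthRate.prod fun i =>
      ((hm i).const_mul Δ).hasGrowthRate_pow (Eventually.of_forall fun x => pow_pos (hy i) _)
  have hΔn := hn.eventually_ge_atTop Δ
  have hrate := ((hasGrowthRate_simplicityFactor hn (Eventually.of_forall fun _ => le_rfl) hΔn).mul
    (((hasGrowthRate_multinomial hn ha).mul (hasGrowthRate_multinomial hn hb)).div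
      (hasGrowthRate_multinomial hn fun j => (hb j).const_mul Δ))).mul
        ((hpow ha hBz).div (hpow hb hz))
  rw [entropy_const_mul] at hrate
  simp only [mul_assoc (Δ : ℝ), ← Finset.mul_sum, ← mul_sub, zero_add] at hrate
  refine ⟨_, hrate, ?_⟩
  filter_upwards [hab, hΔn] with x hx hΔx
  simpa only [mul_assoc] using firstMoment_le hB hΔx hx.1 hx.2 hz

theorem exists_hasGrowthRate_le_firstMoment (hn : Tendsto n l atTop) (hΔ : 0 < Δ)
    (ha : ∀ i, HasDensity l n (fun x => a x i) (α i))
    (hb : ∀ j, HasDensity l n (fun x => b x j) (β j))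
    (hab : ∀ᶠ x in l, ∑ i, a x i = n x ∧ ∑ j, b x j = n x) (hα : ∀ i, 0 < α i)
    (hB : ∀ i j, 0 ≤ B i j) {P : Fin (q + 1) → Fin (q + 1) → ℝ} (hP : ∀ i j, 0 ≤ P i j)
    (hP₀ : ∀ i, 0 < P i 0) (hP₀' : ∀ j, 0 < P 0 j) (hrow : ∀ i, ∑ j, P i j = α i)
    (hcol : ∀ j, ∑ i, P i j = β j) (hBP : ∀ i j, B i j = 0 → P i j = 0) :
    ∃ g : X → ℝ, HasGrowthRate l n g (entropy α + entropy β - Δ * (entropy α + entropy β)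
        + Δ * (entropy (fun x : Fin (q + 1) × Fin (q + 1) => P x.1 x.2)
          + ∑ x : Fin (q + 1) × Fin (q + 1), P x.1 x.2 * Real.log (B x.1 x.2))) ∧
      ∀ᶠ x in l, g x ≤ firstMoment B Δ (n x) (a x) (b x) := by
  have hΔ' : (0 : ℝ) < Δ := Nat.cast_pos.2 hΔ
  have hΔa : ∀ᶠ x in l, ∀ i, Δ ≤ a x i := eventually_all.2 fun i =>
    (ha i).eventually_le hn (hasDensity_const hn Δ) (hα i)
  obtain ⟨N, hN, hmargins, hN0⟩ := exists_hasDensity_of_margins (P := fun i j => Δ * P i j)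
    (u := fun x i => Δ * a x i) (v := fun x j => Δ * b x j) hn
    (fun i j => mul_nonneg hΔ'.le (hP i j)) (fun i => mul_pos hΔ' (hP₀ i))
    (fun j => mul_pos hΔ' (hP₀' j))
    (fun i => by simpa only [← Finset.mul_sum, hrow] using (ha i).const_mul Δ)
    (fun j => by simpa only [← Finset.mul_sum, hcol] using (hb j).const_mul Δ)
    (by filter_upwards [hab] with x hx using by simp only [← Finset.mul_sum, hx])
  have hBN : ∀ i j x, 0 < B i j ^ N x i j := fun i j x => by
    rcases (hB i j).eq_or_lt with h0 | hpos
    · rw [hN0 x i j (by rw [hBP i j h0.symm, mul_zero]), pow_zero]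
      exact one_pos
    · exact pow_pos hpos _
  have han : ∀ i, ∀ᶠ x in l, a x i ≤ n x := fun i => hab.mono fun x hx =>
    hx.1 ▸ Finset.single_le_sum (fun _ _ => Nat.zero_le _) (Finset.mem_univ i)
  have hsimple := HasGrowthRate.prod fun i =>
    hasGrowthRate_simplicityFactor hn (m := fun x => a x i) (han i) (hΔa.mono fun x hx => hx i)
  have hrate := ((((hasGrowthRate_multinomial hn ha).mul (hasGrowthRate_multinomial hn hb)).mul
    ((hasGrowthRate_multinomial hn fun y : Fin (q + 1) × Fin (q + 1) => hN y.1 y.2).mul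
      (HasGrowthRate.prod fun y : Fin (q + 1) × Fin (q + 1) =>
        (hN y.1 y.2).hasGrowthRate_pow (Eventually.of_forall (hBN y.1 y.2))))).div
    ((hasGrowthRate_multinomial hn fun i => (ha i).const_mul Δ).mul
      (hasGrowthRate_multinomial hn fun j => (hb j).const_mul Δ))).div hsimple
  simp only [entropy_const_mul, mul_assoc (Δ : ℝ), ← Finset.mul_sum, Finset.sum_const_zero,
    sub_zero] at hrate
  refine ⟨_, by convert hrate using 1; ring, ?_⟩
  filter_upwards [hab, hΔa, hmargins, hsimple.eventually_pos, hn.eventually_ge_atTop Δ]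
    with x hx hΔx hNx hpos hΔn
  exact (div_le_iff₀' hpos).2
    (le_firstMoment (N := fun y => N x y.1 y.2) hB hΔn hΔx hx.1 hx.2 hNx.1 hNx.2)

/-- The upper bound provided by `z` is tight to exponential order when the edge distribution it
induces has the right margins, because that distribution then provides a matching lower bound. -/
theorem hasGrowthRate_firstMoment (hn : Tendsto n l atTop) (hΔ : 0 < Δ)
    (ha : ∀ i, HasDensity l n (fun x => a x i) (α i))
    (hb : ∀ j, HasDensity l n (fun x => b x j) (β j))
    (hab : ∀ᶠ x in l, ∑ i, a x i = n x ∧ ∑ j, b x j = n x) (hα : ∀ i, 0 < α i)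
    (hB : ∀ i j, 0 ≤ B i j) (hB₀ : ∀ i, 0 < B i 0) (hB₀' : ∀ j, 0 < B 0 j) (hz : ∀ j, 0 < z j)
    (hcol : ∀ j, ∑ i, edgeDistribution B α z i j = β j) :
    HasGrowthRate l n (fun x => firstMoment B Δ (n x) (a x) (b x)) (tiltedRate B Δ α β z) := by
  have hBz : ∀ i, 0 < ∑ j, B i j * z j := fun i =>
    Finset.sum_pos' (fun j _ => mul_nonneg (hB i j) (hz j).le)
      ⟨0, Finset.mem_univ _, mul_pos (hB₀ i) (hz 0)⟩
  obtain ⟨g, hg, hle_g⟩ :=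
    exists_hasGrowthRate_firstMoment_le (Δ := Δ) hn ha hb hab hB hz hBz
  obtain ⟨f, hf, hf_le⟩ := exists_hasGrowthRate_le_firstMoment hn hΔ ha hb hab hα hB
    (fun i j => edgeDistribution_nonneg (hα i).le (hB i j) (hz j).le (hBz i))
    (fun i => edgeDistribution_pos (hα i) (hB₀ i) (hz 0) (hBz i))
    (fun j => edgeDistribution_pos (hα 0) (hB₀' j) (hz j) (hBz 0))
    (fun i => sum_edgeDistribution (hBz i)) hcol (fun i j => edgeDistribution_eq_zero)
  rw [entropy_edgeDistribution hB hz hBz] at hf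
  simp only [hcol] at hf
  refine (?_ : HasGrowthRate l n f (tiltedRate B Δ α β z)).squeeze hg hf_le hle_g
  convert hf using 1
  rw [tiltedRate]
  ring

theorem tendsto_logFirstMoment (hΔ : 0 < Δ) (hα : ∀ i, 0 < α i)
    (hB : ∀ i j, 0 ≤ B i j) (hB₀ : ∀ i, 0 < B i 0) (hB₀' : ∀ j, 0 < B 0 j) (hz : ∀ j, 0 < z j)
    (hcol : ∀ j, ∑ i, edgeDistribution B α z i j = β j) :
    Tendsto (logFirstMoment B Δ) (phaseFilter α β) (𝓝 (tiltedRate B Δ α β z)) :=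
  (hasGrowthRate_firstMoment tendsto_size_phaseFilter hΔ hasDensity_left_phaseFilter
    hasDensity_right_phaseFilter eventually_sum_phaseFilter hα hB hB₀ hB₀' hz hcol).tendsto

end FirstMomentRate

section ConvexMaximum

variable {E : Type*} [NormedAddCommGroup E] [NormedSpace ℝ E] {S : Set E}

theorem fderiv_apply_le_of_isMaxOn {f : E → ℝ} {f' : E →L[ℝ] ℝ} {x y : E} (hS : Convex ℝ S)
    (hx : x ∈ S) (hmax : IsMaxOn f S x) (hf : HasFDerivAt f f' x) (hy : y ∈ S) : f' y ≤ f' x := by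
  have hdir : y - x ∈ posTangentConeAt S x :=
    sub_mem_posTangentConeAt_of_segment_subset (hS.segment_subset hx hy)
  simpa using hmax.localize.hasFDerivWithinAt_nonpos hf.hasFDerivWithinAt hdir

theorem deriv_mul_le_of_isMaxOn {f : ℝ → ℝ} {f' x y : ℝ} {I : Set ℝ} (hI : Convex ℝ I) (hx : x ∈ I)
    (hmax : IsMaxOn f I x) (hf : HasDerivAt f f' x) (hy : y ∈ I) : y * f' ≤ x * f' := by
  simpa using fderiv_apply_le_of_isMaxOn hI hx hmax hf.hasFDerivAt hy

theorem isMaxOn_of_isMaxOn_sum_smul {ι : Type*} [Fintype ι] {g : E →L[ℝ] ℝ} {r : ι → ℝ}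
    {z : ι → E} (hr : ∀ i, 0 ≤ r i) (hr1 : ∑ i, r i = 1) (hz : ∀ i, z i ∈ S)
    (hmax : IsMaxOn g S (∑ i, r i • z i)) {i : ι} (hi : 0 < r i) : IsMaxOn g S (z i) := by
  set m := ∑ i, r i • z i with hm
  have hgap_nonneg : ∀ j ∈ Finset.univ, 0 ≤ r j * (g m - g (z j)) := fun j _ =>
    mul_nonneg (hr j) (sub_nonneg.2 (hmax (hz j)))
  have hgap_sum : ∑ j, r j * (g m - g (z j)) = 0 := by
    simp only [mul_sub, Finset.sum_sub_distrib, ← Finset.sum_mul, hr1, one_mul]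
    simp [hm, map_sum]
  have hgap : r i * (g m - g (z i)) = 0 :=
    (Finset.sum_eq_zero_iff_of_nonneg hgap_nonneg).1 hgap_sum i (Finset.mem_univ i)
  have heq : g m = g (z i) := sub_eq_zero.1 ((mul_eq_zero.1 hgap).resolve_left hi.ne')
  exact fun v hv => (hmax hv).trans_eq heq

variable [FiniteDimensional ℝ E]

theorem convexHull_eq_iUnion_image_stdSimplex (S : Set E) :
    convexHull ℝ S = ⋃ n ∈ Finset.range (Module.finrank ℝ E + 2),
      (fun a : (Fin n → ℝ) × (Fin n → E) => ∑ i, a.1 i • a.2 i) ''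
        (stdSimplex ℝ (Fin n) ×ˢ Set.univ.pi fun _ => S) := by
  refine Set.Subset.antisymm (fun x hx => ?_) (Set.iUnion₂_subset fun n _ => ?_)
  · obtain ⟨ι, _, z, r, hz, hindep, hr, hr1, rfl⟩ := eq_pos_convex_span_of_mem_convexHull hx
    have hcard : Fintype.card ι < Module.finrank ℝ E + 2 := Nat.lt_succ_of_le <|
      hindep.card_le_finrank_succ.trans (Nat.succ_le_succ (Submodule.finrank_le _))
    let e := (Fintype.equivFin ι).symm
    refine Set.mem_biUnion (Finset.mem_range.2 hcard) ⟨(r ∘ e, z ∘ e), ⟨⟨fun i => (hr _).le, ?_⟩,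
      fun i _ => hz ⟨e i, rfl⟩⟩, ?_⟩
    · exact (e.sum_comp r).trans hr1
    · exact e.sum_comp fun i => r i • z i
  · rintro _ ⟨a, ⟨⟨hr, hr1⟩, hz⟩, rfl⟩
    exact (convex_convexHull ℝ S).sum_mem (fun i _ => hr i) hr1
      fun i _ => subset_convexHull ℝ S (hz i trivial)

theorem isCompact_convexHull (hS : IsCompact S) : IsCompact (convexHull ℝ S) := by
  rw [convexHull_eq_iUnion_image_stdSimplex]
  refine Finset.isCompact_biUnion _ fun n _ => IsCompact.image ?_ (by fun_prop)
  exact (isCompact_stdSimplex ℝ (Fin n)).prod (isCompact_univ_pi fun _ => hS)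

end ConvexMaximum

section Relaxation

/-- The exponent `p = Δ / (Δ - 1)`, where `Δ = d + 1`. -/
noncomputable abbrev phaseExp (d : ℕ) : ℝ := ((d : ℝ) + 1) / d

/-- The statistics `(((ξ, ξ ^ p), (η, η ^ p)), ξ η)` of a pair of messages, in which the growth
rate depends on the two messages of each colour only through their averages over the colours. -/
noncomputable def moments (d : ℕ) (ξ η : ℝ) : ((ℝ × ℝ) × (ℝ × ℝ)) × ℝ :=
  (((ξ, ξ ^ phaseExp d), (η, η ^ phaseExp d)), ξ * η)

/-- The averages of `moments` over distributions of messages in the box `[0, c]²`: the domain of the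
relaxed optimisation problem. -/
def momentHull (d : ℕ) (c : ℝ) : Set (((ℝ × ℝ) × (ℝ × ℝ)) × ℝ) :=
  convexHull ℝ ((fun z : ℝ × ℝ => moments d z.1 z.2) '' (Set.Icc 0 c ×ˢ Set.Icc 0 c))

/-- The factor `A` of the fixpoint equations `x = A (1 - y) ^ d`, determined by the average
message `X` of the `q` colours: in total weight `1`, the special colour carries `w A`. -/
noncomputable def scale (q w X : ℝ) : ℝ := (1 - q * X) / w

/-- The sum of the `p`-th powers of messages of total weight `1`, where `q` colours have average
message `u.1` and average power `u.2`, and the special colour contributes `w` terms. -/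
noncomputable def normPow (d : ℕ) (q w : ℝ) (u : ℝ × ℝ) : ℝ :=
  w * scale q w u.1 ^ phaseExp d + q * u.2

/-- The growth rate as a function of the averaged statistics of `q` colours. -/
noncomputable def rate (d : ℕ) (q w : ℝ) (m : ((ℝ × ℝ) × (ℝ × ℝ)) × ℝ) : ℝ :=
  ((d : ℝ) + 1) * Real.log (1 - q * m.2) - d * Real.log (normPow d q w m.1.1)
    - d * Real.log (normPow d q w m.1.2)

/-- Up to a negative factor, the derivative of `normPow` at `u`. -/
noncomputable def normPowGradient (d : ℕ) (q w : ℝ) (u : ℝ × ℝ) : ℝ × ℝ →L[ℝ] ℝ :=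
  scale q w u.1 ^ (d : ℝ)⁻¹ • ContinuousLinearMap.fst ℝ ℝ ℝ
    - (phaseExp d)⁻¹ • ContinuousLinearMap.snd ℝ ℝ ℝ

/-- Up to a positive factor, the derivative of `rate` at `m`. -/
noncomputable def rateGradient (d : ℕ) (q w : ℝ) (m : ((ℝ × ℝ) × (ℝ × ℝ)) × ℝ) :
    ((ℝ × ℝ) × (ℝ × ℝ)) × ℝ →L[ℝ] ℝ :=
  -((1 - q * m.2)⁻¹ • ContinuousLinearMap.snd ℝ ((ℝ × ℝ) × (ℝ × ℝ)) ℝ)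
    + ((normPow d q w m.1.1)⁻¹ • (normPowGradient d q w m.1.1).comp
          (ContinuousLinearMap.fst ℝ (ℝ × ℝ) (ℝ × ℝ))
        + (normPow d q w m.1.2)⁻¹ • (normPowGradient d q w m.1.2).comp
          (ContinuousLinearMap.snd ℝ (ℝ × ℝ) (ℝ × ℝ))).comp
      (ContinuousLinearMap.fst ℝ ((ℝ × ℝ) × (ℝ × ℝ)) ℝ)

/-- The parameters for which the relaxation over messages in the box `[0, c]²` is well behaved: all
logarithms in `rate` have positive arguments, and no maximiser has a message equal to `c`. -/
structure IsMessageBox (q w c : ℝ) : Prop where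
  q_pos : 0 < q
  w_pos : 0 < w
  inv_lt : w⁻¹ < c
  lt_one : c < 1
  mul_lt_one : q * c < 1

variable {d : ℕ} {q w c : ℝ}

theorem one_le_phaseExp (hd : 0 < d) : 1 ≤ phaseExp d := by
  rw [one_le_div (Nat.cast_pos.2 hd)]
  linarith

theorem phaseExp_eq (hd : 0 < d) : phaseExp d = 1 + (d : ℝ)⁻¹ := by
  have : (d : ℝ) ≠ 0 := Nat.cast_ne_zero.2 hd.ne'
  rw [phaseExp, add_div, div_self this, one_div]

theorem rpow_phaseExp (hd : 0 < d) {x : ℝ} (hx : 0 ≤ x) : x ^ phaseExp d = x * x ^ (d : ℝ)⁻¹ := by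
  rw [phaseExp_eq hd, Real.rpow_add' hx (by positivity), Real.rpow_one]

theorem continuous_rpow_phaseExp (d : ℕ) : Continuous fun x : ℝ => x ^ phaseExp d :=
  Real.continuous_rpow_const (by positivity)

theorem continuous_normPow (d : ℕ) (q w : ℝ) : Continuous (normPow d q w) := by
  have := continuous_rpow_phaseExp d
  unfold normPow scale
  fun_prop

theorem moments_mem_momentHull {ξ η : ℝ} (hξ : ξ ∈ Set.Icc 0 c) (hη : η ∈ Set.Icc 0 c) :
    moments d ξ η ∈ momentHull d c :=
  subset_convexHull ℝ _ ⟨(ξ, η), ⟨hξ, hη⟩, rfl⟩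

theorem momentHull_subset (hc : 0 ≤ c) : momentHull d c ⊆
    ((Set.Icc 0 c ×ˢ Set.Ici 0) ×ˢ (Set.Icc 0 c ×ˢ Set.Ici 0)) ×ˢ Set.Iic (c * c) := by
  have hside : Convex ℝ (Set.Icc (0 : ℝ) c ×ˢ Set.Ici (0 : ℝ)) :=
    (convex_Icc 0 c).prod (convex_Ici 0)
  refine convexHull_min ?_ ((hside.prod hside).prod (convex_Iic _))
  rintro _ ⟨⟨ξ, η⟩, ⟨hξ, hη⟩, rfl⟩
  exact ⟨⟨⟨hξ, Real.rpow_nonneg hξ.1 _⟩, hη, Real.rpow_nonneg hη.1 _⟩,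
    mul_le_mul hξ.2 hη.2 hη.1 hc⟩

theorem isCompact_momentHull (d : ℕ) (c : ℝ) : IsCompact (momentHull d c) := by
  have := continuous_rpow_phaseExp d
  refine isCompact_convexHull ((isCompact_Icc.prod isCompact_Icc).image ?_)
  unfold moments
  fun_prop

theorem IsMessageBox.pos (hbox : IsMessageBox q w c) : 0 < c :=
  (inv_pos.2 hbox.w_pos).trans hbox.inv_lt

theorem IsMessageBox.one_sub_pos (hbox : IsMessageBox q w c) {X : ℝ} (hX : X ≤ c) :
    0 < 1 - q * X := by
  nlinarith [mul_le_mul_of_nonneg_left hX hbox.q_pos.le, hbox.mul_lt_one]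

theorem IsMessageBox.scale_pos (hbox : IsMessageBox q w c) {X : ℝ} (hX : X ≤ c) :
    0 < scale q w X :=
  div_pos (hbox.one_sub_pos hX) hbox.w_pos

theorem IsMessageBox.scale_lt (hbox : IsMessageBox q w c) {X : ℝ} (hX : 0 ≤ X) :
    scale q w X < c := by
  refine lt_of_le_of_lt ?_ hbox.inv_lt
  rw [scale, div_eq_mul_inv]
  exact mul_le_of_le_one_left (inv_nonneg.2 hbox.w_pos.le)
    (sub_le_self 1 (mul_nonneg hbox.q_pos.le hX))

theorem IsMessageBox.normPow_pos (hbox : IsMessageBox q w c) {u : ℝ × ℝ}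
    (hu : u ∈ Set.Icc 0 c ×ˢ Set.Ici (0 : ℝ)) : 0 < normPow d q w u := by
  obtain ⟨⟨-, hX⟩, hP⟩ := hu
  have hA : 0 < scale q w u.1 := hbox.scale_pos hX
  have := hbox.w_pos
  exact add_pos_of_pos_of_nonneg (by positivity) (mul_nonneg hbox.q_pos.le hP)

theorem IsMessageBox.pairing_pos (hbox : IsMessageBox q w c) {m : ((ℝ × ℝ) × (ℝ × ℝ)) × ℝ}
    (hm : m ∈ momentHull d c) : 0 < 1 - q * m.2 :=
  hbox.one_sub_pos <| (momentHull_subset hbox.pos.le hm).2.trans <|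
    mul_le_of_le_one_left hbox.pos.le hbox.lt_one.le

theorem IsMessageBox.normPow_fst_pos (hbox : IsMessageBox q w c) {m : ((ℝ × ℝ) × (ℝ × ℝ)) × ℝ}
    (hm : m ∈ momentHull d c) : 0 < normPow d q w m.1.1 :=
  hbox.normPow_pos (momentHull_subset hbox.pos.le hm).1.1

theorem IsMessageBox.normPow_snd_pos (hbox : IsMessageBox q w c) {m : ((ℝ × ℝ) × (ℝ × ℝ)) × ℝ}
    (hm : m ∈ momentHull d c) : 0 < normPow d q w m.1.2 :=
  hbox.normPow_pos (momentHull_subset hbox.pos.le hm).1.2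

theorem exists_isMaxOn_rate (d : ℕ) (hbox : IsMessageBox q w c) :
    ∃ m ∈ momentHull d c, IsMaxOn (rate d q w) (momentHull d c) m := by
  have h0 : (0 : ℝ) ∈ Set.Icc 0 c := ⟨le_rfl, hbox.pos.le⟩
  refine (isCompact_momentHull d c).exists_isMaxOn ⟨_, moments_mem_momentHull h0 h0⟩ ?_
  have hlog₀ : ContinuousOn (fun m => Real.log (1 - q * m.2)) (momentHull d c) :=
    ContinuousOn.log (by fun_prop) fun m hm => (hbox.pairing_pos hm).ne'
  have hlog₁ : ContinuousOn (fun m => Real.log (normPow d q w m.1.1)) (momentHull d c) :=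
    ((continuous_normPow d q w).comp (by fun_prop)).continuousOn.log
      fun m hm => (hbox.normPow_fst_pos hm).ne'
  have hlog₂ : ContinuousOn (fun m => Real.log (normPow d q w m.1.2)) (momentHull d c) :=
    ((continuous_normPow d q w).comp (by fun_prop)).continuousOn.log
      fun m hm => (hbox.normPow_snd_pos hm).ne'
  unfold rate
  fun_prop

theorem hasFDerivAt_normPow (hd : 0 < d) (hw : w ≠ 0) (u : ℝ × ℝ) :
    HasFDerivAt (normPow d q w) (-(q * phaseExp d) • normPowGradient d q w u) u := by
  have hd' : (d : ℝ) ≠ 0 := Nat.cast_ne_zero.2 hd.ne'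
  have hbase : HasFDerivAt (fun u : ℝ × ℝ => (1 - q * u.1) * w⁻¹)
      (w⁻¹ • -(q • ContinuousLinearMap.fst ℝ ℝ ℝ)) u :=
    ((hasFDerivAt_fst.const_mul q).const_sub 1).mul_const w⁻¹
  have h := ((hbase.rpow_const (Or.inr (one_le_phaseExp hd))).const_mul w).add
    ((hasFDerivAt_snd (𝕜 := ℝ) (p := u)).const_mul q)
  have hexp : phaseExp d - 1 = (d : ℝ)⁻¹ := by rw [phaseExp_eq hd]; ring
  rw [hexp] at h
  refine h.congr_fderiv ?_
  ext <;> simp [normPowGradient, scale, div_eq_mul_inv] <;> field_simp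

theorem IsMessageBox.hasFDerivAt_rate (hbox : IsMessageBox q w c) (hd : 0 < d)
    {m : ((ℝ × ℝ) × (ℝ × ℝ)) × ℝ} (hm : m ∈ momentHull d c) :
    HasFDerivAt (rate d q w) ((((d : ℝ) + 1) * q) • rateGradient d q w m) m := by
  have hd' : (d : ℝ) ≠ 0 := Nat.cast_ne_zero.2 hd.ne'
  have hlog₀ := ((((hasFDerivAt_snd (𝕜 := ℝ) (p := m)).const_mul q).const_sub 1).log
    (hbox.pairing_pos hm).ne').const_mul ((d : ℝ) + 1)
  have hU₁ := (hasFDerivAt_normPow (q := q) hd hbox.w_pos.ne' m.1.1).comp m (f := fun m => m.1.1)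
    (hasFDerivAt_fst.comp m hasFDerivAt_fst)
  have hU₂ := (hasFDerivAt_normPow (q := q) hd hbox.w_pos.ne' m.1.2).comp m (f := fun m => m.1.2)
    (hasFDerivAt_snd.comp m hasFDerivAt_fst)
  have hlog₁ := (hU₁.log (hbox.normPow_fst_pos hm).ne').const_mul (d : ℝ)
  have hlog₂ := (hU₂.log (hbox.normPow_snd_pos hm).ne').const_mul (d : ℝ)
  refine ((hlog₀.sub hlog₁).sub hlog₂).congr_fderiv ?_
  ext <;> simp [rateGradient, phaseExp] <;> field_simp

end Relaxation

section OptimalMixtures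

variable {ι : Type*} [Fintype ι] {d : ℕ} {q w c : ℝ} {s x y : ι → ℝ}

/-- The average of `moments` over the pairs of messages `(x i, y i)` with weights `s i`. -/
noncomputable def meanMoments (d : ℕ) (s x y : ι → ℝ) : ((ℝ × ℝ) × (ℝ × ℝ)) × ℝ :=
  ∑ i, s i • moments d (x i) (y i)

/-- The distribution giving weight `s i` to the pair of messages `(x i, y i)` maximises the growth
rate among all distributions on the box `[0, c]²`. -/
structure IsOptimalMixture (d : ℕ) (q w c : ℝ) (s x y : ι → ℝ) : Prop
    extends IsMessageBox q w c where
  weight_nonneg : ∀ i, 0 ≤ s i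
  sum_weight : ∑ i, s i = 1
  left_mem : ∀ i, x i ∈ Set.Icc 0 c
  right_mem : ∀ i, y i ∈ Set.Icc 0 c
  isMaxOn : IsMaxOn (rate d q w) (momentHull d c) (meanMoments d s x y)

/-- The contribution of a pair of messages to the linearised rate, when the fixpoint equations are
`x = A (1 - y) ^ d` and `y = A' (1 - x) ^ d`. -/
noncomputable def score (d : ℕ) (A A' ξ η : ℝ) : ℝ :=
  ξ + η - ξ * η
    - (ξ ^ phaseExp d / A ^ (d : ℝ)⁻¹ + η ^ phaseExp d / A' ^ (d : ℝ)⁻¹) / phaseExp d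

theorem meanMoments_eq (d : ℕ) (s x y : ι → ℝ) :
    meanMoments d s x y = (((∑ i, s i * x i, ∑ i, s i * x i ^ phaseExp d),
      (∑ i, s i * y i, ∑ i, s i * y i ^ phaseExp d)), ∑ i, s i * (x i * y i)) := by
  simp [meanMoments, moments, Prod.ext_iff, Prod.fst_sum, Prod.snd_sum]

theorem meanMoments_mem_momentHull (hs : ∀ i, 0 ≤ s i) (hs1 : ∑ i, s i = 1)
    (hx : ∀ i, x i ∈ Set.Icc 0 c) (hy : ∀ i, y i ∈ Set.Icc 0 c) :
    meanMoments d s x y ∈ momentHull d c :=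
  (convex_convexHull ℝ _).sum_mem (fun i _ => hs i) hs1
    fun i _ => moments_mem_momentHull (hx i) (hy i)

theorem rate_swap (d : ℕ) (q w : ℝ) (m : ((ℝ × ℝ) × (ℝ × ℝ)) × ℝ) :
    rate d q w (m.1.swap, m.2) = rate d q w m := by
  simp only [rate, Prod.fst_swap, Prod.snd_swap]
  ring

theorem swap_mem_momentHull {m : ((ℝ × ℝ) × (ℝ × ℝ)) × ℝ} (hm : m ∈ momentHull d c) :
    (m.1.swap, m.2) ∈ momentHull d c := by
  obtain ⟨ι, _, s, z, hs, hs1, hz, rfl⟩ := mem_convexHull_iff_exists_fintype.1 hm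
  refine mem_convexHull_of_exists_fintype s (fun i => ((z i).1.swap, (z i).2)) hs hs1
    (fun i => ?_) ?_
  · obtain ⟨⟨ξ, η⟩, ⟨hξ, hη⟩, hz⟩ := hz i
    exact ⟨(η, ξ), ⟨hη, hξ⟩, by simp [← hz, moments, mul_comm]⟩
  · simp [Prod.ext_iff, Prod.fst_sum, Prod.snd_sum]

theorem rateGradient_moments (m : ((ℝ × ℝ) × (ℝ × ℝ)) × ℝ) (ξ η : ℝ) :
    rateGradient d q w m (moments d ξ η) = -(ξ * η) / (1 - q * m.2)
      + (scale q w m.1.1.1 ^ (d : ℝ)⁻¹ * ξ - ξ ^ phaseExp d / phaseExp d) / normPow d q w m.1.1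
      + (scale q w m.1.2.1 ^ (d : ℝ)⁻¹ * η - η ^ phaseExp d / phaseExp d)
        / normPow d q w m.1.2 := by
  simp only [rateGradient, normPowGradient, moments, add_apply,
    neg_apply, smul_apply, ContinuousLinearMap.comp_apply,
    sub_apply, ContinuousLinearMap.coe_fst', ContinuousLinearMap.coe_snd',
    smul_eq_mul]
  ring

theorem hasDerivAt_rateGradient_moments (hd : 0 < d) (m : ((ℝ × ℝ) × (ℝ × ℝ)) × ℝ) (ξ η : ℝ) :
    HasDerivAt (fun ξ => rateGradient d q w m (moments d ξ η))
      (-η / (1 - q * m.2)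
        + (scale q w m.1.1.1 ^ (d : ℝ)⁻¹ - ξ ^ (d : ℝ)⁻¹) / normPow d q w m.1.1) ξ := by
  have hp : phaseExp d ≠ 0 := (zero_lt_one.trans_le (one_le_phaseExp hd)).ne'
  have hpair := (hasDerivAt_id ξ).mul_const η
  have hpow := (Real.hasDerivAt_rpow_const (x := ξ) (Or.inr (one_le_phaseExp hd))).div_const
    (phaseExp d)
  have hlin := (hasDerivAt_id ξ).const_mul (scale q w m.1.1.1 ^ (d : ℝ)⁻¹)
  simp only [rateGradient_moments]
  refine (((hpair.fun_neg.div_const _).fun_add ((hlin.fun_sub hpow).div_const _)).add_const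
    _).congr_deriv ?_
  rw [mul_div_cancel_left₀ _ hp, show phaseExp d - 1 = (d : ℝ)⁻¹ by rw [phaseExp_eq hd]; ring]
  simp

namespace IsOptimalMixture

theorem mem_momentHull (h : IsOptimalMixture d q w c s x y) :
    meanMoments d s x y ∈ momentHull d c :=
  meanMoments_mem_momentHull h.weight_nonneg h.sum_weight h.left_mem h.right_mem

theorem symm (h : IsOptimalMixture d q w c s x y) : IsOptimalMixture d q w c s y x where
  toIsMessageBox := h.toIsMessageBox
  weight_nonneg := h.weight_nonneg
  sum_weight := h.sum_weight
  left_mem := h.right_mem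
  right_mem := h.left_mem
  isMaxOn m hm := by
    have hswap : meanMoments d s y x = ((meanMoments d s x y).1.swap, (meanMoments d s x y).2) := by
      simp only [meanMoments_eq, Prod.swap_prod_mk, mul_comm (x _) (y _)]
    change rate d q w m ≤ rate d q w (meanMoments d s y x)
    rw [hswap, rate_swap, ← rate_swap d q w m]
    exact h.isMaxOn (swap_mem_momentHull hm)

theorem rateGradient_le (h : IsOptimalMixture d q w c s x y) (hd : 0 < d) {i : ι} (hi : 0 < s i)
    {ξ η : ℝ} (hξ : ξ ∈ Set.Icc 0 c) (hη : η ∈ Set.Icc 0 c) :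
    rateGradient d q w (meanMoments d s x y) (moments d ξ η)
      ≤ rateGradient d q w (meanMoments d s x y) (moments d (x i) (y i)) := by
  have hfactor : 0 < ((d : ℝ) + 1) * q := mul_pos (by positivity) h.q_pos
  have hmax : IsMaxOn (rateGradient d q w (meanMoments d s x y)) (momentHull d c)
      (∑ i, s i • moments d (x i) (y i)) := fun v hv =>
    le_of_mul_le_mul_left (fderiv_apply_le_of_isMaxOn (convex_convexHull ℝ _) h.mem_momentHull
      h.isMaxOn (h.hasFDerivAt_rate hd h.mem_momentHull) hv) hfactor
  exact isMaxOn_of_isMaxOn_sum_smul h.weight_nonneg h.sum_weight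
    (fun i => moments_mem_momentHull (h.left_mem i) (h.right_mem i)) hmax hi
    (moments_mem_momentHull hξ hη)

theorem sum_left_mem (h : IsOptimalMixture d q w c s x y) : ∑ i, s i * x i ∈ Set.Icc 0 c :=
  (convex_Icc 0 c).sum_mem (fun i _ => h.weight_nonneg i) h.sum_weight fun i _ => h.left_mem i

theorem scale_pos (h : IsOptimalMixture d q w c s x y) : 0 < scale q w (∑ i, s i * x i) :=
  h.toIsMessageBox.scale_pos h.sum_left_mem.2

theorem scale_lt (h : IsOptimalMixture d q w c s x y) : scale q w (∑ i, s i * x i) < c :=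
  h.toIsMessageBox.scale_lt h.sum_left_mem.1

/-- The derivative of the linearised rate in the left message of the `i`-th atom. -/
noncomputable def leftSlope (d : ℕ) (q w : ℝ) (s x y : ι → ℝ) (i : ι) : ℝ :=
  -y i / (1 - q * ∑ j, s j * (x j * y j)) + (scale q w (∑ j, s j * x j) ^ (d : ℝ)⁻¹
    - x i ^ (d : ℝ)⁻¹) / normPow d q w (∑ j, s j * x j, ∑ j, s j * x j ^ phaseExp d)

theorem leftSlope_nonpos_and_mul_eq_zero (h : IsOptimalMixture d q w c s x y) (hd : 0 < d) {i : ι}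
    (hi : 0 < s i) : leftSlope d q w s x y i ≤ 0 ∧ x i * leftSlope d q w s x y i = 0 := by
  have hmem := h.mem_momentHull
  have hU := h.normPow_fst_pos hmem
  have hN := h.pairing_pos hmem
  have hder :=
    hasDerivAt_rateGradient_moments (q := q) (w := w) hd (meanMoments d s x y) (x i) (y i)
  rw [meanMoments_eq] at hU hN hder
  change HasDerivAt _ (leftSlope d q w s x y i) _ at hder
  have hslope : ∀ z ∈ Set.Icc 0 c, z * leftSlope d q w s x y i ≤ x i * leftSlope d q w s x y i :=
    fun z hz => deriv_mul_le_of_isMaxOn (convex_Icc 0 c) (h.left_mem i) (fun ξ hξ => by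
      simpa only [Set.mem_ofPred_eq, meanMoments_eq] using
        h.rateGradient_le hd hi hξ (h.right_mem i)) hder hz
  have hzero := hslope 0 ⟨le_rfl, h.pos.le⟩
  have hend := hslope c ⟨h.pos.le, le_rfl⟩
  rcases (h.left_mem i).2.eq_or_lt with hxc | hxc
  · have hroot : scale q w (∑ j, s j * x j) ^ (d : ℝ)⁻¹ < x i ^ (d : ℝ)⁻¹ :=
      hxc ▸ Real.rpow_lt_rpow h.scale_pos.le h.scale_lt (by positivity)
    have hneg : leftSlope d q w s x y i < 0 := add_neg_of_nonpos_of_neg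
      (div_nonpos_of_nonpos_of_nonneg (neg_nonpos.2 (h.right_mem i).1) hN.le)
      (div_neg_of_neg_of_pos (sub_neg.2 hroot) hU)
    nlinarith [h.pos]
  · have hnonpos : leftSlope d q w s x y i ≤ 0 := by nlinarith
    exact ⟨hnonpos, le_antisymm (mul_nonpos_of_nonneg_of_nonpos (h.left_mem i).1 hnonpos)
      (by simpa using hzero)⟩

theorem normPow_eq (h : IsOptimalMixture d q w c s x y) (hd : 0 < d) :
    normPow d q w (∑ i, s i * x i, ∑ i, s i * x i ^ phaseExp d)
      = (1 - q * ∑ i, s i * (x i * y i)) * scale q w (∑ i, s i * x i) ^ (d : ℝ)⁻¹ := by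
  have hU := h.normPow_fst_pos h.mem_momentHull
  have hN := h.pairing_pos h.mem_momentHull
  have hsum : ∑ i, s i * (x i * leftSlope d q w s x y i) = 0 := Finset.sum_eq_zero fun i _ => by
    rcases (h.weight_nonneg i).eq_or_lt with hi | hi
    · rw [← hi, zero_mul]
    · rw [(h.leftSlope_nonpos_and_mul_eq_zero hd hi).2, mul_zero]
  have hw := h.w_pos
  rw [meanMoments_eq] at hU hN
  simp only [leftSlope] at hsum
  have hA : w * scale q w (∑ i, s i * x i) = 1 - q * ∑ i, s i * x i := by
    rw [scale]
    field_simp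
  have hnorm : normPow d q w (∑ i, s i * x i, ∑ i, s i * x i ^ phaseExp d)
      = (1 - q * ∑ i, s i * x i) * scale q w (∑ i, s i * x i) ^ (d : ℝ)⁻¹
        + q * ∑ i, s i * x i ^ phaseExp d := by
    rw [normPow, rpow_phaseExp hd h.scale_pos.le, ← mul_assoc, hA]
  set U := normPow d q w (∑ i, s i * x i, ∑ i, s i * x i ^ phaseExp d)
  set κ := scale q w (∑ i, s i * x i) ^ (d : ℝ)⁻¹
  set Z := ∑ i, s i * (x i * y i) with hZ
  set N := 1 - q * Z with hN_def
  have hEuler : -Z / N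
      + (κ * ∑ i, s i * x i - ∑ i, s i * x i ^ phaseExp d) / U = 0 := by
    rw [← hsum, hZ, Finset.mul_sum, ← Finset.sum_sub_distrib, Finset.sum_div,
      ← Finset.sum_neg_distrib, Finset.sum_div, ← Finset.sum_add_distrib]
    refine Finset.sum_congr rfl fun i _ => ?_
    rw [rpow_phaseExp hd (h.left_mem i).1]
    ring
  field_simp at hEuler
  linear_combination (-q) * hEuler + N * hnorm - U * hN_def

theorem left_eq (h : IsOptimalMixture d q w c s x y) (hd : 0 < d) {i : ι} (hi : 0 < s i) :
    x i = scale q w (∑ j, s j * x j) * (1 - y i) ^ d := by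
  have hU := h.normPow_fst_pos h.mem_momentHull
  have hN := h.pairing_pos h.mem_momentHull
  rw [meanMoments_eq] at hU hN
  obtain ⟨hle, hmul⟩ := h.leftSlope_nonpos_and_mul_eq_zero hd hi
  have hslope : leftSlope d q w s x y i = (scale q w (∑ j, s j * x j) ^ (d : ℝ)⁻¹ * (1 - y i)
      - x i ^ (d : ℝ)⁻¹) / normPow d q w (∑ j, s j * x j, ∑ j, s j * x j ^ phaseExp d) := by
    have hκ : 0 < scale q w (∑ j, s j * x j) ^ (d : ℝ)⁻¹ := Real.rpow_pos_of_pos h.scale_pos _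
    rw [leftSlope, h.normPow_eq hd]
    generalize scale q w (∑ j, s j * x j) ^ (d : ℝ)⁻¹ = κ at hκ ⊢
    change 0 < 1 - q * ∑ j, s j * (x j * y j) at hN
    generalize 1 - q * ∑ j, s j * (x j * y j) = N at hN ⊢
    field_simp
    ring
  have hy : y i < 1 := (h.right_mem i).2.trans_lt h.lt_one
  have hx : x i ≠ 0 := fun h0 => by
    rw [hslope, h0, Real.zero_rpow (by positivity), sub_zero] at hle
    exact hle.not_gt (div_pos (mul_pos (Real.rpow_pos_of_pos h.scale_pos _) (by linarith)) hU)
  rw [hslope] at hmul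
  have hroot : x i ^ (d : ℝ)⁻¹ = scale q w (∑ j, s j * x j) ^ (d : ℝ)⁻¹ * (1 - y i) :=
    (sub_eq_zero.1 <| (div_eq_zero_iff.1 <| (mul_eq_zero.1 hmul).resolve_left hx).resolve_right
      hU.ne').symm
  rw [← Real.rpow_inv_natCast_pow (h.left_mem i).1 hd.ne', hroot, mul_pow,
    Real.rpow_inv_natCast_pow h.scale_pos.le hd.ne']

theorem score_le (h : IsOptimalMixture d q w c s x y) (hd : 0 < d) {i : ι} (hi : 0 < s i)
    {ξ η : ℝ} (hξ : ξ ∈ Set.Icc 0 c) (hη : η ∈ Set.Icc 0 c) :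
    score d (scale q w (∑ j, s j * x j)) (scale q w (∑ j, s j * y j)) ξ η
      ≤ score d (scale q w (∑ j, s j * x j)) (scale q w (∑ j, s j * y j)) (x i) (y i) := by
  have hN := h.pairing_pos h.mem_momentHull
  have hgradient := h.rateGradient_le hd hi hξ hη
  have hκ : 0 < scale q w (∑ j, s j * x j) ^ (d : ℝ)⁻¹ := Real.rpow_pos_of_pos h.scale_pos _
  have hκ' : 0 < scale q w (∑ j, s j * y j) ^ (d : ℝ)⁻¹ := Real.rpow_pos_of_pos h.symm.scale_pos _
  have hsymm := h.symm.normPow_eq hd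
  simp only [mul_comm (y _) (x _)] at hsymm
  have hscore : ∀ ξ η, rateGradient d q w (meanMoments d s x y) (moments d ξ η)
      = score d (scale q w (∑ j, s j * x j)) (scale q w (∑ j, s j * y j)) ξ η
        / (1 - q * ∑ j, s j * (x j * y j)) := fun ξ η => by
    rw [rateGradient_moments, meanMoments_eq, h.normPow_eq hd, hsymm, score]
    rw [meanMoments_eq] at hN
    change 0 < 1 - q * ∑ j, s j * (x j * y j) at hN
    generalize 1 - q * ∑ j, s j * (x j * y j) = N at hN ⊢
    generalize scale q w (∑ j, s j * x j) ^ (d : ℝ)⁻¹ = κ at hκ ⊢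
    generalize scale q w (∑ j, s j * y j) ^ (d : ℝ)⁻¹ = κ' at hκ' ⊢
    field_simp
    ring
  rw [hscore, hscore] at hgradient
  rw [meanMoments_eq] at hN
  exact (div_le_div_iff_of_pos_right hN).1 hgradient

end IsOptimalMixture

end OptimalMixtures

section TwoCycles

variable {d : ℕ} {A x : ℝ}

theorem one_sub_mul_pow_pos (hd : d ≠ 0) (hA1 : A ≤ 1) (hx : x ∈ Set.Ioo 0 1) :
    0 < 1 - A * (1 - x) ^ d := by
  have hpow : (1 - x) ^ d < 1 := pow_lt_one₀ (by linarith [hx.2]) (by linarith [hx.1]) hd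
  nlinarith [pow_nonneg (sub_nonneg.2 hx.2.le) d]

/-- The logarithm of the ratio of the two sides of the two-step fixpoint equation
`x = A (1 - A (1 - x) ^ d) ^ d`. -/
noncomputable def twoStepLogRatio (d : ℕ) (A x : ℝ) : ℝ :=
  Real.log x - Real.log A - d * Real.log (1 - A * (1 - x) ^ d)

theorem hasDerivAt_twoStepLogRatio (hd : d ≠ 0) (hA1 : A ≤ 1) (hx : x ∈ Set.Ioo 0 1) :
    HasDerivAt (twoStepLogRatio d A)
      (x⁻¹ - d * (A * (d * (1 - x) ^ (d - 1)) / (1 - A * (1 - x) ^ d))) x := by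
  have hinner : HasDerivAt (fun x => 1 - A * (1 - x) ^ d) (A * (d * (1 - x) ^ (d - 1))) x :=
    (((((hasDerivAt_id x).const_sub 1).pow d).const_mul A).const_sub 1).congr_deriv (by simp)
  exact ((Real.hasDerivAt_log hx.1.ne').sub_const (Real.log A)).fun_sub
    ((hinner.log (one_sub_mul_pow_pos hd hA1 hx).ne').const_mul (d : ℝ))

theorem twoStepLogRatio_eq_zero (hd : d ≠ 0) (hA : 0 < A) (hA1 : A ≤ 1) (hx : x ∈ Set.Ioo 0 1)
    (hfix : x = A * (1 - A * (1 - x) ^ d) ^ d) : twoStepLogRatio d A x = 0 := by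
  have hpos := one_sub_mul_pow_pos hd hA1 hx
  have hlog := congrArg Real.log hfix
  rw [Real.log_mul hA.ne' (by positivity), Real.log_pow] at hlog
  rw [twoStepLogRatio]
  linarith

/-- The logarithm of `(1 - x) ^ (d - 1) (1 + (d² - 1) x)`, which is constant on the critical points
of `twoStepLogRatio`. -/
noncomputable def criticalLog (d : ℕ) (x : ℝ) : ℝ :=
  ((d : ℝ) - 1) * Real.log (1 - x) + Real.log (1 + ((d : ℝ) ^ 2 - 1) * x)

theorem criticalLog_eq (hd : 2 ≤ d) (hA : 0 < A) (hA1 : A ≤ 1) (hx : x ∈ Set.Ioo 0 1)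
    (hcrit : x⁻¹ - d * (A * (d * (1 - x) ^ (d - 1)) / (1 - A * (1 - x) ^ d)) = 0) :
    criticalLog d x = -Real.log A := by
  have : (2 : ℝ) ≤ d := by exact_mod_cast hd
  have hinner := one_sub_mul_pow_pos (show d ≠ 0 by omega) hA1 hx
  have hx0 := hx.1
  have hx1 : 0 < 1 - x := sub_pos.2 hx.2
  have hproduct : A * ((1 - x) ^ (d - 1) * (1 + ((d : ℝ) ^ 2 - 1) * x)) = 1 := by
    have hpow : (1 - x) ^ d = (1 - x) ^ (d - 1) * (1 - x) := (pow_sub_one_mul (by omega) _).symm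
    field_simp at hcrit
    rw [hpow] at hcrit
    linear_combination -hcrit
  have hfactor : 0 < 1 + ((d : ℝ) ^ 2 - 1) * x := by nlinarith
  have hlog := congrArg Real.log hproduct
  rw [Real.log_mul hA.ne' (by positivity), Real.log_mul (by positivity) hfactor.ne', Real.log_pow,
    Real.log_one, Nat.cast_sub (by omega), Nat.cast_one] at hlog
  rw [criticalLog]
  linarith

theorem strictConcaveOn_criticalLog (hd : 2 ≤ d) :
    StrictConcaveOn ℝ (Set.Ioo 0 1) (criticalLog d) := by
  have hd' : (2 : ℝ) ≤ d := by exact_mod_cast hd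
  have hfactor : ∀ x ∈ Set.Ioo (0 : ℝ) 1, 0 < 1 + ((d : ℝ) ^ 2 - 1) * x := fun x hx => by
    nlinarith [mul_pos (show (0 : ℝ) < (d : ℝ) ^ 2 - 1 by nlinarith) hx.1]
  refine ⟨convex_Ioo _ _, fun x hx y hy hxy a b ha hb hab => ?_⟩
  have hfirst := strictConcaveOn_log_Ioi.2 (sub_pos.2 hx.2) (sub_pos.2 hy.2)
    (fun h => hxy (sub_right_injective h)) ha hb hab
  have hsecond := strictConcaveOn_log_Ioi.concaveOn.2 (hfactor x hx) (hfactor y hy) ha.le hb.le hab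
  simp only [smul_eq_mul, criticalLog] at hfirst hsecond ⊢
  rw [show 1 - (a * x + b * y) = a * (1 - x) + b * (1 - y) by linear_combination -hab,
    show 1 + ((d : ℝ) ^ 2 - 1) * (a * x + b * y)
      = a * (1 + ((d : ℝ) ^ 2 - 1) * x) + b * (1 + ((d : ℝ) ^ 2 - 1) * y) by
      linear_combination -hab]
  nlinarith

theorem exists_criticalLog_eq (hd : 2 ≤ d) (hA : 0 < A) (hA1 : A ≤ 1) {a b : ℝ} (ha : 0 < a)
    (hab : a < b) (hb : b < 1) (hfixa : a = A * (1 - A * (1 - a) ^ d) ^ d)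
    (hfixb : b = A * (1 - A * (1 - b) ^ d) ^ d) :
    ∃ z ∈ Set.Ioo a b, criticalLog d z = -Real.log A := by
  have hder : ∀ x ∈ Set.Icc a b, _ := fun x hx =>
    hasDerivAt_twoStepLogRatio (show d ≠ 0 by omega) hA1 ⟨ha.trans_le hx.1, hx.2.trans_lt hb⟩
  obtain ⟨z, hz, hcrit⟩ := exists_hasDerivAt_eq_zero hab
    (fun x hx => (hder x hx).continuousAt.continuousWithinAt)
    ((twoStepLogRatio_eq_zero (by omega) hA hA1 ⟨ha, hab.trans hb⟩ hfixa).trans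
      (twoStepLogRatio_eq_zero (by omega) hA hA1 ⟨ha.trans hab, hb⟩ hfixb).symm)
    fun x hx => hder x ⟨hx.1.le, hx.2.le⟩
  exact ⟨z, hz, criticalLog_eq hd hA hA1 ⟨ha.trans hz.1, hz.2.trans hb⟩ hcrit⟩

theorem not_four_fixedPoints (hd : 2 ≤ d) (hA : 0 < A) (hA1 : A ≤ 1) {a₁ a₂ a₃ a₄ : ℝ}
    (h0 : 0 < a₁) (h12 : a₁ < a₂) (h23 : a₂ < a₃) (h34 : a₃ < a₄) (h1 : a₄ < 1)
    (hfix₁ : a₁ = A * (1 - A * (1 - a₁) ^ d) ^ d) (hfix₂ : a₂ = A * (1 - A * (1 - a₂) ^ d) ^ d)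
    (hfix₃ : a₃ = A * (1 - A * (1 - a₃) ^ d) ^ d) (hfix₄ : a₄ = A * (1 - A * (1 - a₄) ^ d) ^ d) :
    False := by
  obtain ⟨z₁, ⟨_, _⟩, hz₁⟩ :=
    exists_criticalLog_eq hd hA hA1 h0 h12 (by linarith) hfix₁ hfix₂
  obtain ⟨z₂, ⟨_, _⟩, hz₂⟩ :=
    exists_criticalLog_eq hd hA hA1 (by linarith) h23 (by linarith) hfix₂ hfix₃
  obtain ⟨z₃, ⟨_, _⟩, hz₃⟩ :=
    exists_criticalLog_eq hd hA hA1 (by linarith) h34 h1 hfix₃ hfix₄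
  have hlt := (strictConcaveOn_criticalLog hd).lt_on_openSegment (x := z₁) (y := z₃) (z := z₂)
    ⟨by linarith, by linarith⟩ ⟨by linarith, by linarith⟩ (by linarith)
    (by rw [openSegment_eq_Ioo (by linarith)]; exact ⟨by linarith, by linarith⟩)
  rw [hz₁, hz₂, hz₃, min_self] at hlt
  exact lt_irrefl _ hlt

/-- The numbers `b < a` in `(0, 1)` are exchanged by `x ↦ A (1 - x) ^ d`. -/
structure IsTwoCycle (d : ℕ) (A a b : ℝ) : Prop where
  pos : 0 < b
  lt : b < a
  lt_one : a < 1
  left_eq : a = A * (1 - b) ^ d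
  right_eq : b = A * (1 - a) ^ d

theorem IsTwoCycle.left_le_left (hd : 2 ≤ d) (hA : 0 < A) (hA1 : A ≤ 1) {a₁ b₁ a₂ b₂ : ℝ}
    (h₁ : IsTwoCycle d A a₁ b₁) (h₂ : IsTwoCycle d A a₂ b₂) : a₂ ≤ a₁ := by
  by_contra! hlt
  have hlt' : b₂ < b₁ := by
    rw [h₁.right_eq, h₂.right_eq]
    have hpow : (1 - a₂) ^ d < (1 - a₁) ^ d :=
      pow_lt_pow_left₀ (by linarith) (by linarith [h₂.lt_one]) (by omega)
    gcongr
  refine not_four_fixedPoints hd hA hA1 h₂.pos hlt' h₁.lt hlt h₂.lt_one ?_ ?_ ?_ ?_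
  · rw [← h₂.left_eq, ← h₂.right_eq]
  · rw [← h₁.left_eq, ← h₁.right_eq]
  · rw [← h₁.right_eq, ← h₁.left_eq]
  · rw [← h₂.right_eq, ← h₂.left_eq]

theorem IsTwoCycle.unique (hd : 2 ≤ d) (hA : 0 < A) (hA1 : A ≤ 1) {a₁ b₁ a₂ b₂ : ℝ}
    (h₁ : IsTwoCycle d A a₁ b₁) (h₂ : IsTwoCycle d A a₂ b₂) : a₁ = a₂ ∧ b₁ = b₂ := by
  have ha : a₁ = a₂ := (h₂.left_le_left hd hA hA1 h₁).antisymm (h₁.left_le_left hd hA hA1 h₂)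
  exact ⟨ha, by rw [h₁.right_eq, h₂.right_eq, ha]⟩

end TwoCycles

section Diagonal

variable {d : ℕ} {A x : ℝ}

theorem eventually_lt_of_hasDerivAt_pos {f f' : ℝ → ℝ} {a m : ℝ} (hf : ∀ x, HasDerivAt f (f' x) x)
    (ha : f' a = 0) (hf' : HasDerivAt f' m a) (hm : 0 < m) : ∀ᶠ x in 𝓝[>] a, f a < f x := by
  have hpos : ∀ᶠ x in 𝓝[>] a, 0 < f' x := by
    have hslope := (hasDerivAt_iff_tendsto_slope.1 hf').mono_left
      (nhdsWithin_mono a fun x (hx : a < x) => hx.ne')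
    filter_upwards [hslope.eventually (lt_mem_nhds hm), self_mem_nhdsWithin] with x hx hax
    rw [slope_def_field, ha, sub_zero] at hx
    exact (div_pos_iff_of_pos_right (sub_pos.2 hax)).1 hx
  obtain ⟨b, hab, hb⟩ := mem_nhdsGT_iff_exists_Ioo_subset.1 hpos
  filter_upwards [Ioo_mem_nhdsGT hab] with x hx
  refine strictMonoOn_of_deriv_pos (convex_Icc a x)
    (fun z _ => (hf z).continuousAt.continuousWithinAt) (fun z hz => ?_)
    (Set.left_mem_Icc.2 hx.1.le) (Set.right_mem_Icc.2 hx.1.le) hx.1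
  rw [interior_Icc] at hz
  rw [(hf z).deriv]
  exact hb ⟨hz.1, hz.2.trans hx.2⟩

theorem one_sub_lt_natCast_mul (hd : 0 < d) (hdA : 5 ≤ d * A) (hx1 : x ≤ 1)
    (hfix : x = A * (1 - x) ^ d) : 1 - x < d * x := by
  by_contra! hle
  have hd' : (0 : ℝ) < d := by exact_mod_cast hd
  have hsub : 0 ≤ 1 - x := sub_nonneg.2 hx1
  have hbase : 1 ≤ (1 - x) * (1 + (d : ℝ)⁻¹) := by
    rw [← mul_le_mul_iff_of_pos_left hd']
    field_simp
    linarith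
  have hlower : 1 ≤ (1 - x) ^ d * Real.exp 1 := by
    calc 1 ≤ ((1 - x) * (1 + (d : ℝ)⁻¹)) ^ d := one_le_pow₀ hbase
      _ = (1 - x) ^ d * (1 + (d : ℝ)⁻¹) ^ d := mul_pow _ _ _
      _ ≤ (1 - x) ^ d * Real.exp 1 := by gcongr; exact Real.one_add_inv_pow_le_exp
  have hupper : 5 * (1 - x) ^ d ≤ 1 := by
    calc 5 * (1 - x) ^ d ≤ d * A * (1 - x) ^ d := by gcongr
      _ = d * x := by rw [mul_assoc, ← hfix]
      _ ≤ 1 := by nlinarith [mul_nonneg hd'.le hsub]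
  nlinarith [Real.exp_one_lt_d9, pow_nonneg hsub d]

theorem score_add_sub (d : ℕ) (A x ε : ℝ) : score d A A (x + ε) (x - ε) = 2 * x - x ^ 2 + ε ^ 2
    - ((x + ε) ^ phaseExp d + (x - ε) ^ phaseExp d) / phaseExp d / A ^ (d : ℝ)⁻¹ := by
  rw [score]
  ring

theorem eventually_score_lt (hd : 0 < d) (hA : 0 < A) (hdA : 5 ≤ d * A) (hx : 0 < x) (hx1 : x ≤ 1)
    (hfix : x = A * (1 - x) ^ d) :
    ∀ᶠ ε in 𝓝[>] 0, score d A A x x < score d A A (x + ε) (x - ε) := by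
  have : (0 : ℝ) < d := by exact_mod_cast hd
  have hp := one_le_phaseExp hd
  have hp0 : phaseExp d ≠ 0 := (zero_lt_one.trans_le hp).ne'
  have : 0 < A ^ (d : ℝ)⁻¹ := Real.rpow_pos_of_pos hA _
  have hroot : x ^ (d : ℝ)⁻¹ = A ^ (d : ℝ)⁻¹ * (1 - x) := by
    conv_lhs => rw [hfix]
    rw [Real.mul_rpow hA.le (by positivity), Real.pow_rpow_inv_natCast (by linarith) hd.ne']
  have hfirst : ∀ ε, HasDerivAt (fun ε => score d A A (x + ε) (x - ε))
      (2 * ε - ((x + ε) ^ (d : ℝ)⁻¹ - (x - ε) ^ (d : ℝ)⁻¹) / A ^ (d : ℝ)⁻¹) ε := fun ε => by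
    have hadd := ((hasDerivAt_id ε).const_add x).rpow_const (p := phaseExp d) (Or.inr hp)
    have hsub := ((hasDerivAt_id ε).const_sub x).rpow_const (p := phaseExp d) (Or.inr hp)
    simp only [score_add_sub]
    refine (((hasDerivAt_pow 2 ε).const_add _).fun_sub
      (((hadd.fun_add hsub).div_const _).div_const _)).congr_deriv ?_
    rw [show phaseExp d - 1 = (d : ℝ)⁻¹ by rw [phaseExp_eq hd]; ring]
    simp only [id]
    generalize phaseExp d = p at hp0
    field_simp
    ring
  have hsecond : HasDerivAt
      (fun ε => 2 * ε - ((x + ε) ^ (d : ℝ)⁻¹ - (x - ε) ^ (d : ℝ)⁻¹) / A ^ (d : ℝ)⁻¹)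
      (2 - 2 * ((1 - x) / (d * x))) 0 := by
    have hadd := ((hasDerivAt_id (0 : ℝ)).const_add x).rpow_const (p := (d : ℝ)⁻¹)
      (Or.inl (by simpa using hx.ne'))
    have hsub := ((hasDerivAt_id (0 : ℝ)).const_sub x).rpow_const (p := (d : ℝ)⁻¹)
      (Or.inl (by simpa using hx.ne'))
    refine (((hasDerivAt_id (0 : ℝ)).const_mul 2).fun_sub
      ((hadd.fun_sub hsub).div_const _)).congr_deriv ?_
    simp only [id, add_zero, sub_zero]
    rw [Real.rpow_sub_one hx.ne', hroot]
    field_simp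
    ring
  have hsteep : (1 - x) / (d * x) < 1 :=
    (div_lt_one (by positivity)).2 (one_sub_lt_natCast_mul hd hdA hx1 hfix)
  simpa using eventually_lt_of_hasDerivAt_pos hfirst (by simp) hsecond (by linarith)

end Diagonal

section Structure

variable {d : ℕ} {q w c : ℝ} {ι : Type*} [Fintype ι] {s x y : ι → ℝ}

theorem not_lt_of_forall_le {A A' : ℝ} (hq : 0 ≤ q) (hw : 0 < w) (hA : 0 ≤ A)
    (hs : ∀ i, 0 ≤ s i) (hx : ∀ i, x i ≤ 1) (hy : ∀ i, y i ≤ 1)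
    (h : A * (w + q * ∑ i, s i * (1 - y i) ^ d) = 1)
    (h' : A' * (w + q * ∑ i, s i * (1 - x i) ^ d) = 1)
    (hxy : ∀ i, 0 < s i → x i ≤ y i) : ¬ A < A' := by
  intro hlt
  have hmono : ∑ i, s i * (1 - y i) ^ d ≤ ∑ i, s i * (1 - x i) ^ d := by
    refine Finset.sum_le_sum fun i _ => ?_
    rcases (hs i).eq_or_lt with hi | hi
    · rw [← hi, zero_mul, zero_mul]
    · have := hxy i hi
      have := hy i
      gcongr
  have hpos : 0 ≤ ∑ i, s i * (1 - x i) ^ d := Finset.sum_nonneg fun i _ =>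
    mul_nonneg (hs i) (pow_nonneg (sub_nonneg.2 (hx i)) d)
  refine lt_irrefl (1 : ℝ) ?_
  calc 1 = A * (w + q * ∑ i, s i * (1 - y i) ^ d) := h.symm
    _ ≤ A * (w + q * ∑ i, s i * (1 - x i) ^ d) := by gcongr
    _ < A' * (w + q * ∑ i, s i * (1 - x i) ^ d) := by gcongr
    _ = 1 := h'

theorem sum_smul_of_two_valued {E : Type*} [AddCommGroup E] [Module ℝ E] (hs : ∀ i, 0 ≤ s i)
    (hs1 : ∑ i, s i = 1) {a b : ℝ} (hab : a ≠ b)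
    (hval : ∀ i, 0 < s i → (x i = a ∧ y i = b) ∨ (x i = b ∧ y i = a)) (F : ℝ → ℝ → E) :
    ∑ i, s i • F (x i) (y i) = (∑ i, if x i = a then s i else 0) • F a b
      + (1 - ∑ i, if x i = a then s i else 0) • F b a := by
  have hcompl : (1 - ∑ i, if x i = a then s i else 0) = ∑ i, if x i = a then 0 else s i := by
    rw [← hs1, ← Finset.sum_sub_distrib]
    exact Finset.sum_congr rfl fun i _ => by split_ifs <;> simp
  rw [hcompl, Finset.sum_smul, Finset.sum_smul, ← Finset.sum_add_distrib]
  refine Finset.sum_congr rfl fun i _ => ?_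
  rcases (hs i).eq_or_lt with hi | hi
  · simp [← hi]
  · rcases hval i hi with ⟨hx, hy⟩ | ⟨hx, hy⟩
    · simp [hx, hy]
    · simp [hx, hy, hab.symm]

theorem score_swap_sub {A A' : ℝ} (ξ η : ℝ) : score d A A' η ξ - score d A A' ξ η
    = (ξ ^ phaseExp d - η ^ phaseExp d) * ((A ^ (d : ℝ)⁻¹)⁻¹ - (A' ^ (d : ℝ)⁻¹)⁻¹)
      / phaseExp d := by
  rw [score, score]
  ring

theorem le_of_score_swap_le (hd : 0 < d) {A A' ξ η : ℝ} (hA : 0 < A) (hAA' : A < A')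
    (hη : 0 ≤ η) (hswap : score d A A' η ξ ≤ score d A A' ξ η) : ξ ≤ η := by
  have hp := zero_lt_one.trans_le (one_le_phaseExp hd)
  have hroot : (A' ^ (d : ℝ)⁻¹)⁻¹ < (A ^ (d : ℝ)⁻¹)⁻¹ :=
    inv_strictAnti₀ (Real.rpow_pos_of_pos hA _) (Real.rpow_lt_rpow hA.le hAA' (by positivity))
  by_contra! hlt
  refine (sub_nonpos.2 hswap).not_gt ?_
  rw [score_swap_sub]
  exact div_pos (mul_pos (sub_pos.2 (Real.rpow_lt_rpow hη hlt hp)) (sub_pos.2 hroot)) hp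

namespace IsOptimalMixture

theorem scale_mul_eq_one (h : IsOptimalMixture d q w c s x y) (hd : 0 < d) :
    scale q w (∑ i, s i * x i) * (w + q * ∑ i, s i * (1 - y i) ^ d) = 1 := by
  have hmean : scale q w (∑ i, s i * x i) * ∑ i, s i * (1 - y i) ^ d = ∑ i, s i * x i := by
    rw [Finset.mul_sum]
    refine Finset.sum_congr rfl fun i _ => ?_
    rcases (h.weight_nonneg i).eq_or_lt with hi | hi
    · rw [← hi, zero_mul, zero_mul, mul_zero]
    · rw [mul_left_comm, ← h.left_eq hd hi]
  have hw : scale q w (∑ i, s i * x i) * w = 1 - q * ∑ i, s i * x i :=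
    div_mul_cancel₀ _ h.w_pos.ne'
  linear_combination hw + q * hmean

theorem left_le_one (h : IsOptimalMixture d q w c s x y) (i : ι) : x i ≤ 1 :=
  (h.left_mem i).2.trans h.lt_one.le

theorem not_scale_lt_scale (h : IsOptimalMixture d q w c s x y) (hd : 0 < d) :
    ¬ scale q w (∑ i, s i * x i) < scale q w (∑ i, s i * y i) := fun hlt =>
  not_lt_of_forall_le h.q_pos.le h.w_pos h.scale_pos.le h.weight_nonneg h.left_le_one
    h.symm.left_le_one (h.scale_mul_eq_one hd) (h.symm.scale_mul_eq_one hd)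
    (fun i hi => le_of_score_swap_le hd h.scale_pos hlt (h.right_mem i).1
      (h.score_le hd hi (h.right_mem i) (h.left_mem i))) hlt

theorem scale_eq_scale (h : IsOptimalMixture d q w c s x y) (hd : 0 < d) :
    scale q w (∑ i, s i * y i) = scale q w (∑ i, s i * x i) :=
  le_antisymm (not_lt.1 (h.not_scale_lt_scale hd)) (not_lt.1 (h.symm.not_scale_lt_scale hd))

theorem right_eq (h : IsOptimalMixture d q w c s x y) (hd : 0 < d) {i : ι} (hi : 0 < s i) :
    y i = scale q w (∑ j, s j * x j) * (1 - x i) ^ d := by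
  rw [← h.scale_eq_scale hd]
  exact h.symm.left_eq hd hi

theorem left_pos (h : IsOptimalMixture d q w c s x y) (hd : 0 < d) {i : ι} (hi : 0 < s i) :
    0 < x i := by
  rw [h.left_eq hd hi]
  exact mul_pos h.scale_pos (pow_pos (sub_pos.2 ((h.right_mem i).2.trans_lt h.lt_one)) d)

theorem left_lt (h : IsOptimalMixture d q w c s x y) (hd : 0 < d) {i : ι} (hi : 0 < s i) :
    x i < c := by
  rw [h.left_eq hd hi]
  refine (mul_le_of_le_one_right h.scale_pos.le ?_).trans_lt h.scale_lt
  exact pow_le_one₀ (sub_nonneg.2 (h.symm.left_le_one i)) (sub_le_self 1 (h.right_mem i).1)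

theorem five_le_mul_scale (h : IsOptimalMixture d q w c s x y) (hd : 0 < d)
    (hdw : 5 * (w + q) ≤ d) : 5 ≤ d * scale q w (∑ i, s i * x i) := by
  have hmean : ∑ i, s i * (1 - y i) ^ d ≤ 1 := by
    refine (Finset.sum_le_sum fun i _ => ?_).trans_eq h.sum_weight
    exact mul_le_of_le_one_right (h.weight_nonneg i)
      (pow_le_one₀ (sub_nonneg.2 (h.symm.left_le_one i)) (sub_le_self 1 (h.right_mem i).1))
  have hscale := h.scale_pos
  have hq := h.q_pos
  calc (5 : ℝ) = 5 * (w + q * ∑ i, s i * (1 - y i) ^ d) * scale q w (∑ i, s i * x i) := by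
        rw [mul_assoc, mul_comm _ (scale _ _ _), h.scale_mul_eq_one hd, mul_one]
    _ ≤ 5 * (w + q * 1) * scale q w (∑ i, s i * x i) := by gcongr
    _ ≤ d * scale q w (∑ i, s i * x i) := by rw [mul_one]; gcongr

theorem left_ne_right (h : IsOptimalMixture d q w c s x y) (hd : 0 < d) (hdw : 5 * (w + q) ≤ d)
    {i : ι} (hi : 0 < s i) : x i ≠ y i := by
  intro hxy
  have hfix := h.left_eq hd hi
  rw [← hxy] at hfix
  have hx := h.left_pos hd hi
  have hxc := h.left_lt hd hi
  have hspread := eventually_score_lt hd h.scale_pos (h.five_le_mul_scale hd hdw) hx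
    (h.left_le_one i) hfix
  obtain ⟨ε, hlt, hε0, hε⟩ := (hspread.and (Ioo_mem_nhdsGT (lt_min hx (sub_pos.2 hxc)))).exists
  have hεx := hε.trans_le (min_le_left _ _)
  have hεc := hε.trans_le (min_le_right _ _)
  have hle := h.score_le hd hi (ξ := x i + ε) (η := x i - ε) ⟨by linarith, by linarith⟩
    ⟨by linarith, by linarith⟩
  rw [← hxy, h.scale_eq_scale hd] at hle
  exact hle.not_gt hlt

theorem isTwoCycle (h : IsOptimalMixture d q w c s x y) (hd : 0 < d) {i : ι} (hi : 0 < s i)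
    (hlt : y i < x i) : IsTwoCycle d (scale q w (∑ j, s j * x j)) (x i) (y i) where
  pos := h.symm.left_pos hd hi
  lt := hlt
  lt_one := (h.left_mem i).2.trans_lt h.lt_one
  left_eq := h.left_eq hd hi
  right_eq := h.right_eq hd hi

theorem exists_isTwoCycle (h : IsOptimalMixture d q w c s x y) (hd : 2 ≤ d)
    (hdw : 5 * (w + q) ≤ d) : ∃ a b, IsTwoCycle d (scale q w (∑ i, s i * x i)) a b ∧
      ∀ i, 0 < s i → (x i = a ∧ y i = b) ∨ (x i = b ∧ y i = a) := by
  have hd0 : 0 < d := by omega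
  have hatom : ∀ i, 0 < s i → ∃ a b, IsTwoCycle d (scale q w (∑ i, s i * x i)) a b ∧
      ((x i = a ∧ y i = b) ∨ (x i = b ∧ y i = a)) := fun i hi => by
    rcases (h.left_ne_right hd0 hdw hi).lt_or_gt with hlt | hlt
    · have hcycle := h.symm.isTwoCycle hd0 hi hlt
      rw [h.scale_eq_scale hd0] at hcycle
      exact ⟨_, _, hcycle, Or.inr ⟨rfl, rfl⟩⟩
    · exact ⟨_, _, h.isTwoCycle hd0 hi hlt, Or.inl ⟨rfl, rfl⟩⟩
  obtain ⟨i₀, -, hi₀⟩ := Finset.exists_lt_of_sum_lt (s := Finset.univ) (f := fun _ => (0 : ℝ))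
    (g := s) (by rw [h.sum_weight]; simp)
  obtain ⟨a, b, hab, -⟩ := hatom i₀ hi₀
  refine ⟨a, b, hab, fun i hi => ?_⟩
  obtain ⟨a', b', hab', hval⟩ := hatom i hi
  obtain ⟨rfl, rfl⟩ := hab.unique hd h.scale_pos (h.scale_lt.trans h.lt_one).le hab'
  exact hval

theorem sum_weight_eq_half (h : IsOptimalMixture d q w c s x y) (hd : 0 < d) {A a b : ℝ}
    (hab : IsTwoCycle d A a b)
    (hval : ∀ i, 0 < s i → (x i = a ∧ y i = b) ∨ (x i = b ∧ y i = a)) :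
    (∑ i, if x i = a then s i else 0) = 1 / 2 := by
  have hsums : ∑ i, s i * (1 - x i) ^ d = ∑ i, s i * (1 - y i) ^ d := by
    have heq := (h.symm.scale_mul_eq_one hd).trans (h.scale_mul_eq_one hd).symm
    rw [h.scale_eq_scale hd] at heq
    exact mul_left_cancel₀ h.q_pos.ne' (add_left_cancel (mul_left_cancel₀ h.scale_pos.ne' heq))
  have hleft := sum_smul_of_two_valued h.weight_nonneg h.sum_weight hab.lt.ne' hval
    fun x _ => (1 - x) ^ d
  have hright := sum_smul_of_two_valued h.weight_nonneg h.sum_weight hab.lt.ne' hval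
    fun _ y => (1 - y) ^ d
  simp only [smul_eq_mul] at hleft hright
  have hpow : (1 - a) ^ d < (1 - b) ^ d :=
    pow_lt_pow_left₀ (by linarith [hab.lt]) (by linarith [hab.lt_one]) hd.ne'
  generalize (∑ i, if x i = a then s i else 0) = S at hleft hright ⊢
  have hzero : (2 * S - 1) * ((1 - b) ^ d - (1 - a) ^ d) = 0 := by
    linear_combination hleft - hright - hsums
  linarith [(mul_eq_zero.1 hzero).resolve_right (sub_pos.2 hpow).ne']

theorem exists_balanced (h : IsOptimalMixture d q w c s x y) (hd : 2 ≤ d)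
    (hdw : 5 * (w + q) ≤ d) : ∃ A a b, IsTwoCycle d A a b ∧ 0 < A ∧ A * w + q / 2 * (a + b) = 1 ∧
      (∀ i, 0 < s i → (x i = a ∧ y i = b) ∨ (x i = b ∧ y i = a)) ∧
      (∑ i, if x i = a then s i else 0) = 1 / 2 ∧
      meanMoments d s x y = (1 / 2 : ℝ) • moments d a b + (1 / 2 : ℝ) • moments d b a := by
  obtain ⟨a, b, hab, hval⟩ := h.exists_isTwoCycle hd hdw
  have hhalf := h.sum_weight_eq_half (by omega) hab hval
  have htwo := fun {E : Type} [AddCommGroup E] [Module ℝ E] (F : ℝ → ℝ → E) =>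
    sum_smul_of_two_valued h.weight_nonneg h.sum_weight hab.lt.ne' hval F
  simp only [hhalf, sub_half] at htwo
  refine ⟨_, a, b, hab, h.scale_pos, ?_, hval, hhalf, htwo (moments d)⟩
  have hmean : ∑ i, s i * x i = (a + b) / 2 := by
    rw [← Finset.sum_congr rfl fun i _ => smul_eq_mul (s i) (x i), htwo fun x _ => x]
    simp only [smul_eq_mul]
    ring
  rw [scale, div_mul_cancel₀ _ h.w_pos.ne', hmean]
  ring

end IsOptimalMixture

end Structure

section Messages

/-- The total weight `t R₀ + ∑ Rᵢ` of a message vector. -/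
noncomputable def totalWeight (q k d : ℕ) (R : Fin (q + 1) → ℝ) : ℝ :=
  tParam q k d * R 0 + ∑ i : Fin q, R i.succ

/-- The pairing `Rᵀ B C`. -/
noncomputable def pairing (q k d : ℕ) (R C : Fin (q + 1) → ℝ) : ℝ :=
  ∑ i, R i * ∑ j, interaction q k d i j * C j

/-- The growth rate `Δ log (Rᵀ B C) - d log ∑ Rᵢ ^ p - d log ∑ Cⱼ ^ p` in terms of messages. -/
noncomputable def messageRate (q k d : ℕ) (R C : Fin (q + 1) → ℝ) : ℝ :=
  ((d : ℝ) + 1) * Real.log (pairing q k d R C) - d * Real.log (∑ i, R i ^ phaseExp d)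
    - d * Real.log (∑ j, C j ^ phaseExp d)

/-- One half of the tree recursion: up to a factor, `R` is the image of the messages `C`. -/
def IsMessageUpdate (q k d : ℕ) (R C : Fin (q + 1) → ℝ) : Prop :=
  ∃ A : ℝ, R 0 = A * (tParam q k d ^ d * totalWeight q k d C ^ d) ∧
    ∀ i : Fin q, R i.succ = A * (totalWeight q k d C - C i.succ) ^ d

/-- The messages of the colours `1, …, q`, scaled to total weight `1`. -/
noncomputable def normalized (q k d : ℕ) (R : Fin (q + 1) → ℝ) (i : Fin q) : ℝ :=
  R i.succ / totalWeight q k d R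

/-- The averages of `moments` over the colours `1, …, q`. -/
noncomputable def colourMoments (q k d : ℕ) (R C : Fin (q + 1) → ℝ) :
    ((ℝ × ℝ) × (ℝ × ℝ)) × ℝ :=
  meanMoments d (fun _ => (q : ℝ)⁻¹) (normalized q k d R) (normalized q k d C)

variable {q k d : ℕ} {R C : Fin (q + 1) → ℝ}

theorem tParam_pos (hw : (q : ℝ) < (q : ℝ) ^ k) : 0 < tParam q k d :=
  Real.rpow_pos_of_pos (sub_pos.2 hw) _

theorem tParam_pow (hw : (q : ℝ) < (q : ℝ) ^ k) : tParam q k d ^ (d + 1) = (q : ℝ) ^ k - q := by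
  have hexp : (1 : ℝ) / ((d : ℝ) + 1) = ((d + 1 : ℕ) : ℝ)⁻¹ := by push_cast; rw [one_div]
  rw [tParam, hexp, Real.rpow_inv_natCast_pow (sub_pos.2 hw).le (Nat.succ_ne_zero d)]

theorem sum_interaction_zero (C : Fin (q + 1) → ℝ) :
    ∑ j, interaction q k d 0 j * C j = tParam q k d * totalWeight q k d C := by
  simp only [Fin.sum_univ_succ, interaction, totalWeight, if_true, Fin.succ_ne_zero, if_false,
    mul_add, Finset.mul_sum]
  ring

theorem sum_interaction_succ (C : Fin (q + 1) → ℝ) (i : Fin q) :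
    ∑ j, interaction q k d i.succ j * C j = totalWeight q k d C - C i.succ := by
  have hterm : ∀ j : Fin q, (if i = j then (0 : ℝ) else 1) * C j.succ
      = C j.succ - if i = j then C j.succ else 0 := fun j => by split_ifs <;> simp
  simp only [Fin.sum_univ_succ, interaction, totalWeight, if_true, Fin.succ_ne_zero, if_false,
    Fin.succ_inj, hterm, Finset.sum_sub_distrib, Finset.sum_ite_eq, Finset.mem_univ]
  ring

theorem pairing_eq (R C : Fin (q + 1) → ℝ) :
    pairing q k d R C = totalWeight q k d R * totalWeight q k d C
      - ∑ i : Fin q, R i.succ * C i.succ := by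
  rw [pairing, Fin.sum_univ_succ, sum_interaction_zero]
  simp only [sum_interaction_succ, mul_sub, Finset.sum_sub_distrib, ← Finset.sum_mul]
  rw [totalWeight.eq_def q k d R]
  ring

theorem isPosFixpoint_iff : IsPosFixpoint q k d R C ↔
    (∀ i, 0 < R i) ∧ (∀ i, 0 < C i) ∧ IsMessageUpdate q k d R C ∧ IsMessageUpdate q k d C R := by
  have herase : ∀ (C : Fin (q + 1) → ℝ) (i : Fin q), tParam q k d * C 0
      + ∑ j ∈ Finset.univ.erase i, C j.succ = totalWeight q k d C - C i.succ := fun C i => by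
    rw [Finset.sum_erase_eq_sub (Finset.mem_univ i), totalWeight]
    ring
  simp only [IsMessageUpdate, ← herase]
  exact ⟨fun ⟨hR, hC, hRC, hCR⟩ => ⟨hR, hC, hRC, hCR⟩,
    fun ⟨hR, hC, hRC, hCR⟩ => ⟨hR, hC, hRC, hCR⟩⟩

theorem totalWeight_pos (hw : (q : ℝ) < (q : ℝ) ^ k) (hR : ∀ i, 0 < R i) :
    0 < totalWeight q k d R :=
  add_pos_of_pos_of_nonneg (mul_pos (tParam_pos hw) (hR 0))
    (Finset.sum_nonneg fun _ _ => (hR _).le)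

theorem message_le_totalWeight (hw : (q : ℝ) < (q : ℝ) ^ k) (hR : ∀ i, 0 < R i) (i : Fin q) :
    R i.succ ≤ totalWeight q k d R :=
  (Finset.single_le_sum (f := fun j : Fin q => R j.succ) (fun _ _ => (hR _).le)
    (Finset.mem_univ i)).trans (le_add_of_nonneg_left (mul_pos (tParam_pos hw) (hR 0)).le)

/-- The special colour alone has weight `t R₀ ≥ t ^ Δ Rᵢ`. -/
theorem normalized_le (hw : (q : ℝ) < (q : ℝ) ^ k) (hR : ∀ i, 0 < R i) (hC : ∀ i, 0 < C i)
    (h : IsMessageUpdate q k d R C) (i : Fin q) :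
    normalized q k d R i ≤ ((q : ℝ) ^ k - q)⁻¹ := by
  obtain ⟨A, h₀, hsucc⟩ := h
  have ht := tParam_pos (d := d) hw
  have hχ := totalWeight_pos (d := d) hw hC
  have hA : 0 < A := (pos_iff_pos_of_mul_pos (h₀ ▸ hR 0)).2 (by positivity)
  have hmessage : R i.succ ≤ A * totalWeight q k d C ^ d := by
    rw [hsucc]
    have := sub_nonneg.2 (message_le_totalWeight (d := d) hw hC i)
    gcongr
    exact sub_le_self _ (hC _).le
  rw [normalized, div_le_iff₀ (totalWeight_pos hw hR), inv_mul_eq_div, le_div_iff₀ (sub_pos.2 hw)]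
  calc R i.succ * ((q : ℝ) ^ k - q) ≤ A * totalWeight q k d C ^ d * ((q : ℝ) ^ k - q) := by
        gcongr
    _ = tParam q k d * R 0 := by
        rw [h₀, ← tParam_pow hw (d := d)]
        ring
    _ ≤ totalWeight q k d R := le_add_of_nonneg_right (Finset.sum_nonneg fun _ _ => (hR _).le)

theorem IsPosFixpoint.normalized_mem {c : ℝ} (hw : (q : ℝ) < (q : ℝ) ^ k)
    (hc : ((q : ℝ) ^ k - q)⁻¹ ≤ c) (h : IsPosFixpoint q k d R C) (i : Fin q) :
    normalized q k d R i ∈ Set.Icc 0 c ∧ normalized q k d C i ∈ Set.Icc 0 c := by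
  obtain ⟨hR, hC, hRC, hCR⟩ := isPosFixpoint_iff.1 h
  exact ⟨⟨(div_pos (hR _) (totalWeight_pos hw hR)).le, (normalized_le hw hR hC hRC i).trans hc⟩,
    (div_pos (hC _) (totalWeight_pos hw hC)).le, (normalized_le hw hC hR hCR i).trans hc⟩

theorem scale_mean_normalized (hw : (q : ℝ) < (q : ℝ) ^ k) (hq : q ≠ 0) (hR : ∀ i, 0 < R i) :
    scale q ((q : ℝ) ^ k - q) (∑ i, (q : ℝ)⁻¹ * normalized q k d R i)
      = R 0 / (tParam q k d ^ d * totalWeight q k d R) := by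
  have hq' : (q : ℝ) ≠ 0 := Nat.cast_ne_zero.2 hq
  have ht := tParam_pos (d := d) hw
  have hρ := totalWeight_pos (d := d) hw hR
  have hspecial : 1 - q * ∑ i, (q : ℝ)⁻¹ * normalized q k d R i
      = tParam q k d * R 0 / totalWeight q k d R := by
    rw [← Finset.mul_sum, mul_inv_cancel_left₀ hq']
    simp only [normalized]
    rw [← Finset.sum_div, eq_div_iff hρ.ne', sub_mul, div_mul_cancel₀ _ hρ.ne', one_mul]
    exact sub_eq_of_eq_add rfl
  rw [scale, hspecial, ← tParam_pow hw (d := d), pow_succ]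
  field_simp

theorem sum_rpow_phaseExp_pos (hR : ∀ i, 0 < R i) : 0 < ∑ i, R i ^ phaseExp d :=
  Finset.sum_pos (fun i _ => Real.rpow_pos_of_pos (hR i) _) Finset.univ_nonempty

theorem sum_rpow_eq (hd : 0 < d) (hq : q ≠ 0) (hw : (q : ℝ) < (q : ℝ) ^ k) (hR : ∀ i, 0 < R i) :
    ∑ i, R i ^ phaseExp d = totalWeight q k d R ^ phaseExp d
      * normPow d q ((q : ℝ) ^ k - q) (∑ i, (q : ℝ)⁻¹ * normalized q k d R i,
        ∑ i, (q : ℝ)⁻¹ * normalized q k d R i ^ phaseExp d) := by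
  have hq' : (q : ℝ) ≠ 0 := Nat.cast_ne_zero.2 hq
  have ht := tParam_pos (d := d) hw
  have hρ := totalWeight_pos (d := d) hw hR
  have hρp := (Real.rpow_pos_of_pos hρ (phaseExp d)).ne'
  simp only [normPow, scale_mean_normalized hw hq hR]
  rw [← Finset.mul_sum, mul_inv_cancel_left₀ hq', mul_add, Finset.mul_sum, Fin.sum_univ_succ]
  congr 1
  · have hexp : (tParam q k d ^ d) ^ phaseExp d = (q : ℝ) ^ k - q := by
      rw [← tParam_pow hw (d := d), ← Real.rpow_natCast, ← Real.rpow_natCast, ← Real.rpow_mul ht.le,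
        mul_div_cancel₀ _ (Nat.cast_ne_zero.2 hd.ne')]
      norm_cast
    have hw' := (sub_pos.2 hw).ne'
    rw [Real.div_rpow (hR 0).le (by positivity), Real.mul_rpow (by positivity) hρ.le, hexp]
    field_simp
  · refine Finset.sum_congr rfl fun i _ => ?_
    rw [normalized, Real.div_rpow (hR _).le hρ.le, mul_div_cancel₀ _ hρp]

theorem pairing_eq_mul (hq : q ≠ 0) (hw : (q : ℝ) < (q : ℝ) ^ k) (hR : ∀ i, 0 < R i)
    (hC : ∀ i, 0 < C i) : pairing q k d R C = totalWeight q k d R * totalWeight q k d C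
      * (1 - q * ∑ i, (q : ℝ)⁻¹ * (normalized q k d R i * normalized q k d C i)) := by
  have hρ := totalWeight_pos (d := d) hw hR
  have hχ := totalWeight_pos (d := d) hw hC
  rw [pairing_eq, ← Finset.mul_sum, mul_inv_cancel_left₀ (Nat.cast_ne_zero.2 hq), mul_sub, mul_one,
    Finset.mul_sum]
  congr 1
  refine Finset.sum_congr rfl fun i _ => ?_
  rw [normalized, normalized]
  field_simp

theorem pairing_pos (hw : (q : ℝ) < (q : ℝ) ^ k) (hR : ∀ i, 0 < R i) (hC : ∀ i, 0 < C i) :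
    0 < pairing q k d R C := by
  rw [pairing, Fin.sum_univ_succ, sum_interaction_zero]
  refine add_pos_of_pos_of_nonneg
    (mul_pos (hR 0) (mul_pos (tParam_pos hw) (totalWeight_pos hw hC)))
    (Finset.sum_nonneg fun i _ => ?_)
  rw [sum_interaction_succ]
  exact mul_nonneg (hR _).le (sub_nonneg.2 (message_le_totalWeight hw hC i))

theorem messageRate_eq (hd : 0 < d) (hq : q ≠ 0) (hw : (q : ℝ) < (q : ℝ) ^ k) (hR : ∀ i, 0 < R i)
    (hC : ∀ i, 0 < C i) :
    messageRate q k d R C = rate d q ((q : ℝ) ^ k - q) (colourMoments q k d R C) := by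
  have hd' : (d : ℝ) ≠ 0 := Nat.cast_ne_zero.2 hd.ne'
  have hlog : ∀ {R : Fin (q + 1) → ℝ}, (∀ i, 0 < R i) → d * Real.log (∑ i, R i ^ phaseExp d)
      = ((d : ℝ) + 1) * Real.log (totalWeight q k d R)
        + d * Real.log (normPow d q ((q : ℝ) ^ k - q) (∑ i, (q : ℝ)⁻¹ * normalized q k d R i,
          ∑ i, (q : ℝ)⁻¹ * normalized q k d R i ^ phaseExp d)) := fun {R} hR => by
    have hρ := totalWeight_pos (d := d) hw hR
    have hpos := sum_rpow_phaseExp_pos (d := d) hR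
    rw [sum_rpow_eq hd hq hw hR] at hpos ⊢
    rw [Real.log_mul (Real.rpow_pos_of_pos hρ _).ne' (right_ne_zero_of_mul hpos.ne'),
      Real.log_rpow hρ, mul_add, ← mul_assoc, mul_div_cancel₀ _ hd']
  have hpair := pairing_pos (d := d) hw hR hC
  rw [messageRate, hlog hR, hlog hC, rate, colourMoments, meanMoments_eq]
  rw [pairing_eq_mul hq hw hR hC] at hpair ⊢
  rw [Real.log_mul (left_ne_zero_of_mul hpair.ne') (right_ne_zero_of_mul hpair.ne'),
    Real.log_mul (totalWeight_pos hw hR).ne' (totalWeight_pos hw hC).ne']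
  ring

theorem hasType_of_two_values {R : Fin (q + 1) → ℝ} {a b : ℝ} (hq : Even q) (hq0 : q ≠ 0)
    (hab : a ≠ b) (hval : ∀ i : Fin q, R i.succ = a ∨ R i.succ = b)
    (ha : (Finset.univ.filter fun i : Fin q => R i.succ = a).card = q / 2) :
    HasType R (q / 2) (q / 2) 0 := by
  have hhalf : 0 < q / 2 := Nat.div_pos (by obtain ⟨n, rfl⟩ := hq; omega) two_pos
  have hb : (Finset.univ.filter fun i : Fin q => R i.succ = b).card = q / 2 := by
    have hcompl : (Finset.univ.filter fun i : Fin q => R i.succ = b)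
        = Finset.univ.filter fun i : Fin q => ¬ R i.succ = a :=
      Finset.filter_congr fun i _ =>
        ⟨fun hib hia => hab (hia.symm.trans hib), (hval i).resolve_left⟩
    have hadd := Finset.card_filter_add_card_filter_not (s := (Finset.univ : Finset (Fin q)))
      (fun i : Fin q => R i.succ = a)
    rw [ha, ← hcompl, Finset.card_univ, Fintype.card_fin] at hadd
    obtain ⟨n, rfl⟩ := hq
    omega
  have himage : (Finset.univ.image fun i : Fin q => R i.succ) = {a, b} := by
    refine Finset.Subset.antisymm (fun v hv => ?_) ?_
    · obtain ⟨i, -, rfl⟩ := Finset.mem_image.1 hv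
      simpa using hval i
    · have hmem : ∀ v, (Finset.univ.filter fun i : Fin q => R i.succ = v).card = q / 2 →
          v ∈ Finset.univ.image fun i : Fin q => R i.succ := fun v hv => by
        obtain ⟨i, hi⟩ := Finset.card_pos.1 (hv ▸ hhalf)
        exact Finset.mem_image.2 ⟨i, Finset.mem_univ i, (Finset.mem_filter.1 hi).2⟩
      exact Finset.insert_subset (hmem a ha) (Finset.singleton_subset_iff.2 (hmem b hb))
  rw [HasType, himage, Finset.insert_val_of_notMem (by simpa using hab)]
  simp [ha, hb, hhalf.ne']

end Messages

section Balanced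

variable {q k d : ℕ} {A a b c : ℝ} {R C : Fin (q + 1) → ℝ}

/-- The message vector with message `A t ^ d` for the colour `0`, message `a` for the first half of
the colours `1, …, q`, and message `b` for the second half. -/
noncomputable def balancedMessages (q k d : ℕ) (A a b : ℝ) : Fin (q + 1) → ℝ :=
  Fin.cons (A * tParam q k d ^ d) fun i : Fin q => if i.val < q / 2 then a else b

theorem card_filter_val_lt_half (q : ℕ) :
    (Finset.univ.filter fun i : Fin q => i.val < q / 2).card = q / 2 := by
  rw [Fin.card_filter_val_lt]
  omega

theorem sum_ite_val_lt_half {E : Type*} [AddCommGroup E] [Module ℝ E] (hq : Even q) (x y : E) :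
    ∑ i : Fin q, (if i.val < q / 2 then x else y) = ((q : ℝ) / 2) • x + ((q : ℝ) / 2) • y := by
  have hcompl := Finset.card_filter_add_card_filter_not (s := (Finset.univ : Finset (Fin q)))
    (fun i : Fin q => i.val < q / 2)
  obtain ⟨n, rfl⟩ := hq
  rw [card_filter_val_lt_half, Finset.card_univ, Fintype.card_fin] at hcompl
  have hhalf : (((n + n : ℕ) : ℝ) / 2) = n := by push_cast; ring
  rw [Finset.sum_ite, Finset.sum_const, Finset.sum_const, card_filter_val_lt_half, hhalf,
    ← Nat.cast_smul_eq_nsmul ℝ, ← Nat.cast_smul_eq_nsmul ℝ]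
  congr 3 <;> omega

theorem balancedMessages_pos (hw : (q : ℝ) < (q : ℝ) ^ k) (hA : 0 < A) (ha : 0 < a) (hb : 0 < b)
    (i : Fin (q + 1)) : 0 < balancedMessages q k d A a b i := by
  have ht := tParam_pos (d := d) hw
  refine Fin.cases ?_ (fun i => ?_) i
  · exact mul_pos hA (pow_pos ht d)
  · simp only [balancedMessages, Fin.cons_succ]
    split_ifs <;> assumption

theorem totalWeight_balancedMessages (hq : Even q) (hw : (q : ℝ) < (q : ℝ) ^ k) :
    totalWeight q k d (balancedMessages q k d A a b)
      = A * ((q : ℝ) ^ k - q) + q / 2 * (a + b) := by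
  simp only [totalWeight, balancedMessages, Fin.cons_zero, Fin.cons_succ, sum_ite_val_lt_half hq,
    smul_eq_mul, ← tParam_pow hw (d := d)]
  ring

theorem isMessageUpdate_balancedMessages
    (hba : totalWeight q k d (balancedMessages q k d A b a) = 1)
    (ha : a = A * (1 - b) ^ d) (hb : b = A * (1 - a) ^ d) :
    IsMessageUpdate q k d (balancedMessages q k d A a b) (balancedMessages q k d A b a) := by
  refine ⟨A, by rw [hba]; simp [balancedMessages], fun i => ?_⟩
  rw [hba]
  simp only [balancedMessages, Fin.cons_succ]
  split_ifs <;> assumption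

theorem isPosFixpoint_balancedMessages (hq : Even q) (hw : (q : ℝ) < (q : ℝ) ^ k) (hA : 0 < A)
    (h : IsTwoCycle d A a b) (hmass : A * ((q : ℝ) ^ k - q) + q / 2 * (a + b) = 1) :
    IsPosFixpoint q k d (balancedMessages q k d A a b) (balancedMessages q k d A b a) := by
  have hab : totalWeight q k d (balancedMessages q k d A a b) = 1 := by
    rw [totalWeight_balancedMessages hq hw, hmass]
  have hba : totalWeight q k d (balancedMessages q k d A b a) = 1 := by
    rw [totalWeight_balancedMessages hq hw, add_comm b, hmass]
  exact isPosFixpoint_iff.2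
    ⟨balancedMessages_pos hw hA (h.pos.trans h.lt) h.pos,
      balancedMessages_pos hw hA h.pos (h.pos.trans h.lt),
      isMessageUpdate_balancedMessages hba h.left_eq h.right_eq,
      isMessageUpdate_balancedMessages hab h.right_eq h.left_eq⟩

theorem colourMoments_balancedMessages (hq : Even q) (hq0 : q ≠ 0) (hw : (q : ℝ) < (q : ℝ) ^ k)
    (hmass : A * ((q : ℝ) ^ k - q) + q / 2 * (a + b) = 1) :
    colourMoments q k d (balancedMessages q k d A a b) (balancedMessages q k d A b a)
      = (1 / 2 : ℝ) • moments d a b + (1 / 2 : ℝ) • moments d b a := by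
  have hterm : ∀ i : Fin q, (q : ℝ)⁻¹ • moments d
      (normalized q k d (balancedMessages q k d A a b) i)
      (normalized q k d (balancedMessages q k d A b a) i)
      = if i.val < q / 2 then (q : ℝ)⁻¹ • moments d a b else (q : ℝ)⁻¹ • moments d b a :=
      fun i => by
    simp only [normalized, totalWeight_balancedMessages hq hw, add_comm b a, hmass, div_one]
    simp only [balancedMessages, Fin.cons_succ]
    split_ifs <;> rfl
  have hhalf : (q : ℝ) / 2 * (q : ℝ)⁻¹ = 1 / 2 := by field_simp
  rw [colourMoments, meanMoments, Finset.sum_congr rfl fun i _ => hterm i, sum_ite_val_lt_half hq,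
    smul_smul, smul_smul, hhalf]

theorem hasType_balancedMessages (hq : Even q) (hq0 : q ≠ 0) (hab : a ≠ b) :
    HasType (balancedMessages q k d A a b) (q / 2) (q / 2) 0 := by
  refine hasType_of_two_values hq hq0 hab (fun i => ?_) ?_
  · simp only [balancedMessages, Fin.cons_succ]
    split_ifs <;> simp
  · rw [← card_filter_val_lt_half q]
    congr 1
    refine Finset.filter_congr fun i _ => ?_
    simp only [balancedMessages, Fin.cons_succ]
    split_ifs with hi <;> simp [hi, hab.symm]

theorem IsMessageBox.exists_isTwoCycle_isMaxOn {q w : ℝ} (hbox : IsMessageBox q w c) (hd : 2 ≤ d)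
    (hdw : 5 * (w + q) ≤ d) : ∃ A a b : ℝ, IsTwoCycle d A a b ∧ 0 < A ∧
      A * w + q / 2 * (a + b) = 1 ∧ IsMaxOn (rate d q w) (momentHull d c)
        ((1 / 2 : ℝ) • moments d a b + (1 / 2 : ℝ) • moments d b a) := by
  obtain ⟨m, hm, hmax⟩ := exists_isMaxOn_rate d hbox
  obtain ⟨ι, _, s, z, hs, hs1, hz, rfl⟩ := mem_convexHull_iff_exists_fintype.1 hm
  choose u hu huz using hz
  have hsum : ∑ i, s i • z i = meanMoments d s (fun i => (u i).1) fun i => (u i).2 :=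
    Finset.sum_congr rfl fun i _ => by rw [← huz]
  have hopt : IsOptimalMixture d q w c s (fun i => (u i).1) fun i => (u i).2 :=
    ⟨hbox, hs, hs1, fun i => (hu i).1, fun i => (hu i).2, hsum ▸ hmax⟩
  obtain ⟨A, a, b, hcycle, hA, hmass, -, -, hmean⟩ := hopt.exists_balanced hd hdw
  exact ⟨A, a, b, hcycle, hA, hmass, by rwa [← hmean, ← hsum]⟩

theorem colourMoments_mem_momentHull (hq : q ≠ 0) (hw : (q : ℝ) < (q : ℝ) ^ k)
    (hc : ((q : ℝ) ^ k - q)⁻¹ ≤ c) (h : IsPosFixpoint q k d R C) :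
    colourMoments q k d R C ∈ momentHull d c :=
  meanMoments_mem_momentHull (fun _ => by positivity) (by simp [hq])
    (fun i => (h.normalized_mem hw hc i).1) fun i => (h.normalized_mem hw hc i).2

theorem IsPosFixpoint.hasType_of_isMaxOn (h : IsPosFixpoint q k d R C) (hq : Even q)
    (hbox : IsMessageBox q ((q : ℝ) ^ k - q) c) (hd : 2 ≤ d) (hdw : 5 * (q : ℝ) ^ k ≤ d)
    (hmax : IsMaxOn (rate d q ((q : ℝ) ^ k - q)) (momentHull d c) (colourMoments q k d R C)) :
    HasType R (q / 2) (q / 2) 0 := by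
  have hq0 : q ≠ 0 := Nat.cast_ne_zero.1 hbox.q_pos.ne'
  have hw := sub_pos.1 hbox.w_pos
  have hmem := h.normalized_mem hw hbox.inv_lt.le
  have hopt : IsOptimalMixture d q ((q : ℝ) ^ k - q) c (fun _ : Fin q => (q : ℝ)⁻¹)
      (normalized q k d R) (normalized q k d C) :=
    ⟨hbox, fun _ => by positivity, by simp [hq0], fun i => (hmem i).1, fun i => (hmem i).2, hmax⟩
  obtain ⟨A, a, b, hcycle, -, -, hval, hhalf, -⟩ := hopt.exists_balanced hd (by linarith)
  have hρ := totalWeight_pos (d := d) hw h.R_pos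
  have hiff : ∀ i v, R i.succ = v * totalWeight q k d R ↔ normalized q k d R i = v := fun i v =>
    (div_eq_iff hρ.ne').symm
  refine hasType_of_two_values hq hq0
    (fun hab => hcycle.lt.ne' (mul_right_cancel₀ hρ.ne' hab))
    (fun i => by
      simpa only [hiff] using (hval i (inv_pos.2 hbox.q_pos)).imp And.left And.left) ?_
  simp only [hiff]
  rw [Finset.sum_ite, Finset.sum_const_zero, add_zero, Finset.sum_const, nsmul_eq_mul,
    ← div_eq_mul_inv, div_eq_iff hbox.q_pos.ne'] at hhalf
  obtain ⟨n, rfl⟩ := hq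
  have hcard : ((Finset.univ.filter fun i => normalized (n + n) k d R i = a).card : ℝ) = n := by
    rw [hhalf]
    push_cast
    ring
  rw [Nat.cast_inj.1 hcard]
  omega

theorem isMessageBox_colours (hq : 4 ≤ q) (hk : 2 ≤ k) :
    IsMessageBox q ((q : ℝ) ^ k - q) (2 * (q : ℝ))⁻¹ := by
  have hq' : (4 : ℝ) ≤ q := by exact_mod_cast hq
  have hsq : (q : ℝ) ^ 2 ≤ (q : ℝ) ^ k := pow_le_pow_right₀ (by linarith) hk
  have hlt : 2 * (q : ℝ) < (q : ℝ) ^ k - q := by nlinarith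
  refine ⟨by linarith, by linarith, ?_, ?_, ?_⟩
  · exact inv_strictAnti₀ (by linarith) hlt
  · exact inv_lt_one_of_one_lt₀ (by linarith)
  · rw [mul_inv_lt_iff₀ (by linarith)]
    linarith

theorem exists_isPosFixpoint_messageRate_max (hq : 4 ≤ q) (hq_even : Even q) (hk : 2 ≤ k)
    (hd : 5 * q ^ k ≤ d) :
    ∃ R C : Fin (q + 1) → ℝ, IsPosFixpoint q k d R C ∧ HasType R (q / 2) (q / 2) 0 ∧
      ∀ R' C' : Fin (q + 1) → ℝ, IsPosFixpoint q k d R' C' →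
        messageRate q k d R' C' ≤ messageRate q k d R C ∧
        (messageRate q k d R' C' = messageRate q k d R C → HasType R' (q / 2) (q / 2) 0) := by
  have hq0 : q ≠ 0 := by omega
  have hd2 : 2 ≤ d := by
    have := Nat.one_le_pow k q (by omega)
    omega
  have hd' : 5 * (q : ℝ) ^ k ≤ d := by exact_mod_cast hd
  have hbox := isMessageBox_colours hq hk
  have hw := sub_pos.1 hbox.w_pos
  obtain ⟨A, a, b, hcycle, hA, hmass, hmax⟩ :=
    hbox.exists_isTwoCycle_isMaxOn hd2 (by linarith)
  have hfix := isPosFixpoint_balancedMessages hq_even hw hA hcycle hmass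
  refine ⟨_, _, hfix, hasType_balancedMessages hq_even hq0 hcycle.lt.ne', fun R C h => ?_⟩
  rw [← colourMoments_balancedMessages hq_even hq0 hw hmass] at hmax
  rw [messageRate_eq (by omega) hq0 hw h.R_pos h.C_pos,
    messageRate_eq (by omega) hq0 hw hfix.R_pos hfix.C_pos]
  refine ⟨hmax (colourMoments_mem_momentHull hq0 hw hbox.inv_lt.le h), fun heq => ?_⟩
  refine h.hasType_of_isMaxOn hq_even hbox hd2 hd' fun m hm => ?_
  exact (hmax hm).trans_eq heq.symm

end Balanced

section FixpointRate

variable {q k d : ℕ} {R C : Fin (q + 1) → ℝ}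

theorem interaction_nonneg (hw : (q : ℝ) < (q : ℝ) ^ k) (i j : Fin (q + 1)) :
    0 ≤ interaction q k d i j := by
  have ht := (tParam_pos (d := d) hw).le
  unfold interaction
  split_ifs <;> positivity

theorem interaction_symm (i j : Fin (q + 1)) : interaction q k d i j = interaction q k d j i := by
  simp only [interaction, eq_comm (a := i)]
  split_ifs <;> rfl

theorem interaction_zero_right_pos (hw : (q : ℝ) < (q : ℝ) ^ k) (i : Fin (q + 1)) :
    0 < interaction q k d i 0 := by
  have ht := tParam_pos (d := d) hw
  unfold interaction
  split_ifs <;> positivity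

theorem sum_interaction_pos (hw : (q : ℝ) < (q : ℝ) ^ k) (hC : ∀ i, 0 < C i) (i : Fin (q + 1)) :
    0 < ∑ j, interaction q k d i j * C j :=
  Finset.sum_pos' (fun j _ => mul_nonneg (interaction_nonneg hw i j) (hC j).le)
    ⟨0, Finset.mem_univ _, mul_pos (interaction_zero_right_pos hw i) (hC 0)⟩

theorem pairing_comm : pairing q k d R C = pairing q k d C R := by
  simp only [pairing, Finset.mul_sum]
  rw [Finset.sum_comm]
  refine Finset.sum_congr rfl fun j _ => Finset.sum_congr rfl fun i _ => ?_
  rw [interaction_symm i j]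
  ring

theorem phase_pos (hR : ∀ i, 0 < R i) (i : Fin (q + 1)) : 0 < phase d R i :=
  div_pos (Real.rpow_pos_of_pos (hR i) _) (sum_rpow_phaseExp_pos hR)

theorem sum_phase (hR : ∀ i, 0 < R i) : ∑ i, phase d R i = 1 := by
  simp only [phase, ← Finset.sum_div]
  exact div_self (sum_rpow_phaseExp_pos hR).ne'

theorem entropy_phase (hR : ∀ i, 0 < R i) :
    entropy (phase d R) = Real.log (∑ i, R i ^ phaseExp d)
      - phaseExp d * ∑ i, phase d R i * Real.log (R i) := by
  have hlog : ∀ i, Real.log (phase d R i)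
      = phaseExp d * Real.log (R i) - Real.log (∑ j, R j ^ phaseExp d) := fun i => by
    rw [phase, Real.log_div (Real.rpow_pos_of_pos (hR i) _).ne' (sum_rpow_phaseExp_pos hR).ne',
      Real.log_rpow (hR i)]
  simp only [entropy_eq_of_sum_eq_one (sum_phase hR), hlog, mul_sub, Finset.sum_sub_distrib,
    ← Finset.sum_mul, sum_phase hR, one_mul, Finset.mul_sum, mul_left_comm (phaseExp d), neg_sub]

namespace IsMessageUpdate

theorem exists_rpow_eq_mul_field (hd : 0 < d) (hw : (q : ℝ) < (q : ℝ) ^ k) (hR : ∀ i, 0 < R i)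
    (hC : ∀ i, 0 < C i) (h : IsMessageUpdate q k d R C) :
    ∃ c : ℝ, 0 < c ∧ ∀ i, R i ^ (1 / (d : ℝ)) = c * ∑ j, interaction q k d i j * C j := by
  obtain ⟨A, hzero, hsucc⟩ := h
  have hfield := sum_interaction_pos (d := d) hw hC
  have hR_eq : ∀ i, R i = A * (∑ j, interaction q k d i j * C j) ^ d := fun i => by
    induction i using Fin.cases with
    | zero => rw [sum_interaction_zero, mul_pow, hzero]
    | succ i => rw [sum_interaction_succ, hsucc]
  have hA : 0 < A := pos_of_mul_pos_left (hR_eq 0 ▸ hR 0) (pow_pos (hfield 0) d).le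
  refine ⟨A ^ (1 / (d : ℝ)), Real.rpow_pos_of_pos hA _, fun i => ?_⟩
  rw [hR_eq, Real.mul_rpow hA.le (pow_nonneg (hfield i).le d), one_div,
    Real.pow_rpow_inv_natCast (hfield i).le hd.ne']

theorem phase_mul_pairing (hd : 0 < d) (hw : (q : ℝ) < (q : ℝ) ^ k) (hR : ∀ i, 0 < R i)
    (hC : ∀ i, 0 < C i) (h : IsMessageUpdate q k d R C) (i : Fin (q + 1)) :
    phase d R i * pairing q k d R C = R i * ∑ j, interaction q k d i j * C j := by
  obtain ⟨c, hc, hroot⟩ := h.exists_rpow_eq_mul_field hd hw hR hC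
  have hpow : ∀ i, R i ^ phaseExp d = c * (R i * ∑ j, interaction q k d i j * C j) := fun i => by
    have hd' : (d : ℝ) ≠ 0 := Nat.cast_ne_zero.2 hd.ne'
    rw [phaseExp, add_div, div_self hd', Real.rpow_one_add' (hR i).le (by positivity), hroot]
    ring
  have hpairing := pairing_pos (d := d) hw hR hC
  have hsum : ∑ i, R i ^ phaseExp d = c * pairing q k d R C := by
    simp only [hpow, pairing, Finset.mul_sum]
  rw [phase, hsum, hpow]
  field_simp

theorem sum_phase_mul_log_field (hd : 0 < d) (hw : (q : ℝ) < (q : ℝ) ^ k) (hR : ∀ i, 0 < R i)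
    (hC : ∀ i, 0 < C i) (h : IsMessageUpdate q k d R C) :
    ∑ i, phase d R i * Real.log (∑ j, interaction q k d i j * C j)
      = Real.log (pairing q k d R C) - entropy (phase d R)
        - ∑ i, phase d R i * Real.log (R i) := by
  have hlog : ∀ i, Real.log (∑ j, interaction q k d i j * C j)
      = Real.log (pairing q k d R C) + Real.log (phase d R i) - Real.log (R i) := fun i => by
    have hlog := congrArg Real.log (h.phase_mul_pairing hd hw hR hC i)
    rw [Real.log_mul (phase_pos hR i).ne' (pairing_pos hw hR hC).ne',
      Real.log_mul (hR i).ne' (sum_interaction_pos hw hC i).ne'] at hlog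
    linarith
  simp only [hlog, mul_sub, mul_add, Finset.sum_sub_distrib, Finset.sum_add_distrib,
    ← Finset.sum_mul, sum_phase hR, one_mul, entropy_eq_of_sum_eq_one (sum_phase hR),
    sub_neg_eq_add]

end IsMessageUpdate

namespace IsPosFixpoint

/-- At a fixpoint the edge distribution is proportional to `R i * B i j * C j`. -/
theorem sum_edgeDistribution (hd : 0 < d) (hw : (q : ℝ) < (q : ℝ) ^ k)
    (h : IsPosFixpoint q k d R C) (j : Fin (q + 1)) :
    ∑ i, edgeDistribution (interaction q k d) (phase d R) C i j = phase d C j := by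
  obtain ⟨hR, hC, hRC, hCR⟩ := isPosFixpoint_iff.1 h
  have hpairing := pairing_pos (d := d) hw hR hC
  have hedge : ∀ i, edgeDistribution (interaction q k d) (phase d R) C i j
      = C j * (interaction q k d j i * R i) / pairing q k d R C := fun i => by
    have hfield := sum_interaction_pos (d := d) hw hC i
    rw [edgeDistribution, eq_div_iff hpairing.ne', interaction_symm j i, mul_right_comm,
      hRC.phase_mul_pairing hd hw hR hC]
    field_simp
  rw [Finset.sum_congr rfl fun i _ => hedge i, ← Finset.sum_div, ← Finset.mul_sum,
    ← hCR.phase_mul_pairing hd hw hC hR, pairing_comm, mul_div_cancel_right₀ _ hpairing.ne']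

theorem tiltedRate_eq (hd : 0 < d) (hw : (q : ℝ) < (q : ℝ) ^ k) (h : IsPosFixpoint q k d R C) :
    tiltedRate (interaction q k d) (d + 1) (phase d R) (phase d C) C = messageRate q k d R C := by
  obtain ⟨hR, hC, hRC, -⟩ := isPosFixpoint_iff.1 h
  have hd' : (d : ℝ) ≠ 0 := Nat.cast_ne_zero.2 hd.ne'
  rw [tiltedRate, hRC.sum_phase_mul_log_field hd hw hR hC, entropy_phase hR, entropy_phase hC,
    messageRate, phaseExp]
  push_cast
  field_simp
  ring

theorem tendsto_logFirstMoment (hd : 0 < d) (hw : (q : ℝ) < (q : ℝ) ^ k)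
    (h : IsPosFixpoint q k d R C) :
    Tendsto (logFirstMoment (interaction q k d) (d + 1)) (phaseFilter (phase d R) (phase d C))
      (𝓝 (messageRate q k d R C)) := by
  have hB₀ := interaction_zero_right_pos (d := d) hw
  exact h.tiltedRate_eq hd hw ▸ HypergraphColouring.tendsto_logFirstMoment d.succ_pos
    (phase_pos h.R_pos) (interaction_nonneg hw) hB₀ (fun j => interaction_symm j 0 ▸ hB₀ j)
    h.C_pos (h.sum_edgeDistribution hd hw)

theorem psi1At_eq (hd : 0 < d) (hw : (q : ℝ) < (q : ℝ) ^ k) (h : IsPosFixpoint q k d R C) :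
    psi1At q k d R C = messageRate q k d R C :=
  have := phaseFilter_neBot (phase_pos (d := d) h.R_pos) (sum_phase h.R_pos)
    (phase_pos (d := d) h.C_pos) (sum_phase h.C_pos)
  (h.tendsto_logFirstMoment hd hw).limUnder_eq

end IsPosFixpoint

end FixpointRate

end HypergraphColouring

theorem mainTheorem3_general (q k d : ℕ) (hq : 4 ≤ q) (hq_even : Even q) (hk : 2 ≤ k)
    (hd : 5 * q ^ k ≤ d) :
    (∀ R C : Fin (q + 1) → ℝ, IsPosFixpoint q k d R C →
      Filter.Tendsto (logFirstMoment (interaction q k d) (d + 1))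
        (phaseFilter (phase d R) (phase d C)) (nhds (psi1At q k d R C))) ∧
    ∃ R C : Fin (q + 1) → ℝ, IsPosFixpoint q k d R C ∧ HasType R (q / 2) (q / 2) 0 ∧
      ∀ R' C' : Fin (q + 1) → ℝ, IsPosFixpoint q k d R' C' →
        psi1At q k d R' C' ≤ psi1At q k d R C ∧
        (psi1At q k d R' C' = psi1At q k d R C → HasType R' (q / 2) (q / 2) 0) := by
  have hw := sub_pos.1 (isMessageBox_colours hq hk).w_pos
  have hd0 : 0 < d := (by positivity : 0 < 5 * q ^ k).trans_le hd
  refine ⟨fun R C h => ?_, ?_⟩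
  · rw [h.psi1At_eq hd0 hw]
    exact h.tendsto_logFirstMoment hd0 hw
  · obtain ⟨R, C, hfix, htype, hmax⟩ := exists_isPosFixpoint_messageRate_max hq hq_even hk hd
    refine ⟨R, C, hfix, htype, fun R₁ C₁ h => ?_⟩
    rw [h.psi1At_eq hd0 hw, hfix.psi1At_eq hd0 hw]
    exact hmax R₁ C₁ h

/-- For even `q ≥ 4`, `k ≥ 2` and `d = 5q^k`: the limit defining `Ψ₁` exists at every positive
fixpoint of the tree recursion; the maximum of `Ψ₁` over the positive fixpoints is attained at a
fixpoint of type `(q/2, q/2, 0)`, and only at fixpoints of that type. -/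
theorem mainTheorem3 (q k d : ℕ) (hq : 4 ≤ q) (hq_even : Even q) (hk : 2 ≤ k)
    (hd : d = 5 * q ^ k) :
    (∀ R C : Fin (q + 1) → ℝ, IsPosFixpoint q k d R C →
      Filter.Tendsto (logFirstMoment (interaction q k d) (d + 1))
        (phaseFilter (phase d R) (phase d C)) (nhds (psi1At q k d R C))) ∧
    ∃ R C : Fin (q + 1) → ℝ, IsPosFixpoint q k d R C ∧ HasType R (q / 2) (q / 2) 0 ∧
      ∀ R' C' : Fin (q + 1) → ℝ, IsPosFixpoint q k d R' C' →
        psi1At q k d R' C' ≤ psi1At q k d R C ∧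
        (psi1At q k d R' C' = psi1At q k d R C → HasType R' (q / 2) (q / 2) 0) :=
  mainTheorem3_general q k d hq hq_even hk hd.ge
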